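/- Let $m,c>0$ and $\beta,v_0\in\mathbb R$. For $\sigma>0$ let $\delta_\sigma(x)=\frac{1}{\sigma\sqrt{2\pi}}e^{-x^2/(2\sigma^2)}$. For a smooth function $f$ consider, for $x\in\mathbb R$, $t\ge 0$, the system $$\frac{\partial^2\phi}{\partial t^2}(x,t)=c^2\frac{\partial^2\phi}{\partial x^2}(x,t)+\beta f(x-y(t)),\qquad \phi(x,0)=0,\quad \phi_t(x,0)=0,$$ $$m\,y''(t)=\beta\,\frac{\partial}{\partial z}\int_{-\infty}^{\infty}\phi(x,t)f(x-z)\,dx\,\Big|_{z=y(t)},\qquad y(0)=0,\quad y'(0)=v_0,$$ where $\phi$ is $C^2$ on $\mathbb R\times[0,\infty)$, $y$ is $C^2$ on $[0,\infty)$ and the two differential equations hold for $t>0$. A solution of the system with $f=\delta$ is a pair $(\phi,y)$ with $\phi$ continuous on $\mathbb R\times[0,\infty)$, $\phi(x,0)=0$, $y$ of class $C^2$ on $[0,\infty)$, $y(0)=0$, $y'(0)=v_0$, such that the wave equation and its zero initial data hold weakly, $$\int_0^\infty\!\!\int_{\mathbb R}\phi\,(\psi_{tt}-c^2\psi_{xx})\,dx\,dt=\beta\int_0^\infty\psi(y(t),t)\,dt\qquad\text{for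 all }\psi\in C_c^\infty(\mathbb R^2),$$ and, for $t>0$, $m\,y''(t)=\lim_{\varepsilon\to0+}\beta\,\frac{\partial}{\partial z}\int\phi(x,t)\,\delta_\varepsilon(x-z)\,dx\,\big|_{z=y(t)}$. 1. For every $\sigma>0$ the system with $f=\delta_\sigma$ has a solution $(\phi_\sigma,y_\sigma)$ on the whole time interval $[0,\infty)$, and this solution is unique. 2. If $|v_0|<c$, there is a solution $(\phi,y)$ of the system with $f=\delta$ such that $v=y'$ is smooth and monotone on $[0,\infty)$, $\sup_{t\ge0}|v(t)|<c$ and, if $\beta\ne0$, $v(t)\to0$ exponentially fast as $t\to\infty$; it is the unique solution with $\sup_{t\ge0}|y'(t)|<c$. As $\sigma\to0+$, the solutions $(\phi_\sigma,y_\sigma)$ converge to $(\phi,y)$: for every $T>0$, $y_\sigma\to y$ and $y_\sigma'\to y'$ uniformly on $[0,T]$, and $\phi_\sigma\to\phi$ uniformly on $\mathbb R\times[0,T]$. -/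

import Mathlib

open Set Filter Topology MeasureTheory
open scoped ContDiff

noncomputable section

namespace PointParticle

/-- The Gaussian density with mean zero and standard deviation `σ`. -/
def gaussianDelta (σ x : ℝ) : ℝ :=
  1 / (σ * Real.sqrt (2 * Real.pi)) * Real.exp (-x ^ 2 / (2 * σ ^ 2))

/-- The velocity of a trajectory on `[0, ∞)` (one-sided derivative at `t = 0`). -/
def velocity (y : ℝ → ℝ) (t : ℝ) : ℝ := derivWithin y (Ici 0) t

/-- `F = β ∂/∂z ∫ u(x) f(x - z) dx` at the point `z = η`, where the integrals converge and the
derivative exists: the force at `η` in the field `u` for the smearing function `f`. -/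
def HasForce (β : ℝ) (f u : ℝ → ℝ) (η F : ℝ) : Prop :=
  (∀ z : ℝ, Integrable (fun x : ℝ => u x * f (x - z))) ∧
    HasDerivAt (fun z : ℝ => β * ∫ x : ℝ, u x * f (x - z)) F η

/-- Trajectories of class `C²` on `[0, ∞)` with `y(0) = 0` and `y'(0) = v₀`. -/
structure IsTrajectory (v₀ : ℝ) (y : ℝ → ℝ) : Prop where
  contDiffOn : ContDiffOn ℝ 2 y (Ici 0)
  position_zero : y 0 = 0
  velocity_zero : velocity y 0 = v₀

/-- Global classical solutions `(φ, y)`, on `x ∈ ℝ`, `t ∈ [0, ∞)`, of the system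
`φ_tt = c² φ_xx + β f(x - y(t))`, `m y'' = β ∂/∂y ∫ φ(x,t) f(x - y) dx` with
`φ(x,0) = φ_t(x,0) = 0`, `y(0) = 0`, `y'(0) = v₀`.
Values at negative times are irrelevant. -/
structure IsSmoothSolution (m c β v₀ : ℝ) (f : ℝ → ℝ) (φ : ℝ → ℝ → ℝ) (y : ℝ → ℝ) :
    Prop where
  field_contDiffOn : ContDiffOn ℝ 2 (fun p : ℝ × ℝ => φ p.1 p.2) (univ ×ˢ Ici 0)
  field_zero : ∀ x : ℝ, φ x 0 = 0
  field_deriv_zero : ∀ x : ℝ, derivWithin (fun s : ℝ => φ x s) (Ici 0) 0 = 0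
  wave : ∀ x t : ℝ, 0 < t →
    iteratedDeriv 2 (fun s : ℝ => φ x s) t =
      c ^ 2 * iteratedDeriv 2 (fun z : ℝ => φ z t) x + β * f (x - y t)
  trajectory : IsTrajectory v₀ y
  newton : ∀ t : ℝ, 0 < t →
    HasForce β f (fun x : ℝ => φ x t) (y t) (m * iteratedDeriv 2 y t)

/-- Weak form on `t ≥ 0` of `φ_tt = c² φ_xx + β δ(x - y(t))`, `φ(x,0) = φ_t(x,0) = 0`.
The test functions need not vanish near `t = 0`, which encodes both initial conditions. -/
def IsWeakDeltaField (c β : ℝ) (φ : ℝ → ℝ → ℝ) (y : ℝ → ℝ) : Prop :=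
  ∀ ψ : ℝ × ℝ → ℝ, ContDiff ℝ ∞ ψ → HasCompactSupport ψ →
    ∫ t in Ioi (0 : ℝ), ∫ x : ℝ, φ x t *
        (iteratedDeriv 2 (fun s : ℝ => ψ (x, s)) t -
          c ^ 2 * iteratedDeriv 2 (fun z : ℝ => ψ (z, t)) x) =
      β * ∫ t in Ioi (0 : ℝ), ψ (y t, t)

/-- Global solutions `(φ, y)` of the same system with `f = δ`. The field is continuous and solves
the wave equation weakly. It has a kink at `x = y(t)`, so the force `β ∂φ/∂x (y(t), t)` is
understood through the Gaussian approximation of `δ`, as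
`lim_{ε → 0+} β ∂/∂z ∫ φ(x,t) δ_ε(x - z) dx` at `z = y(t)`. -/
structure IsDeltaSolution (m c β v₀ : ℝ) (φ : ℝ → ℝ → ℝ) (y : ℝ → ℝ) : Prop where
  field_continuousOn : ContinuousOn (fun p : ℝ × ℝ => φ p.1 p.2) (univ ×ˢ Ici 0)
  field_zero : ∀ x : ℝ, φ x 0 = 0
  wave : IsWeakDeltaField c β φ y
  trajectory : IsTrajectory v₀ y
  newton : ∀ t : ℝ, 0 < t → ∃ F : ℝ → ℝ,
    (∀ ε : ℝ, 0 < ε → HasForce β (gaussianDelta ε) (fun x : ℝ => φ x t) (y t) (F ε)) ∧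
      Tendsto F (𝓝[>] 0) (𝓝 (m * iteratedDeriv 2 y t))

/-- `sup_{t ≥ 0} |y'(t)| < c`. -/
def UniformlySubsonic (c : ℝ) (y : ℝ → ℝ) : Prop :=
  ∃ K : ℝ, K < c ∧ ∀ t : ℝ, 0 ≤ t → |velocity y t| ≤ K

end PointParticle

end

open Set Filter Topology MeasureTheory
open scoped ContDiff

noncomputable section

namespace PointParticle

/-! ### The Gaussian density and its primitive -/

/-! D'Alembert's formula makes the field a functional of the trajectory. If `K` is a primitive of
the smearing function, then φ(x,t) is β/(2c) times the integral over s ∈ [0,t] of K(x - y(s) +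
c(t-s)) - K(x - y(s) - c(t-s)), which is `retardedField`. Newton's law smears this field a second
time, and two Gaussians of width σ convolve to one of width √2 σ. The system thus collapses to an
equation v = v₀ + ∫ a(v) for the velocity alone, where a(v)(t) depends on v on [0,t] only. For fixed
σ this functional is Lipschitz on every bounded time interval, with no restriction on v
(`selfAcceleration_causalLipschitz`), so Picard iteration in exponentially weighted norms gives a
unique global solution for every v₀.

For a subsonic trajectory, |v| ≤ K < c, the phases x - y(s) ± c(t-s) are strictly monotone in s with
speed at least c - K. A Gaussian integrated along such a phase is therefore at most 1/(c-K),
uniformly in its width (`integral_comp_le_of_deriv_ge`). At x = y(t) the phase ends at 0, so half of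
the mass of the Gaussian is seen, and the memory integral tends to 1/(2(c+v)) - 1/(2(c-v)) at the
present velocity (`abs_retardedField_sub_meanSlope_le`). The delay equation becomes the ordinary
differential equation v' = -b v/(c² - v²) with b = β²/(2cm). Its integrating factor shows the sign,
the monotonicity and the exponential decay of v (`limit_velocity_eq_exp`), and bootstrapping shows
its smoothness.

Uniqueness for the point particle needs the field first. A continuous weak field is determined by
its source, by testing with products of ramps in the two null coordinates, whose wave operator is a
nonnegative bump of arbitrarily small support (`IsWeakDeltaField.le`). The field of any uniformly
subsonic solution is then the retarded one, its velocity solves the differential equation, and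
Grönwall's inequality applies.

For the convergence, the smeared velocity satisfies the limiting equation in integrated form up to
O(σ) while it stays below K (`abs_sub_limit_equation_le`). Grönwall's inequality turns this into a
distance O(σ) from v, and a continuation argument removes the condition (`exists_velocity_rate`).
The fields follow, because `retardedField` is stable under perturbation of a subsonic path and under
replacing the smooth step by the sharp one, uniformly in x. -/

theorem integral_comp_add_right_Ioi (f : ℝ → ℝ) (a r : ℝ) :
    ∫ x in Ioi a, f (x + r) = ∫ x in Ioi (a + r), f x := by
  rw [← (measurePreserving_add_right volume r).setIntegral_preimage_emb
    (measurableEmbedding_addRight r) f (Ioi (a + r))]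
  simp

theorem gaussianDelta_pos {σ : ℝ} (hσ : 0 < σ) (x : ℝ) : 0 < gaussianDelta σ x := by
  unfold gaussianDelta; positivity

theorem gaussianDelta_neg (σ x : ℝ) : gaussianDelta σ (-x) = gaussianDelta σ x := by
  simp [gaussianDelta]

theorem gaussianDelta_contDiff (σ : ℝ) {n : ℕ∞} : ContDiff ℝ n (gaussianDelta σ) := by
  unfold gaussianDelta
  fun_prop

theorem gaussianDelta_continuous (σ : ℝ) : Continuous (gaussianDelta σ) :=
  (gaussianDelta_contDiff σ (n := 0)).continuous

theorem gaussianDelta_eq_exp (σ x : ℝ) :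
    gaussianDelta σ x =
      1 / (σ * Real.sqrt (2 * Real.pi)) * Real.exp (-(1 / (2 * σ ^ 2)) * x ^ 2) := by
  unfold gaussianDelta
  congr 2
  ring

theorem gaussianDelta_integrable {σ : ℝ} (hσ : 0 < σ) : Integrable (gaussianDelta σ) := by
  have h := (integrable_exp_neg_mul_sq (b := 1 / (2 * σ ^ 2)) (by positivity)).const_mul
    (1 / (σ * Real.sqrt (2 * Real.pi)))
  exact h.congr (Eventually.of_forall fun x => (gaussianDelta_eq_exp σ x).symm)

theorem sqrt_two_pi_mul_sq {σ : ℝ} (hσ : 0 < σ) :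
    Real.sqrt (Real.pi / (1 / (2 * σ ^ 2))) = σ * Real.sqrt (2 * Real.pi) := by
  rw [show Real.pi / (1 / (2 * σ ^ 2)) = σ ^ 2 * (2 * Real.pi) by field_simp,
    Real.sqrt_mul (by positivity), Real.sqrt_sq hσ.le]

theorem integral_gaussianDelta {σ : ℝ} (hσ : 0 < σ) : ∫ x, gaussianDelta σ x = 1 := by
  simp_rw [gaussianDelta_eq_exp]
  rw [integral_const_mul, integral_gaussian, sqrt_two_pi_mul_sq hσ]
  have : 0 < Real.sqrt (2 * Real.pi) := by positivity
  field_simp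

theorem integral_gaussianDelta_Ioi {σ : ℝ} (hσ : 0 < σ) :
    ∫ x in Ioi 0, gaussianDelta σ x = 1 / 2 := by
  simp_rw [gaussianDelta_eq_exp]
  rw [integral_const_mul, integral_gaussian_Ioi, sqrt_two_pi_mul_sq hσ]
  have : 0 < Real.sqrt (2 * Real.pi) := by positivity
  field_simp

theorem gaussianDelta_le_zero {σ : ℝ} (hσ : 0 < σ) (x : ℝ) :
    gaussianDelta σ x ≤ gaussianDelta σ 0 := by
  unfold gaussianDelta
  gcongr ?_ * Real.exp (?_ / _)
  nlinarith [sq_nonneg x]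

theorem gaussianDelta_hasDerivAt {σ : ℝ} (hσ : 0 < σ) (x : ℝ) :
    HasDerivAt (gaussianDelta σ) (-(x / σ ^ 2) * gaussianDelta σ x) x := by
  have h : HasDerivAt (fun x : ℝ => -x ^ 2 / (2 * σ ^ 2)) (-(2 * x) / (2 * σ ^ 2)) x := by
    simpa using ((hasDerivAt_id x).pow 2).neg.div_const (2 * σ ^ 2)
  refine (h.exp.const_mul (1 / (σ * Real.sqrt (2 * Real.pi)))).congr_deriv ?_
  unfold gaussianDelta
  field_simp

/-- A first moment of a Gaussian is controlled by the wider Gaussian. -/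
theorem abs_mul_gaussianDelta_le {σ : ℝ} (hσ : 0 < σ) (x : ℝ) :
    |x| * gaussianDelta σ x ≤ 2 * σ * gaussianDelta (Real.sqrt 2 * σ) x := by
  have h2 : (Real.sqrt 2) ^ 2 = 2 := Real.sq_sqrt (by norm_num)
  have hs2 : 0 < Real.sqrt 2 := by positivity
  have hs2' : Real.sqrt 2 ≤ 2 := by nlinarith
  have hp : 0 < Real.sqrt (2 * Real.pi) := by positivity
  -- The exponential is E * E: one factor absorbs |x|, the other is the profile of the wider
  -- Gaussian.
  set E := Real.exp (-x ^ 2 / (4 * σ ^ 2)) with hE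
  have hEpos : 0 < E := Real.exp_pos _
  have e1 : Real.exp (-x ^ 2 / (2 * σ ^ 2)) = E * E := by
    rw [hE, ← Real.exp_add]; congr 1; field_simp; ring
  have e2 : Real.exp (-x ^ 2 / (2 * (Real.sqrt 2 * σ) ^ 2)) = E := by
    rw [hE]; congr 1; rw [mul_pow, h2]; ring
  have e3 : |x| * E ≤ σ := by
    have h := Real.add_one_le_exp (x ^ 2 / (4 * σ ^ 2))
    have hinv : E * Real.exp (x ^ 2 / (4 * σ ^ 2)) = 1 := by
      rw [hE, ← Real.exp_add, ← Real.exp_zero]; congr 1; ring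
    have h4 : |x| ≤ σ * (x ^ 2 / (4 * σ ^ 2) + 1) := by
      rw [show σ * (x ^ 2 / (4 * σ ^ 2) + 1) = (x ^ 2 + 4 * σ ^ 2) / (4 * σ) by field_simp,
        le_div_iff₀ (by positivity)]
      nlinarith [sq_nonneg (|x| - 2 * σ), sq_abs x]
    calc |x| * E ≤ (σ * Real.exp (x ^ 2 / (4 * σ ^ 2))) * E := by
          gcongr
          exact h4.trans (by gcongr)
      _ = σ * (E * Real.exp (x ^ 2 / (4 * σ ^ 2))) := by ring
      _ = σ := by rw [hinv, mul_one]
  unfold gaussianDelta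
  rw [e1, e2]
  calc |x| * (1 / (σ * Real.sqrt (2 * Real.pi)) * (E * E))
      = (|x| * E) * (1 / (σ * Real.sqrt (2 * Real.pi)) * E) := by ring
    _ ≤ σ * (1 / (σ * Real.sqrt (2 * Real.pi)) * E) := by gcongr
    _ = 1 / Real.sqrt (2 * Real.pi) * E := by field_simp
    _ ≤ (2 / Real.sqrt 2) * (1 / Real.sqrt (2 * Real.pi) * E) := by
        refine le_mul_of_one_le_left (by positivity) ?_
        rw [le_div_iff₀ hs2]; linarith
    _ = _ := by field_simp

theorem exists_bound_gaussianDelta_deriv {σ : ℝ} (hσ : 0 < σ) :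
    ∃ M, ∀ w, |-(w / σ ^ 2) * gaussianDelta σ w| ≤ M := by
  set s := Real.sqrt 2 * σ
  have hs : 0 < s := by positivity
  refine ⟨2 * σ * gaussianDelta s 0 / σ ^ 2, fun z => ?_⟩
  rw [abs_mul, abs_neg, abs_div, abs_of_pos (gaussianDelta_pos hσ z),
    abs_of_pos (by positivity : 0 < σ ^ 2), div_mul_eq_mul_div]
  have h1 := abs_mul_gaussianDelta_le hσ z
  have h2 := gaussianDelta_le_zero hs z
  refine div_le_div_of_nonneg_right (h1.trans ?_) (by positivity)
  gcongr

theorem exists_gaussianDelta_lipschitz {σ : ℝ} (hσ : 0 < σ) :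
    ∃ L : ℝ, 0 ≤ L ∧ ∀ x y, |gaussianDelta σ x - gaussianDelta σ y| ≤ L * |x - y| := by
  obtain ⟨M, hM⟩ := exists_bound_gaussianDelta_deriv hσ
  refine ⟨M, (abs_nonneg _).trans (hM 0), fun x y => ?_⟩
  have := Convex.norm_image_sub_le_of_norm_hasDerivWithin_le (f := gaussianDelta σ)
    (s := univ) (C := M) (x := y) (y := x)
    (fun z _ => (gaussianDelta_hasDerivAt hσ z).hasDerivWithinAt) (fun z _ => hM z) convex_univ
    (mem_univ _) (mem_univ _)
  simpa [Real.norm_eq_abs] using this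

/-- The convolution of two Gaussians of width `σ` has width `√2 σ`. -/
theorem integral_gaussianDelta_mul {σ : ℝ} (hσ : 0 < σ) (w : ℝ) :
    ∫ x, gaussianDelta σ (x + w) * gaussianDelta σ x = gaussianDelta (Real.sqrt 2 * σ) w := by
  have h2 : (Real.sqrt 2) ^ 2 = 2 := Real.sq_sqrt (by norm_num)
  have hs2 : 0 < Real.sqrt 2 := by positivity
  have hp : 0 < Real.sqrt (2 * Real.pi) := by positivity
  -- Completing the square: (x+w)² + x² = 2(x + w/2)² + w²/2.
  have key : ∀ x, gaussianDelta σ (x + w) * gaussianDelta σ x =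
      gaussianDelta (Real.sqrt 2 * σ) w * gaussianDelta (σ / Real.sqrt 2) (x + w / 2) := by
    intro x
    unfold gaussianDelta
    rw [mul_mul_mul_comm, ← Real.exp_add, mul_mul_mul_comm, ← Real.exp_add]
    congr 1
    · field_simp
    · congr 1
      rw [mul_pow, div_pow, h2]
      field_simp
      ring
  simp_rw [key]
  rw [integral_const_mul, integral_add_right_eq_self (fun x => gaussianDelta (σ / Real.sqrt 2) x),
    integral_gaussianDelta (by positivity), mul_one]

/-- The odd primitive of the Gaussian, a smoothing of `sign / 2`. -/
def smoothStep (σ r : ℝ) : ℝ := ∫ x in (0 : ℝ)..r, gaussianDelta σ x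

/-- The function `sign / 2`. -/
def sharpStep (r : ℝ) : ℝ := Real.sign r / 2

theorem smoothStep_hasDerivAt (σ r : ℝ) : HasDerivAt (smoothStep σ) (gaussianDelta σ r) r :=
  (gaussianDelta_continuous σ).integral_hasStrictDerivAt 0 r |>.hasDerivAt

theorem smoothStep_continuous (σ : ℝ) : Continuous (smoothStep σ) :=
  continuous_iff_continuousAt.2 fun r => (smoothStep_hasDerivAt σ r).continuousAt

theorem smoothStep_neg (σ r : ℝ) : smoothStep σ (-r) = -smoothStep σ r := by
  have := intervalIntegral.integral_comp_neg (a := 0) (b := r) (fun x => gaussianDelta σ x)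
  simp only [gaussianDelta_neg, neg_zero] at this
  rw [smoothStep, smoothStep, this, intervalIntegral.integral_symm]

theorem smoothStep_mono {σ : ℝ} (hσ : 0 < σ) : Monotone (smoothStep σ) :=
  monotone_of_deriv_nonneg (fun r => (smoothStep_hasDerivAt σ r).differentiableAt) fun r => by
    rw [(smoothStep_hasDerivAt σ r).deriv]; exact (gaussianDelta_pos hσ r).le

theorem half_sub_smoothStep {σ : ℝ} (hσ : 0 < σ) (r : ℝ) :
    1 / 2 - smoothStep σ r = ∫ x in Ioi r, gaussianDelta σ x := by
  have h := intervalIntegral.integral_Ioi_sub_Ioi' (f := gaussianDelta σ) (a := 0) (b := r)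
    (μ := volume) (gaussianDelta_integrable hσ).integrableOn
    (gaussianDelta_integrable hσ).integrableOn
  rw [integral_gaussianDelta_Ioi hσ] at h
  rw [smoothStep, ← h]; ring

theorem smoothStep_le_half {σ : ℝ} (hσ : 0 < σ) (r : ℝ) : smoothStep σ r ≤ 1 / 2 := by
  have h := half_sub_smoothStep hσ r
  have : 0 ≤ ∫ x in Ioi r, gaussianDelta σ x :=
    integral_nonneg fun x => (gaussianDelta_pos hσ x).le
  linarith

theorem abs_smoothStep_le {σ : ℝ} (hσ : 0 < σ) (r : ℝ) : |smoothStep σ r| ≤ 1 / 2 := by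
  rw [abs_le]
  have h1 := smoothStep_le_half hσ r
  have h2 := smoothStep_le_half hσ (-r)
  rw [smoothStep_neg] at h2
  constructor <;> linarith

theorem smoothStep_zero (σ : ℝ) : smoothStep σ 0 = 0 := by simp [smoothStep]

/-- Since (x+r)² ≥ x² + r² for x, r ≥ 0, the tail is at most half of exp(-r²/(2σ²)); the factor 2
comes from √(2π) ≤ 4. Bounding the tail by σ times a Gaussian is what matters: such an error
integrates to O(σ) along a subsonic phase. -/
theorem half_sub_smoothStep_le {σ r : ℝ} (hσ : 0 < σ) (hr : 0 ≤ r) :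
    1 / 2 - smoothStep σ r ≤ 2 * σ * gaussianDelta σ r := by
  have hp : 0 < Real.sqrt (2 * Real.pi) := by positivity
  have hp4 : Real.sqrt (2 * Real.pi) ≤ 4 := by
    rw [Real.sqrt_le_left (by norm_num)]; linarith [Real.pi_le_four]
  rw [half_sub_smoothStep hσ]
  have hshift : ∫ x in Ioi r, gaussianDelta σ x = ∫ x in Ioi 0, gaussianDelta σ (x + r) := by
    have := integral_comp_add_right_Ioi (fun x => gaussianDelta σ x) 0 r
    simpa using this.symm
  have hpt : ∀ x ∈ Ioi (0 : ℝ), gaussianDelta σ (x + r) ≤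
      Real.exp (-r ^ 2 / (2 * σ ^ 2)) * gaussianDelta σ x := by
    intro x hx
    have hx : 0 < x := hx
    unfold gaussianDelta
    rw [mul_left_comm, ← Real.exp_add]
    gcongr
    rw [← add_div]
    gcongr
    nlinarith [mul_nonneg hx.le hr]
  rw [hshift]
  calc ∫ x in Ioi 0, gaussianDelta σ (x + r)
      ≤ ∫ x in Ioi 0, Real.exp (-r ^ 2 / (2 * σ ^ 2)) * gaussianDelta σ x :=
        setIntegral_mono_on ((gaussianDelta_integrable hσ).comp_add_right r).integrableOn
          ((gaussianDelta_integrable hσ).const_mul _).integrableOn measurableSet_Ioi hpt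
    _ = Real.exp (-r ^ 2 / (2 * σ ^ 2)) * (1 / 2) := by
        rw [integral_const_mul, integral_gaussianDelta_Ioi hσ]
    _ ≤ Real.exp (-r ^ 2 / (2 * σ ^ 2)) * (2 / Real.sqrt (2 * Real.pi)) := by
        refine mul_le_mul_of_nonneg_left ?_ (Real.exp_pos _).le
        rw [div_le_div_iff₀ (by norm_num) hp]; linarith
    _ = 2 * σ * gaussianDelta σ r := by unfold gaussianDelta; field_simp

theorem sharpStep_neg (r : ℝ) : sharpStep (-r) = -sharpStep r := by
  simp [sharpStep, Real.sign_neg, neg_div]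

theorem sharpStep_of_pos {r : ℝ} (hr : 0 < r) : sharpStep r = 1 / 2 := by
  simp [sharpStep, Real.sign_of_pos hr]

theorem abs_sharpStep_le (r : ℝ) : |sharpStep r| ≤ 1 / 2 := by
  rcases Real.sign_apply_eq r with h | h | h <;> simp [sharpStep, h, abs_div]

theorem sharpStep_measurable : Measurable sharpStep := by
  have : Measurable Real.sign := by
    unfold Real.sign
    exact Measurable.ite measurableSet_Iio measurable_const
      (Measurable.ite measurableSet_Ioi measurable_const measurable_const)
  exact this.div_const 2

theorem abs_smoothStep_sub_sharpStep_le {σ : ℝ} (hσ : 0 < σ) (r : ℝ) :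
    |smoothStep σ r - sharpStep r| ≤ 2 * σ * gaussianDelta σ r := by
  have hpos : ∀ r : ℝ, 0 < r → |smoothStep σ r - sharpStep r| ≤ 2 * σ * gaussianDelta σ r := by
    intro r hr
    rw [sharpStep_of_pos hr, abs_sub_comm, abs_of_nonneg (by linarith [smoothStep_le_half hσ r])]
    exact half_sub_smoothStep_le hσ hr.le
  rcases lt_trichotomy r 0 with hr | rfl | hr
  · have := hpos (-r) (by linarith)
    rwa [smoothStep_neg, sharpStep_neg, gaussianDelta_neg, neg_sub_neg, abs_sub_comm] at this
  · have := gaussianDelta_pos hσ 0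
    simp only [smoothStep_zero, sharpStep, Real.sign_zero, zero_div, sub_zero, abs_zero]
    positivity
  · exact hpos r hr

/-- Smearing the sharp step. -/
theorem integral_sharpStep_mul {σ : ℝ} (hσ : 0 < σ) (w : ℝ) :
    ∫ x, sharpStep x * gaussianDelta σ (x - w) = smoothStep σ w := by
  have h_int := (gaussianDelta_integrable hσ).comp_sub_right w
  have hmul : Integrable (fun x => sharpStep x * gaussianDelta σ (x - w)) :=
    h_int.bdd_mul (c := 1 / 2) sharpStep_measurable.aestronglyMeasurable
      (Eventually.of_forall fun x => by simpa using abs_sharpStep_le x)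
  rw [← intervalIntegral.integral_Iic_add_Ioi (b := 0) hmul.integrableOn hmul.integrableOn]
  have e1 : ∫ x in Ioi (0 : ℝ), sharpStep x * gaussianDelta σ (x - w) =
      1 / 2 * (1 / 2 + smoothStep σ w) := by
    have : ∫ x in Ioi (0 : ℝ), sharpStep x * gaussianDelta σ (x - w) =
        ∫ x in Ioi (0 : ℝ), 1 / 2 * gaussianDelta σ (x - w) :=
      setIntegral_congr_fun measurableSet_Ioi fun x hx => by
        simp only [sharpStep_of_pos hx]
    rw [this, integral_const_mul]
    have := integral_comp_add_right_Ioi (fun x => gaussianDelta σ x) 0 (-w)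
    simp only [← sub_eq_add_neg, zero_sub] at this
    rw [this, ← half_sub_smoothStep hσ, smoothStep_neg, sub_neg_eq_add]
  have e2 : ∫ x in Iic (0 : ℝ), sharpStep x * gaussianDelta σ (x - w) =
      -(1 / 2 * (1 / 2 - smoothStep σ w)) := by
    rw [integral_Iic_eq_integral_Iio]
    have h := integral_comp_neg_Ioi (c := (0 : ℝ)) fun x => sharpStep x * gaussianDelta σ (x - w)
    rw [neg_zero, integral_Iic_eq_integral_Iio] at h
    rw [← h]
    have : ∫ x in Ioi (0 : ℝ), sharpStep (-x) * gaussianDelta σ (-x - w) =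
        ∫ x in Ioi (0 : ℝ), -(1 / 2) * gaussianDelta σ (x + w) :=
      setIntegral_congr_fun measurableSet_Ioi fun x hx => by
        simp only [sharpStep_neg, sharpStep_of_pos hx]
        rw [← gaussianDelta_neg σ (x + w)]; ring_nf
    rw [this, integral_const_mul]
    have := integral_comp_add_right_Ioi (fun x => gaussianDelta σ x) 0 w
    simp only [zero_add] at this
    rw [this, ← half_sub_smoothStep hσ]; ring
  rw [e1, e2]; ring

/-- Smearing a smoothed step by a Gaussian of the same width. -/
theorem integral_smoothStep_mul_hasDerivAt {σ : ℝ} (hσ : 0 < σ) (w : ℝ) :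
    HasDerivAt (fun w => ∫ x, smoothStep σ x * gaussianDelta σ (x - w))
      (gaussianDelta (Real.sqrt 2 * σ) w) w := by
  -- The shift moves w into the step, so that differentiation produces the convolution of two
  -- Gaussians.
  have hshift : (fun w => ∫ x, smoothStep σ x * gaussianDelta σ (x - w)) =
      fun w => ∫ x, smoothStep σ (x + w) * gaussianDelta σ x := by
    funext w
    rw [← integral_add_right_eq_self _ w]
    simp
  rw [hshift, ← integral_gaussianDelta_mul hσ w]
  have hi := gaussianDelta_integrable hσ
  have hc := gaussianDelta_continuous σ
  have hs := smoothStep_continuous σ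
  refine (hasDerivAt_integral_of_dominated_loc_of_deriv_le
    (bound := fun x => gaussianDelta σ 0 * gaussianDelta σ x)
    (F' := fun w x => gaussianDelta σ (x + w) * gaussianDelta σ x) (s := univ)
    Filter.univ_mem ?_ ?_ ?_ ?_ (hi.const_mul _) ?_).2
  · exact Eventually.of_forall fun w => (by fun_prop : Continuous fun x =>
      smoothStep σ (x + w) * gaussianDelta σ x).aestronglyMeasurable
  · exact hi.bdd_mul (c := 1 / 2) (by fun_prop : Continuous fun x =>
      smoothStep σ (x + w)).aestronglyMeasurable
      (Eventually.of_forall fun x => by simpa using abs_smoothStep_le hσ (x + w))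
  · exact (by fun_prop : Continuous fun x =>
      gaussianDelta σ (x + w) * gaussianDelta σ x).aestronglyMeasurable
  · refine Eventually.of_forall fun x w _ => ?_
    rw [Real.norm_eq_abs, abs_of_pos (mul_pos (gaussianDelta_pos hσ _) (gaussianDelta_pos hσ _))]
    have := (gaussianDelta_pos hσ x).le
    gcongr
    exact gaussianDelta_le_zero hσ _
  · refine Eventually.of_forall fun x w _ => ?_
    have := (smoothStep_hasDerivAt σ (x + w)).comp w ((hasDerivAt_id w).const_add x)
    simpa using this.mul_const (gaussianDelta σ x)

/-! ### The field of a moving source and its force -/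

/-- With `K` a primitive of the smearing function, `2 c / β` times the field of the source moving
along `y`; with `K` the (doubly smeared) kernel itself, `2 c / β` times the spatial slope of that
field, which gives the self-force. -/
def retardedField (K : ℝ → ℝ) (c : ℝ) (y : ℝ → ℝ) (x t : ℝ) : ℝ :=
  ∫ s in (0 : ℝ)..t, (K (x - y s + c * (t - s)) - K (x - y s - c * (t - s)))

theorem retardedField_congr {K : ℝ → ℝ} {c : ℝ} {y₁ y₂ : ℝ → ℝ} {t : ℝ} (ht : 0 ≤ t)
    (h : ∀ s ∈ Icc 0 t, y₁ s = y₂ s) (x : ℝ) :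
    retardedField K c y₁ x t = retardedField K c y₂ x t := by
  refine intervalIntegral.integral_congr fun s hs => ?_
  rw [uIcc_of_le ht] at hs
  simp only [h s hs]

theorem integrable_prod_bounded_mul {K f : ℝ → ℝ} {C : ℝ} (hKm : Measurable K)
    (hK : ∀ x, |K x| ≤ C) (hf : Integrable f) {p : ℝ → ℝ} (hp : Continuous p) (z t : ℝ) :
    Integrable (fun q : ℝ × ℝ => K (q.1 - p q.2) * f (q.1 - z))
      (volume.prod (volume.restrict (Ioc 0 t))) := by
  have h1 : Integrable (fun q : ℝ × ℝ => f (q.1 - z) * (1 : ℝ))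
      (volume.prod (volume.restrict (Ioc 0 t))) :=
    (hf.comp_sub_right z).mul_prod (integrable_const (1 : ℝ))
  simp only [mul_one] at h1
  refine h1.bdd_mul (c := C) ?_ (Eventually.of_forall fun q => hK _)
  exact (hKm.comp (measurable_fst.sub (hp.measurable.comp measurable_snd))).aestronglyMeasurable

theorem integral_translate_mul (K f : ℝ → ℝ) (a z : ℝ) :
    ∫ x, K (x - a) * f (x - z) = ∫ x, K x * f (x - (z - a)) := by
  rw [← integral_sub_right_eq_self (fun x => K x * f (x - (z - a))) a]
  simp

theorem hasDerivAt_intervalIntegral_translate {L k : ℝ → ℝ} {M : ℝ}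
    (hL : ∀ w, HasDerivAt L (k w) w) (hk : Continuous k) (hM : ∀ w, |k w| ≤ M)
    {p : ℝ → ℝ} (hp : Continuous p) (t z : ℝ) :
    HasDerivAt (fun z => ∫ s in (0 : ℝ)..t, L (z - p s)) (∫ s in (0 : ℝ)..t, k (z - p s)) z := by
  have hLc : Continuous L := continuous_iff_continuousAt.2 fun w => (hL w).continuousAt
  refine (intervalIntegral.hasDerivAt_integral_of_dominated_loc_of_deriv_le
    (F' := fun z s => k (z - p s)) (bound := fun _ => M) (s := univ) univ_mem ?_ ?_ ?_ ?_ ?_ ?_).2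
  · exact Eventually.of_forall fun w =>
      (by fun_prop : Continuous fun s => L (w - p s)).aestronglyMeasurable
  · exact (by fun_prop : Continuous fun s => L (z - p s)).intervalIntegrable _ _
  · exact (by fun_prop : Continuous fun s => k (z - p s)).aestronglyMeasurable
  · exact Eventually.of_forall fun s _ w _ => hM _
  · exact intervalIntegrable_const
  · refine Eventually.of_forall fun s _ w _ => ?_
    exact (hL (w - p s)).comp_sub_const w (p s)

/-- The force exerted by the field of a moving source. -/
theorem hasForce_retardedField {K f k : ℝ → ℝ} {C M : ℝ} (hKm : Measurable K)
    (hK : ∀ x, |K x| ≤ C) (hf : Integrable f)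
    (hL : ∀ w, HasDerivAt (fun w => ∫ x, K x * f (x - w)) (k w) w)
    (hk : Continuous k) (hM : ∀ w, |k w| ≤ M) {y : ℝ → ℝ} (hy : Continuous y) (c β a η : ℝ)
    {t : ℝ} (ht : 0 ≤ t) :
    HasForce β f (fun x => a * retardedField K c y x t) η (β * a * retardedField k c y η t) := by
  set p : ℝ → ℝ := fun s => y s - c * (t - s) with hp
  set q : ℝ → ℝ := fun s => y s + c * (t - s) with hq
  have hpc : Continuous p := by fun_prop
  have hqc : Continuous q := by fun_prop
  have h_int : ∀ z, Integrable (fun r : ℝ × ℝ =>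
      (K (r.1 - p r.2) - K (r.1 - q r.2)) * f (r.1 - z))
      (volume.prod (volume.restrict (Ioc 0 t))) := fun z => by
    simp only [sub_mul]
    exact (integrable_prod_bounded_mul hKm hK hf hpc z t).sub
      (integrable_prod_bounded_mul hKm hK hf hqc z t)
  have hfield : ∀ x z, a * retardedField K c y x t * f (x - z) =
      a * ∫ s in Ioc 0 t, (K (x - p s) - K (x - q s)) * f (x - z) := by
    intro x z
    rw [integral_mul_const, retardedField, intervalIntegral.integral_of_le ht, mul_assoc]
    congr 3
    funext s
    simp only [hp, hq]
    congr 2 <;> ring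
  refine ⟨fun z => ?_, ?_⟩
  · simp only [hfield]
    exact (h_int z).integral_prod_left.const_mul a
  -- After Fubini only the smeared kernel L is differentiated, never K itself; this admits the
  -- discontinuous `sharpStep`.
  set L : ℝ → ℝ := fun w => ∫ x, K x * f (x - w)
  have hLc : Continuous L := continuous_iff_continuousAt.2 fun w => (hL w).continuousAt
  have hval : ∀ z, ∫ x, a * retardedField K c y x t * f (x - z) =
      a * ((∫ s in (0 : ℝ)..t, L (z - p s)) - ∫ s in (0 : ℝ)..t, L (z - q s)) := by
    intro z
    simp only [hfield]
    have hKf : ∀ r, Integrable fun x => K (x - r) * f (x - z) := fun r =>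
      (hf.comp_sub_right z).bdd_mul (c := C)
        (hKm.comp (measurable_id.sub_const r)).aestronglyMeasurable
        (Eventually.of_forall fun x => hK _)
    rw [integral_const_mul, integral_integral_swap (h_int z), ← intervalIntegral.integral_sub,
      intervalIntegral.integral_of_le ht]
    · congr 2
      funext s
      simp only [sub_mul]
      rw [integral_sub (hKf _) (hKf _), integral_translate_mul, integral_translate_mul]
    · exact (by fun_prop : Continuous fun s => L (z - p s)).intervalIntegrable _ _
    · exact (by fun_prop : Continuous fun s => L (z - q s)).intervalIntegrable _ _
  simp only [hval]
  have hd := (((hasDerivAt_intervalIntegral_translate hL hk hM hpc t η).sub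
    (hasDerivAt_intervalIntegral_translate hL hk hM hqc t η)).const_mul a).const_mul β
  refine hd.congr_deriv ?_
  rw [← intervalIntegral.integral_sub
    ((by fun_prop : Continuous fun s => k (η - p s)).intervalIntegrable _ _)
    ((by fun_prop : Continuous fun s => k (η - q s)).intervalIntegrable _ _), ← mul_assoc,
    retardedField]
  congr 2
  funext s
  simp only [hp, hq]
  congr 2 <;> ring

/-- The charge is smeared twice, as the source of the field and as the receiver of the force, which
widens the kernel to √2 σ. For a point source, in `hasForce_sharpStep`, only the second smearing is
present. -/
theorem hasForce_smoothStep {σ : ℝ} (hσ : 0 < σ) {y : ℝ → ℝ} (hy : Continuous y) (c β a η : ℝ)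
    {t : ℝ} (ht : 0 ≤ t) :
    HasForce β (gaussianDelta σ) (fun x => a * retardedField (smoothStep σ) c y x t) η
      (β * a * retardedField (gaussianDelta (Real.sqrt 2 * σ)) c y η t) := by
  have hs : 0 < Real.sqrt 2 * σ := by positivity
  exact hasForce_retardedField (M := gaussianDelta (Real.sqrt 2 * σ) 0)
    (smoothStep_continuous σ).measurable (abs_smoothStep_le hσ)
    (gaussianDelta_integrable hσ) (integral_smoothStep_mul_hasDerivAt hσ)
    (gaussianDelta_continuous _) (fun w => by
      rw [abs_of_pos (gaussianDelta_pos hs w)]; exact gaussianDelta_le_zero hs w) hy c β a η ht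

theorem hasForce_sharpStep {ε : ℝ} (hε : 0 < ε) {y : ℝ → ℝ} (hy : Continuous y) (c β a η : ℝ)
    {t : ℝ} (ht : 0 ≤ t) :
    HasForce β (gaussianDelta ε) (fun x => a * retardedField sharpStep c y x t) η
      (β * a * retardedField (gaussianDelta ε) c y η t) := by
  refine hasForce_retardedField (M := gaussianDelta ε 0)
    sharpStep_measurable abs_sharpStep_le (gaussianDelta_integrable hε) (fun w => ?_)
    (gaussianDelta_continuous _) (fun w => by
      rw [abs_of_pos (gaussianDelta_pos hε w)]; exact gaussianDelta_le_zero hε w) hy c β a η ht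
  simp only [integral_sharpStep_mul hε]
  exact smoothStep_hasDerivAt ε w

/-! ### D'Alembert's formula -/

/-- Interchanging the order of integration over a triangle. -/
theorem integral_triangle_swap {J : ℝ → ℝ → ℝ} (hJ : Continuous (Function.uncurry J)) {T : ℝ}
    (hT : 0 ≤ T) :
    ∫ t in (0 : ℝ)..T, ∫ s in (0 : ℝ)..t, J s t = ∫ s in (0 : ℝ)..T, ∫ t in s..T, J s t := by
  set μ : Measure ℝ := volume.restrict (Ioc 0 T)
  have e1 : ∫ t in (0 : ℝ)..T, ∫ s in (0 : ℝ)..t, J s t =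
      ∫ t, (∫ s, (Iic t).indicator (fun s => J s t) s ∂μ) ∂μ := by
    rw [intervalIntegral.integral_of_le hT]
    refine setIntegral_congr_fun measurableSet_Ioc fun t ht => ?_
    rw [intervalIntegral.integral_of_le ht.1.le, setIntegral_indicator measurableSet_Iic,
      Ioc_inter_Iic, min_eq_right ht.2]
  have e2 : ∫ s in (0 : ℝ)..T, ∫ t in s..T, J s t =
      ∫ s, (∫ t, (Iic t).indicator (fun s => J s t) s ∂μ) ∂μ := by
    rw [intervalIntegral.integral_of_le hT]
    refine setIntegral_congr_fun measurableSet_Ioc fun s hs => ?_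
    rw [intervalIntegral.integral_of_le hs.2, ← integral_Icc_eq_integral_Ioc]
    have : ∀ t, (Iic t).indicator (fun s => J s t) s = (Ici s).indicator (fun t => J s t) t := by
      intro t
      by_cases h : s ≤ t <;> simp [h]
    simp_rw [this]
    rw [setIntegral_indicator measurableSet_Ici]
    congr 2
    ext t
    simp only [mem_Icc, mem_inter_iff, mem_Ioc, mem_Ici]
    exact ⟨fun h => ⟨⟨hs.1.trans_le h.1, h.2⟩, h.1⟩, fun h => ⟨h.2, h.1.2⟩⟩
  rw [e1, e2]
  refine integral_integral_swap ?_
  have hset : MeasurableSet {q : ℝ × ℝ | q.2 ≤ q.1} := measurableSet_le measurable_snd measurable_fst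
  have hbase : Integrable (fun q : ℝ × ℝ => J q.2 q.1) (μ.prod μ) := by
    rw [Measure.prod_restrict]
    have : IntegrableOn (fun q : ℝ × ℝ => J q.2 q.1) (Icc 0 T ×ˢ Icc 0 T) (volume.prod volume) :=
      ContinuousOn.integrableOn_compact (isCompact_Icc.prod isCompact_Icc)
        (hJ.comp continuous_swap).continuousOn
    exact this.mono_set (prod_mono Ioc_subset_Icc_self Ioc_subset_Icc_self)
  exact (hbase.indicator hset).congr (Eventually.of_forall fun q => by
    by_cases h : q.2 ≤ q.1 <;> simp [Function.uncurry, h])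

section DAlembert

variable {u : ℝ → ℝ → ℝ}

theorem uniqueDiffOn_halfPlane : UniqueDiffOn ℝ ((univ : Set ℝ) ×ˢ Ici (0 : ℝ)) :=
  uniqueDiffOn_univ.prod (uniqueDiffOn_Ici 0)

theorem halfPlane_mem_nhds {p : ℝ × ℝ} (hp : 0 < p.2) :
    (univ : Set ℝ) ×ˢ Ici (0 : ℝ) ∈ 𝓝 p :=
  prod_mem_nhds univ_mem (Ici_mem_nhds hp)

/-- Pure second derivatives along a line through the second Fréchet derivative. -/
theorem iteratedDeriv_two_line {U : ℝ × ℝ → ℝ} {p e : ℝ × ℝ} {γ : ℝ → ℝ × ℝ} {r : ℝ}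
    (hγ : ∀ s, HasDerivAt γ e s) (hγr : γ r = p) (hU : ContDiffAt ℝ 2 U p) :
    iteratedDeriv 2 (fun s => U (γ s)) r = fderiv ℝ (fderiv ℝ U) p e e := by
  have hγc : ContinuousAt γ r := (hγ r).continuousAt
  have hev : ∀ᶠ q in 𝓝 p, DifferentiableAt ℝ U q := by
    filter_upwards [hU.eventually (by simp)] with q hq using hq.differentiableAt (by simp)
  have hev' : deriv (fun s => U (γ s)) =ᶠ[𝓝 r] fun s => fderiv ℝ U (γ s) e := by
    have : Tendsto γ (𝓝 r) (𝓝 p) := hγr ▸ hγc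
    filter_upwards [this.eventually hev] with s hs
    exact (hs.hasFDerivAt.comp_hasDerivAt s (hγ s)).deriv
  rw [iteratedDeriv_succ, iteratedDeriv_one, hev'.deriv_eq]
  have hd : DifferentiableAt ℝ (fderiv ℝ U) p :=
    (hU.fderiv_right (m := 1) (by norm_num)).differentiableAt (by simp)
  have h := (hγr ▸ hd.hasFDerivAt).comp_hasDerivAt r (hγ r)
  exact (h.clm_apply (hasDerivAt_const r e)).deriv.trans (by simp [hγr])

/-- Along characteristics the outgoing combination `u_t + c u_x` is driven by the source. -/
theorem hasDerivAt_characteristic {c : ℝ} {F : ℝ → ℝ → ℝ}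
    (hu : ContDiffOn ℝ 2 (fun p : ℝ × ℝ => u p.1 p.2) (univ ×ˢ Ici 0))
    (hwave : ∀ x t : ℝ, 0 < t → iteratedDeriv 2 (fun s : ℝ => u x s) t =
      c ^ 2 * iteratedDeriv 2 (fun z : ℝ => u z t) x + F x t)
    (X : ℝ) {τ : ℝ} (hτ : 0 < τ) :
    HasDerivAt (fun τ => fderivWithin ℝ (fun p : ℝ × ℝ => u p.1 p.2) (univ ×ˢ Ici 0)
      (X - c * τ, τ) (c, 1)) (F (X - c * τ) τ) τ := by
  set U : ℝ × ℝ → ℝ := fun p => u p.1 p.2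
  set p : ℝ × ℝ := (X - c * τ, τ) with hp
  have hUp : ContDiffAt ℝ 2 U p := hu.contDiffAt (halfPlane_mem_nhds hτ)
  have hγ : HasDerivAt (fun τ : ℝ => (X - c * τ, τ)) (-c, (1 : ℝ)) τ := by
    have h1 : HasDerivAt (fun τ : ℝ => X - c * τ) (-c) τ := by
      simpa using ((hasDerivAt_id τ).const_mul c).const_sub X
    exact h1.prodMk (hasDerivAt_id τ)
  have hd : DifferentiableAt ℝ (fderiv ℝ U) p :=
    (hUp.fderiv_right (m := 1) (by norm_num)).differentiableAt (by simp)
  have h := (HasFDerivAt.comp_hasDerivAt (f := fun τ : ℝ => (X - c * τ, τ)) τ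
    hd.hasFDerivAt hγ).clm_apply (hasDerivAt_const τ (c, (1 : ℝ)))
  have hev : (fun τ => fderivWithin ℝ U (univ ×ˢ Ici 0) (X - c * τ, τ) (c, 1)) =ᶠ[𝓝 τ]
      fun τ => fderiv ℝ U (X - c * τ, τ) (c, 1) := by
    filter_upwards [lt_mem_nhds hτ] with s hs
    rw [fderivWithin_of_mem_nhds (halfPlane_mem_nhds hs)]
  refine (h.congr_of_eventuallyEq hev).congr_deriv ?_
  -- Factoring the wave operator as (∂ₜ - c ∂ₓ)(∂ₜ + c ∂ₓ) leaves two mixed derivatives, which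
  -- cancel by symmetry.
  have hsymm := (hUp.isSymmSndFDerivAt (by simp)).eq (1, 0) (0, 1)
  have hx : iteratedDeriv 2 (fun z : ℝ => u z τ) (X - c * τ) =
      fderiv ℝ (fderiv ℝ U) p (1, 0) (1, 0) :=
    iteratedDeriv_two_line (U := U) (γ := fun z => (z, τ))
      (fun s => (hasDerivAt_id s).prodMk (hasDerivAt_const s τ)) rfl hUp
  have ht : iteratedDeriv 2 (fun s : ℝ => u (X - c * τ) s) τ =
      fderiv ℝ (fderiv ℝ U) p (0, 1) (0, 1) :=
    iteratedDeriv_two_line (U := U) (γ := fun s => (X - c * τ, s))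
      (fun s => (hasDerivAt_const s _).prodMk (hasDerivAt_id s)) rfl hUp
  have hw := hwave (X - c * τ) τ hτ
  rw [hx, ht] at hw
  have e1 : ((-c, 1) : ℝ × ℝ) = (-c) • (1, 0) + (0, 1) := by simp
  have e2 : ((c, 1) : ℝ × ℝ) = c • (1, 0) + (0, 1) := by simp
  simp only [map_zero, add_zero, e1, e2, map_add, map_smul, add_apply,
    smul_apply, smul_eq_mul]
  linear_combination hw - c * hsymm

theorem fderivWithin_zero_data
    (hu : ContDiffOn ℝ 2 (fun p : ℝ × ℝ => u p.1 p.2) (univ ×ˢ Ici 0))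
    (h0 : ∀ x, u x 0 = 0) (h1 : ∀ x, derivWithin (fun s => u x s) (Ici 0) 0 = 0) (x c : ℝ) :
    fderivWithin ℝ (fun p : ℝ × ℝ => u p.1 p.2) (univ ×ˢ Ici 0) (x, 0) (c, 1) = 0 := by
  set U : ℝ × ℝ → ℝ := fun p => u p.1 p.2
  have hmem : ((x, 0) : ℝ × ℝ) ∈ (univ : Set ℝ) ×ˢ Ici (0 : ℝ) := by simp
  have hd : HasFDerivWithinAt U _ (univ ×ˢ Ici 0) (x, 0) :=
    ((hu.differentiableOn (by simp)) _ hmem).hasFDerivWithinAt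
  have ht : fderivWithin ℝ U (univ ×ˢ Ici 0) (x, 0) (0, 1) = 0 := by
    have hγ : HasDerivWithinAt (fun s : ℝ => (x, s)) (0, (1 : ℝ)) (Ici 0) 0 :=
      ((hasDerivAt_const (0 : ℝ) x).prodMk (hasDerivAt_id (0 : ℝ))).hasDerivWithinAt
    have := hd.comp_hasDerivWithinAt (0 : ℝ) hγ (fun s hs => by simpa using hs)
    rw [← this.derivWithin (uniqueDiffOn_Ici 0 0 self_mem_Ici)]
    exact h1 x
  have hx : fderivWithin ℝ U (univ ×ˢ Ici 0) (x, 0) (1, 0) = 0 := by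
    have hγ : HasDerivWithinAt (fun z : ℝ => (z, (0 : ℝ))) ((1 : ℝ), (0 : ℝ)) univ x :=
      ((hasDerivAt_id x).prodMk (hasDerivAt_const x (0 : ℝ))).hasDerivWithinAt
    have h := hd.comp_hasDerivWithinAt x hγ (fun s _ => by simp)
    have hc : U ∘ (fun z : ℝ => (z, (0 : ℝ))) = fun _ => 0 := by
      funext z; exact h0 z
    rw [hc] at h
    rw [hasDerivWithinAt_univ] at h
    exact h.unique (hasDerivAt_const x (0 : ℝ))
  have e2 : ((c, 1) : ℝ × ℝ) = c • (1, 0) + (0, 1) := by simp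
  rw [e2, map_add, map_smul, ht, hx]
  simp

/-- D'Alembert's formula for classical solutions with zero data on the closed half plane. -/
theorem dAlembert {c : ℝ} (hc : 0 < c) {F : ℝ → ℝ → ℝ} (hF : Continuous (Function.uncurry F))
    (hu : ContDiffOn ℝ 2 (fun p : ℝ × ℝ => u p.1 p.2) (univ ×ˢ Ici 0))
    (h0 : ∀ x, u x 0 = 0) (h1 : ∀ x, derivWithin (fun s => u x s) (Ici 0) 0 = 0)
    (hwave : ∀ x t : ℝ, 0 < t → iteratedDeriv 2 (fun s : ℝ => u x s) t =
      c ^ 2 * iteratedDeriv 2 (fun z : ℝ => u z t) x + F x t) (x : ℝ) {t : ℝ} (ht : 0 ≤ t) :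
    u x t = 1 / (2 * c) * ∫ s in (0 : ℝ)..t, ∫ ξ in (x - c * (t - s))..(x + c * (t - s)), F ξ s := by
  set U : ℝ × ℝ → ℝ := fun p => u p.1 p.2 with hU
  set S : Set (ℝ × ℝ) := univ ×ˢ Ici 0
  set w : ℝ × ℝ → ℝ := fun p => fderivWithin ℝ U S p (c, 1) with hwdef
  have hwc : ContinuousOn w S :=
    (hu.continuousOn_fderivWithin uniqueDiffOn_halfPlane (by norm_num)).clm_apply
      continuousOn_const
  have hF2 : ∀ {f g : ℝ → ℝ}, Continuous f → Continuous g → Continuous fun s => F (f s) (g s) :=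
    fun hf hg => hF.comp (hf.prodMk hg)
  -- Along left-moving characteristics `w` starts from zero and accumulates the source. Integrating
  -- `w` in turn along the right-moving characteristic through (x, t) gives `u`.
  have hw : ∀ X τ, 0 ≤ τ → w (X - c * τ, τ) = ∫ s in (0 : ℝ)..τ, F (X - c * s) s := by
    intro X τ hτ
    have := intervalIntegral.integral_eq_sub_of_hasDerivAt_of_le hτ
      (f := fun τ => w (X - c * τ, τ)) (f' := fun s => F (X - c * s) s)
      (hwc.comp (by fun_prop) fun s hs => by simpa [S] using hs.1)
      (fun s hs => hasDerivAt_characteristic hu hwave X hs.1)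
      ((hF2 (by fun_prop) (by fun_prop)).intervalIntegrable _ _)
    rw [this]
    have hz := fderivWithin_zero_data hu h0 h1 X c
    simp only [hwdef, mul_zero, sub_zero]
    rw [hz, sub_zero]
  have hu2 : u x t = ∫ τ in (0 : ℝ)..t, ∫ s in (0 : ℝ)..τ, F (x - c * t + 2 * c * τ - c * s) s := by
    have hderiv : ∀ τ ∈ Ioo 0 t, HasDerivAt (fun τ => U (x - c * t + c * τ, τ))
        (w (x - c * t + c * τ, τ)) τ := by
      intro τ hτ
      have hd : DifferentiableAt ℝ U (x - c * t + c * τ, τ) :=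
        (hu.contDiffAt (halfPlane_mem_nhds (p := (x - c * t + c * τ, τ)) hτ.1)).differentiableAt
          (by simp)
      have hγ : HasDerivAt (fun τ : ℝ => (x - c * t + c * τ, τ)) (c, (1 : ℝ)) τ := by
        have h1 : HasDerivAt (fun τ : ℝ => x - c * t + c * τ) c τ := by
          simpa using ((hasDerivAt_id τ).const_mul c).const_add (x - c * t)
        exact h1.prodMk (hasDerivAt_id τ)
      have := HasFDerivAt.comp_hasDerivAt (f := fun τ : ℝ => (x - c * t + c * τ, τ)) τ
        hd.hasFDerivAt hγ
      simp only [hwdef]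
      rwa [fderivWithin_of_mem_nhds
        (halfPlane_mem_nhds (p := (x - c * t + c * τ, τ)) hτ.1)]
    have hmaps : MapsTo (fun τ : ℝ => (x - c * t + c * τ, τ)) (Icc 0 t) S :=
      fun s hs => by simpa [S] using hs.1
    have hcw : ContinuousOn (fun τ => w (x - c * t + c * τ, τ)) (Icc 0 t) :=
      hwc.comp (by fun_prop) hmaps
    have := intervalIntegral.integral_eq_sub_of_hasDerivAt_of_le ht
      (hu.continuousOn.comp (by fun_prop) hmaps) hderiv
      (hcw.intervalIntegrable_of_Icc ht)
    simp only [hU, Function.comp_apply, h0, sub_zero] at this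
    rw [show u x t = u (x - c * t + c * t) t by ring_nf, ← this]
    refine intervalIntegral.integral_congr fun τ hτ => ?_
    rw [uIcc_of_le ht] at hτ
    rw [show x - c * t + c * τ = (x - c * t + 2 * c * τ) - c * τ by ring, hw _ _ hτ.1]
  -- With s outermost, ξ = x - ct - cs + 2cτ maps τ ∈ [s,t] onto the section of the backward cone at
  -- time s; its Jacobian is the 2c of the prefactor.
  rw [hu2, integral_triangle_swap (J := fun s τ => F (x - c * t + 2 * c * τ - c * s) s) ?_ ht,
    ← intervalIntegral.integral_const_mul]
  · refine intervalIntegral.integral_congr fun s _ => ?_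
    have := intervalIntegral.integral_comp_mul_add (a := s) (b := t) (fun ξ => F ξ s)
      (c := 2 * c) (by positivity) (x - c * t - c * s)
    rw [smul_eq_mul] at this
    rw [one_div]
    convert this using 3
    · congr 1; ring
    · ring
    · ring
  · exact hF.comp (by fun_prop : Continuous fun q : ℝ × ℝ =>
      (x - c * t + 2 * c * q.2 - c * q.1, q.1))

end DAlembert

/-! ### The field of a smeared source is a classical solution -/

/-- The contribution to the field of one family of characteristics. -/
def charIntegral (K p : ℝ → ℝ) (u t : ℝ) : ℝ := ∫ s in (0 : ℝ)..t, K (u - p s)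

/-- In the null coordinates x ± ct the time disappears from the integrand and survives only as the
upper limit, so the two partial derivatives become independent computations. -/
theorem retardedField_eq_charIntegral {K : ℝ → ℝ} (hK : Continuous K) {y : ℝ → ℝ}
    (hy : Continuous y) (c x t : ℝ) :
    retardedField K c y x t = charIntegral K (fun s => y s + c * s) (x + c * t) t -
      charIntegral K (fun s => y s - c * s) (x - c * t) t := by
  rw [charIntegral, charIntegral, ← intervalIntegral.integral_sub, retardedField]
  · congr 1
    funext s
    congr 2 <;> ring
  · exact (by fun_prop : Continuous fun s => K (x + c * t - (y s + c * s))).intervalIntegrable _ _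
  · exact (by fun_prop : Continuous fun s => K (x - c * t - (y s - c * s))).intervalIntegrable _ _

theorem charIntegral_continuous {K : ℝ → ℝ} (hK : Continuous K) {p : ℝ → ℝ} (hp : Continuous p) :
    Continuous (fun q : ℝ × ℝ => charIntegral K p q.1 q.2) := by
  have := intervalIntegral.continuous_parametric_intervalIntegral_of_continuous (μ := volume)
    (a₀ := (0 : ℝ)) (f := fun (q : ℝ × ℝ) s => K (q.1 - p s)) (s := fun q => q.2)
    (by fun_prop) continuous_snd
  exact this

theorem retardedField_continuous {K : ℝ → ℝ} (hK : Continuous K) {y : ℝ → ℝ}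
    (hy : Continuous y) (c : ℝ) :
    Continuous (fun q : ℝ × ℝ => retardedField K c y q.1 q.2) := by
  simp only [retardedField_eq_charIntegral hK hy]
  exact ((charIntegral_continuous hK (by fun_prop)).comp
    (by fun_prop : Continuous fun q : ℝ × ℝ => (q.1 + c * q.2, q.2))).sub
    ((charIntegral_continuous hK (by fun_prop)).comp
    (by fun_prop : Continuous fun q : ℝ × ℝ => (q.1 - c * q.2, q.2)))

section

variable {K k : ℝ → ℝ} {M : ℝ}

theorem charIntegral_hasFDerivAt (hK : ∀ w, HasDerivAt K (k w) w) (hk : Continuous k)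
    (hM : ∀ w, |k w| ≤ M) {p : ℝ → ℝ} (hp : Continuous p) (q : ℝ × ℝ) :
    HasFDerivAt (fun q : ℝ × ℝ => charIntegral K p q.1 q.2)
      (charIntegral k p q.1 q.2 • ContinuousLinearMap.fst ℝ ℝ ℝ +
        K (q.1 - p q.2) • ContinuousLinearMap.snd ℝ ℝ ℝ) q := by
  have hKc : Continuous K := continuous_iff_continuousAt.2 fun w => (hK w).continuousAt
  have h := hasStrictFDerivAt_uncurry_coprod (𝕜 := ℝ) (u := q) (f := charIntegral K p)
    (f₁ := fun u t => charIntegral k p u t • ContinuousLinearMap.id ℝ ℝ)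
    (f₂ := fun u t => K (u - p t) • ContinuousLinearMap.id ℝ ℝ) ?_ ?_ ?_ ?_
  · refine h.hasFDerivAt.congr_fderiv ?_
    ext <;> simp [Function.HasUncurry.uncurry]
  · refine Eventually.of_forall fun v => ?_
    refine (hasDerivAt_intervalIntegral_translate hK hk hM hp v.2 v.1).hasFDerivAt.congr_fderiv ?_
    ext; simp [Function.HasUncurry.uncurry, charIntegral]
  · refine Eventually.of_forall fun v => ?_
    have h1 := (by fun_prop : Continuous fun s => K (v.1 - p s)).integral_hasStrictDerivAt 0 v.2
    refine h1.hasDerivAt.hasFDerivAt.congr_fderiv ?_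
    ext; simp [Function.HasUncurry.uncurry]
  · exact ((charIntegral_continuous hk hp).smul continuous_const).continuousAt
  · exact ((by fun_prop : Continuous fun v : ℝ × ℝ => K (v.1 - p v.2)).smul
      continuous_const).continuousAt

theorem charIntegral_fderiv (hK : ∀ w, HasDerivAt K (k w) w) (hk : Continuous k)
    (hM : ∀ w, |k w| ≤ M) {p : ℝ → ℝ} (hp : Continuous p) :
    fderiv ℝ (fun q : ℝ × ℝ => charIntegral K p q.1 q.2) = fun q =>
      charIntegral k p q.1 q.2 • ContinuousLinearMap.fst ℝ ℝ ℝ +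
        K (q.1 - p q.2) • ContinuousLinearMap.snd ℝ ℝ ℝ :=
  funext fun q => (charIntegral_hasFDerivAt hK hk hM hp q).fderiv

theorem charIntegral_contDiff_one (hK : ∀ w, HasDerivAt K (k w) w) (hk : Continuous k)
    (hM : ∀ w, |k w| ≤ M) {p : ℝ → ℝ} (hp : Continuous p) :
    ContDiff ℝ 1 (fun q : ℝ × ℝ => charIntegral K p q.1 q.2) := by
  have hKc : Continuous K := continuous_iff_continuousAt.2 fun w => (hK w).continuousAt
  rw [contDiff_one_iff_fderiv]
  refine ⟨fun q => (charIntegral_hasFDerivAt hK hk hM hp q).differentiableAt, ?_⟩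
  rw [charIntegral_fderiv hK hk hM hp]
  exact ((charIntegral_continuous hk hp).smul continuous_const).add
    ((by fun_prop : Continuous fun v : ℝ × ℝ => K (v.1 - p v.2)).smul continuous_const)

/-- The first derivative consists of a `charIntegral` of `k`, which is C¹ for any continuous path,
and of the boundary value K(u - p(t)), which is C¹ as soon as the path is. -/
theorem charIntegral_contDiff_two {k' : ℝ → ℝ} {M' : ℝ} (hK : ∀ w, HasDerivAt K (k w) w)
    (hM : ∀ w, |k w| ≤ M) (hk : ∀ w, HasDerivAt k (k' w) w) (hk' : Continuous k')
    (hM' : ∀ w, |k' w| ≤ M') {p : ℝ → ℝ} (hp : ContDiff ℝ 1 p) :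
    ContDiff ℝ 2 (fun q : ℝ × ℝ => charIntegral K p q.1 q.2) := by
  have hkc : Continuous k := continuous_iff_continuousAt.2 fun w => (hk w).continuousAt
  have hK1 : ContDiff ℝ 1 K := by
    rw [contDiff_one_iff_deriv]
    refine ⟨fun w => (hK w).differentiableAt, ?_⟩
    rw [funext fun w => (hK w).deriv]
    exact hkc
  rw [show (2 : ℕ∞ω) = 1 + 1 by norm_num, contDiff_succ_iff_fderiv]
  refine ⟨fun q => (charIntegral_hasFDerivAt hK hkc hM hp.continuous q).differentiableAt,
    by simp, ?_⟩
  rw [charIntegral_fderiv hK hkc hM hp.continuous]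
  have h1 := charIntegral_contDiff_one hk hk' hM' hp.continuous
  have h2 : ContDiff ℝ 1 fun v : ℝ × ℝ => K (v.1 - p v.2) := by fun_prop
  exact (h1.smul contDiff_const).add (h2.smul contDiff_const)

theorem charIntegral_hasDerivAt_char (hK : ∀ w, HasDerivAt K (k w) w) (hk : Continuous k)
    (hM : ∀ w, |k w| ≤ M) {p : ℝ → ℝ} (hp : Continuous p) (x a t : ℝ) :
    HasDerivAt (fun t => charIntegral K p (x + a * t) t)
      (a * charIntegral k p (x + a * t) t + K (x + a * t - p t)) t := by
  have hγ : HasDerivAt (fun t : ℝ => (x + a * t, t)) (a, (1 : ℝ)) t := by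
    have h1 : HasDerivAt (fun t : ℝ => x + a * t) a t := by
      simpa using ((hasDerivAt_id t).const_mul a).const_add x
    exact h1.prodMk (hasDerivAt_id t)
  have := HasFDerivAt.comp_hasDerivAt (f := fun t : ℝ => (x + a * t, t)) t
    (charIntegral_hasFDerivAt hK hk hM hp (x + a * t, t)) hγ
  refine this.congr_deriv ?_
  simp [mul_comm]

end

theorem abs_gaussianDelta_le {σ : ℝ} (hσ : 0 < σ) (w : ℝ) :
    |gaussianDelta σ w| ≤ gaussianDelta σ 0 := by
  rw [abs_of_pos (gaussianDelta_pos hσ w)]; exact gaussianDelta_le_zero hσ w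

theorem retardedField_contDiff {σ : ℝ} (hσ : 0 < σ) {y : ℝ → ℝ} (hy : ContDiff ℝ 1 y) (c : ℝ) :
    ContDiff ℝ 2 (fun q : ℝ × ℝ => retardedField (smoothStep σ) c y q.1 q.2) := by
  obtain ⟨M, hM⟩ := exists_bound_gaussianDelta_deriv hσ
  simp only [retardedField_eq_charIntegral (smoothStep_continuous σ) hy.continuous]
  have hc' : Continuous fun w => -(w / σ ^ 2) * gaussianDelta σ w := by
    have := gaussianDelta_continuous σ
    fun_prop
  have h : ∀ p : ℝ → ℝ, ContDiff ℝ 1 p →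
      ContDiff ℝ 2 (fun q : ℝ × ℝ => charIntegral (smoothStep σ) p q.1 q.2) := fun p hp =>
    charIntegral_contDiff_two (smoothStep_hasDerivAt σ) (abs_gaussianDelta_le hσ)
      (gaussianDelta_hasDerivAt hσ) hc' hM hp
  exact ((h _ (by fun_prop)).comp (by fun_prop : ContDiff ℝ 2 fun q : ℝ × ℝ =>
    (q.1 + c * q.2, q.2))).sub ((h _ (by fun_prop)).comp (by fun_prop : ContDiff ℝ 2
    fun q : ℝ × ℝ => (q.1 - c * q.2, q.2)))

theorem retardedField_hasDerivAt_space {K k : ℝ → ℝ} {M : ℝ} (hK : ∀ w, HasDerivAt K (k w) w)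
    (hk : Continuous k) (hM : ∀ w, |k w| ≤ M) {y : ℝ → ℝ} (hy : Continuous y) (c x t : ℝ) :
    HasDerivAt (fun x => retardedField K c y x t) (retardedField k c y x t) x := by
  have hKc : Continuous K := continuous_iff_continuousAt.2 fun w => (hK w).continuousAt
  simp only [retardedField_eq_charIntegral hKc hy, retardedField_eq_charIntegral hk hy]
  exact ((hasDerivAt_intervalIntegral_translate hK hk hM (by fun_prop) t
    (x + c * t)).comp_add_const x (c * t)).sub
    ((hasDerivAt_intervalIntegral_translate hK hk hM (by fun_prop) t
    (x - c * t)).comp_sub_const x (c * t))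

/-- Both characteristics contribute the boundary term K(x - y(t)), with opposite signs, so it drops
out. -/
theorem retardedField_hasDerivAt_time {K k : ℝ → ℝ} {M : ℝ} (hK : ∀ w, HasDerivAt K (k w) w)
    (hk : Continuous k) (hM : ∀ w, |k w| ≤ M) {y : ℝ → ℝ} (hy : Continuous y) (c x t : ℝ) :
    HasDerivAt (fun t => retardedField K c y x t)
      (c * (charIntegral k (fun s => y s + c * s) (x + c * t) t +
        charIntegral k (fun s => y s - c * s) (x + -c * t) t)) t := by
  have hKc : Continuous K := continuous_iff_continuousAt.2 fun w => (hK w).continuousAt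
  simp only [retardedField_eq_charIntegral hKc hy]
  have h1 := charIntegral_hasDerivAt_char hK hk hM (p := fun s => y s + c * s) (by fun_prop) x c t
  have h2 := charIntegral_hasDerivAt_char hK hk hM (p := fun s => y s - c * s) (by fun_prop) x
    (-c) t
  have := h1.sub h2
  simp only [neg_mul, ← sub_eq_add_neg] at this ⊢
  refine this.congr_deriv ?_
  rw [show x + c * t - (y t + c * t) = x - c * t - (y t - c * t) by ring]
  ring

/-- At second order in time the boundary terms add up instead of cancelling, and they form the
source. -/
theorem retardedField_wave {σ : ℝ} (hσ : 0 < σ) {y : ℝ → ℝ} (hy : Continuous y) (c x t : ℝ) :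
    iteratedDeriv 2 (fun s => retardedField (smoothStep σ) c y x s) t =
      c ^ 2 * iteratedDeriv 2 (fun z => retardedField (smoothStep σ) c y z t) x +
        2 * c * gaussianDelta σ (x - y t) := by
  obtain ⟨M, hM⟩ := exists_bound_gaussianDelta_deriv hσ
  have hg := gaussianDelta_continuous σ
  have hc' : Continuous fun w => -(w / σ ^ 2) * gaussianDelta σ w := by fun_prop
  rw [iteratedDeriv_succ, iteratedDeriv_one, iteratedDeriv_succ, iteratedDeriv_one]
  rw [funext fun s => (retardedField_hasDerivAt_time (smoothStep_hasDerivAt σ) hg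
      (abs_gaussianDelta_le hσ) hy c x s).deriv,
    funext fun z => (retardedField_hasDerivAt_space (smoothStep_hasDerivAt σ) hg
      (abs_gaussianDelta_le hσ) hy c z t).deriv,
    (retardedField_hasDerivAt_space (gaussianDelta_hasDerivAt hσ) hc' hM hy c x t).deriv,
    retardedField_eq_charIntegral hc' hy]
  have h1 := charIntegral_hasDerivAt_char (gaussianDelta_hasDerivAt hσ) hc' hM
    (p := fun s => y s + c * s) (by fun_prop) x c t
  have h2 := charIntegral_hasDerivAt_char (gaussianDelta_hasDerivAt hσ) hc' hM
    (p := fun s => y s - c * s) (by fun_prop) x (-c) t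
  refine ((h1.add h2).const_mul c).deriv.trans ?_
  rw [show x + c * t - (y t + c * t) = x - y t by ring,
    show x + -c * t - (y t - c * t) = x - y t by ring, show x + -c * t = x - c * t by ring]
  ring

theorem retardedField_initial (K : ℝ → ℝ) (c : ℝ) (y : ℝ → ℝ) (x : ℝ) :
    retardedField K c y x 0 = 0 := by
  simp [retardedField]

theorem retardedField_derivWithin_zero {σ : ℝ} (hσ : 0 < σ) {y : ℝ → ℝ} (hy : Continuous y)
    (c x : ℝ) :
    HasDerivAt (fun t => retardedField (smoothStep σ) c y x t) 0 0 := by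
  have := retardedField_hasDerivAt_time (smoothStep_hasDerivAt σ) (gaussianDelta_continuous σ)
      (abs_gaussianDelta_le hσ) hy c x 0
  simpa [charIntegral] using this

/-- A classical solution has the field given by d'Alembert's formula. -/
theorem IsSmoothSolution.field_eq {m c β v₀ σ : ℝ} (hc : 0 < c)
    {φ : ℝ → ℝ → ℝ} {y : ℝ → ℝ} (h : IsSmoothSolution m c β v₀ (gaussianDelta σ) φ y)
    (x : ℝ) {t : ℝ} (ht : 0 ≤ t) :
    φ x t = β / (2 * c) * retardedField (smoothStep σ) c y x t := by
  -- The path is controlled at nonnegative times only; freezing it before 0 makes the source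
  -- continuous on the whole plane.
  set z : ℝ → ℝ := fun t => y (max t 0) with hz
  have hzc : Continuous z := by
    have := h.trajectory.contDiffOn.continuousOn
    exact this.comp_continuous (by fun_prop) fun t => by simp
  have hg := gaussianDelta_continuous σ
  have hF : Continuous (Function.uncurry fun x t => β * gaussianDelta σ (x - z t)) := by
    unfold Function.uncurry
    fun_prop
  have hd := dAlembert hc hF h.field_contDiffOn h.field_zero h.field_deriv_zero
    (fun x t ht => by simpa [hz, max_eq_left ht.le] using h.wave x t ht) x ht
  rw [hd, retardedField_congr ht (y₂ := z)
    (fun s hs => by simp [hz, max_eq_left hs.1]) x, retardedField]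
  have hin : ∀ s, ∫ ξ in (x - c * (t - s))..(x + c * (t - s)), β * gaussianDelta σ (ξ - z s) =
      β * (smoothStep σ (x - z s + c * (t - s)) - smoothStep σ (x - z s - c * (t - s))) := by
    intro s
    rw [intervalIntegral.integral_const_mul,
      intervalIntegral.integral_comp_sub_right (fun ξ => gaussianDelta σ ξ),
      intervalIntegral.integral_eq_sub_of_hasDerivAt (fun r _ => smoothStep_hasDerivAt σ r)
      (hg.intervalIntegrable _ _)]
    congr 3 <;> ring
  simp_rw [hin]
  rw [intervalIntegral.integral_const_mul]
  ring

/-! ### Causal integral equations -/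

/-- A functional on continuous functions that is Lipschitz on bounded time intervals and depends
at time `t ≥ 0` on the values in `[0, t]` only. -/
structure CausalLipschitz (a : (ℝ → ℝ) → ℝ → ℝ) : Prop where
  continuous : ∀ v, Continuous v → Continuous (a v)
  lipschitz : ∀ T : ℝ, ∃ C : ℝ, 0 ≤ C ∧ ∀ v w, Continuous v → Continuous w →
    ∀ t ∈ Icc 0 T, ∀ A : ℝ, (∀ s ∈ Icc 0 t, |v s - w s| ≤ A) → |a v t - a w t| ≤ C * A

theorem integral_exp_le {l : ℝ} (hl : 0 < l) (t : ℝ) :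
    ∫ s in (0 : ℝ)..t, Real.exp (l * s) ≤ Real.exp (l * t) / l := by
  have h : ∀ s ∈ uIcc 0 t, HasDerivAt (fun s => Real.exp (l * s) / l) (Real.exp (l * s)) s := by
    intro s _
    have := (((hasDerivAt_id s).const_mul l).exp).div_const l
    refine this.congr_deriv ?_
    simp only [id, mul_one]
    field_simp
  rw [intervalIntegral.integral_eq_sub_of_hasDerivAt h
    ((by fun_prop : Continuous fun s => Real.exp (l * s)).intervalIntegrable _ _)]
  simp only [mul_zero, Real.exp_zero]
  linarith [(by positivity : 0 < 1 / l)]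

/-- Grönwall's inequality with exponential weights. -/
theorem le_of_weighted_bound {d : ℝ → ℝ} {T ε C : ℝ} (hd : ContinuousOn d (Icc 0 T)) (hε : 0 ≤ ε)
    (hC : 0 ≤ C)
    (h : ∀ A l : ℝ, 0 ≤ A → 0 < l → (∀ s ∈ Icc 0 T, d s ≤ A * Real.exp (l * s)) →
      ∀ t ∈ Icc 0 T, d t ≤ ε + C * A * (Real.exp (l * t) / l)) :
    ∀ t ∈ Icc 0 T, d t ≤ 2 * ε * Real.exp ((2 * C + 1) * t) := by
  intro t ht
  -- This choice makes C / l ≤ 1/2, so that at the maximum of d(s) exp(-l s) half of A is absorbed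
  -- and A ≤ 2ε remains.
  set l := 2 * C + 1 with hl
  have hl0 : 0 < l := by positivity
  obtain ⟨t₀, ht₀, hmax⟩ := isCompact_Icc.exists_isMaxOn ⟨t, ht⟩
    (hd.mul (by fun_prop : ContinuousOn (fun s => Real.exp (-(l * s))) (Icc 0 T)))
  set A := d t₀ * Real.exp (-(l * t₀)) with hA
  have hAbound : ∀ s ∈ Icc 0 T, d s ≤ A * Real.exp (l * s) := by
    intro s hs
    have : d s * Real.exp (-(l * s)) ≤ A := hmax hs
    calc d s = d s * Real.exp (-(l * s)) * Real.exp (l * s) := by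
          rw [mul_assoc, ← Real.exp_add]; simp
      _ ≤ A * Real.exp (l * s) := by gcongr
  have hA2 : A ≤ 2 * ε := by
    rcases le_total A 0 with hA0 | hA0
    · linarith
    have h1 := h A l hA0 hl0 hAbound t₀ ht₀
    have h2 : A ≤ (ε + C * A * (Real.exp (l * t₀) / l)) * Real.exp (-(l * t₀)) := by
      rw [hA]; gcongr
    have h3 : (ε + C * A * (Real.exp (l * t₀) / l)) * Real.exp (-(l * t₀)) =
        ε * Real.exp (-(l * t₀)) + C * A / l := by
      rw [add_mul, show C * A * (Real.exp (l * t₀) / l) * Real.exp (-(l * t₀)) =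
        C * A / l * (Real.exp (l * t₀) * Real.exp (-(l * t₀))) by ring, ← Real.exp_add]
      simp
    have h4 : ε * Real.exp (-(l * t₀)) ≤ ε * 1 := by
      gcongr
      rw [Real.exp_le_one_iff]
      have := mul_nonneg hl0.le ht₀.1
      linarith
    have h5 : C * A / l ≤ A / 2 := by
      rw [div_le_div_iff₀ hl0 (by norm_num)]
      nlinarith
    linarith
  exact (hAbound t ht).trans (by gcongr)

theorem abs_integral_le_weighted {f : ℝ → ℝ} {C A l t : ℝ}
    (hl : 0 < l) (ht : 0 ≤ t) (hCA : 0 ≤ C * A)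
    (h : ∀ s ∈ Icc 0 t, |f s| ≤ C * A * Real.exp (l * s)) :
    |∫ s in (0 : ℝ)..t, f s| ≤ C * A * (Real.exp (l * t) / l) := by
  have h1 : ‖∫ s in (0 : ℝ)..t, f s‖ ≤ ∫ s in (0 : ℝ)..t, C * A * Real.exp (l * s) :=
    intervalIntegral.norm_integral_le_of_norm_le ht
      (Eventually.of_forall fun s hs => h s ⟨hs.1.le, hs.2⟩)
      ((by fun_prop : Continuous fun s => C * A * Real.exp (l * s)).intervalIntegrable _ _)
  rw [intervalIntegral.integral_const_mul] at h1
  exact h1.trans (by gcongr; exact integral_exp_le hl t)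

/-- In the sup norm on [0,T] weighted by exp(-l t), the Picard map contracts by C / l. A large l
thus handles the whole interval at once, without subdividing it. -/
theorem CausalLipschitz.abs_integral_sub_le {a : (ℝ → ℝ) → ℝ → ℝ} (ha : CausalLipschitz a)
    {T C : ℝ} (hC0 : 0 ≤ C) (hC : ∀ v w, Continuous v → Continuous w →
    ∀ t ∈ Icc 0 T, ∀ A : ℝ, (∀ s ∈ Icc 0 t, |v s - w s| ≤ A) → |a v t - a w t| ≤ C * A)
    {v w : ℝ → ℝ} (hv : Continuous v) (hw : Continuous w) {A l : ℝ} (hA : 0 ≤ A) (hl : 0 < l)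
    (h : ∀ s ∈ Icc 0 T, |v s - w s| ≤ A * Real.exp (l * s)) {t : ℝ} (ht : t ∈ Icc 0 T) :
    |(∫ s in (0 : ℝ)..t, a v s) - ∫ s in (0 : ℝ)..t, a w s| ≤
      C * A * (Real.exp (l * t) / l) := by
  rw [← intervalIntegral.integral_sub ((ha.continuous v hv).intervalIntegrable _ _)
    ((ha.continuous w hw).intervalIntegrable _ _)]
  refine abs_integral_le_weighted hl ht.1 (by positivity) fun s hs => ?_
  rw [mul_assoc]
  refine hC v w hv hw s ⟨hs.1, hs.2.trans ht.2⟩ _ fun r hr => ?_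
  exact (h r ⟨hr.1, hr.2.trans (hs.2.trans ht.2)⟩).trans (by gcongr; exact hr.2)

/-- Uniqueness for causal integral equations. -/
theorem CausalLipschitz.unique {a : (ℝ → ℝ) → ℝ → ℝ} (ha : CausalLipschitz a) {v₀ : ℝ}
    {v w : ℝ → ℝ} (hv : Continuous v) (hw : Continuous w)
    (hve : ∀ t, 0 ≤ t → v t = v₀ + ∫ s in (0 : ℝ)..t, a v s)
    (hwe : ∀ t, 0 ≤ t → w t = v₀ + ∫ s in (0 : ℝ)..t, a w s) {t : ℝ} (ht : 0 ≤ t) :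
    v t = w t := by
  obtain ⟨C, hC0, hC⟩ := ha.lipschitz t
  have := le_of_weighted_bound (d := fun s => |v s - w s|) (T := t) (ε := 0) (C := C)
    (by fun_prop) le_rfl hC0 (fun A l hA hl h s hs => by
      rw [hve s hs.1, hwe s hs.1, add_sub_add_left_eq_sub, zero_add]
      exact ha.abs_integral_sub_le hC0 hC hv hw hA hl h hs) t ⟨ht, le_rfl⟩
  simp only [mul_zero, zero_mul] at this
  exact sub_eq_zero.1 (abs_nonpos_iff.1 this)

/-- Picard iterates of a causal integral equation. -/
def picardIterate (a : (ℝ → ℝ) → ℝ → ℝ) (v₀ : ℝ) : ℕ → ℝ → ℝ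
  | 0 => fun _ => v₀
  | n + 1 => fun t => v₀ + ∫ s in (0 : ℝ)..t, a (picardIterate a v₀ n) s

theorem continuous_primitive {f : ℝ → ℝ} (hf : Continuous f) :
    Continuous fun t => ∫ s in (0 : ℝ)..t, f s :=
  continuous_iff_continuousAt.2 fun t =>
    (hf.integral_hasStrictDerivAt 0 t).hasDerivAt.continuousAt

theorem CausalLipschitz.picardIterate_continuous {a : (ℝ → ℝ) → ℝ → ℝ} (ha : CausalLipschitz a)
    (v₀ : ℝ) (n : ℕ) : Continuous (picardIterate a v₀ n) := by
  induction n with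
  | zero => exact continuous_const
  | succ n ih => exact continuous_const.add (continuous_primitive (ha.continuous _ ih))

theorem CausalLipschitz.exists_geometric {a : (ℝ → ℝ) → ℝ → ℝ} (ha : CausalLipschitz a)
    (v₀ T : ℝ) :
    ∃ B : ℝ, ∀ n, ∀ t ∈ Icc 0 T,
      dist (picardIterate a v₀ n t) (picardIterate a v₀ (n + 1) t) ≤ B * (1 / 2) ^ n := by
  have hcont := ha.picardIterate_continuous v₀
  obtain ⟨C, hC0, hC⟩ := ha.lipschitz T
  set l := 2 * C + 1 with hl
  have hl0 : 0 < l := by positivity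
  obtain ⟨A, hA⟩ := isCompact_Icc.exists_bound_of_continuousOn
    ((hcont 1).sub (hcont 0)).continuousOn (s := Icc 0 T)
  have key : ∀ n, ∀ t ∈ Icc 0 T, |picardIterate a v₀ (n + 1) t - picardIterate a v₀ n t| ≤
      |A| * (1 / 2) ^ n * Real.exp (l * t) := by
    intro n
    induction n with
    | zero =>
      intro t ht
      have h1 : 1 ≤ Real.exp (l * t) := Real.one_le_exp (mul_nonneg hl0.le ht.1)
      have h2 : |picardIterate a v₀ 1 t - picardIterate a v₀ 0 t| ≤ A := hA t ht
      simp only [zero_add, pow_zero, mul_one]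
      nlinarith [le_abs_self A, abs_nonneg A]
    | succ n ih =>
      intro t ht
      have := ha.abs_integral_sub_le hC0 hC (hcont (n + 1)) (hcont n)
        (A := |A| * (1 / 2) ^ n) (by positivity) hl0 ih ht
      have e : picardIterate a v₀ (n + 1 + 1) t - picardIterate a v₀ (n + 1) t =
          (∫ s in (0 : ℝ)..t, a (picardIterate a v₀ (n + 1)) s) -
            ∫ s in (0 : ℝ)..t, a (picardIterate a v₀ n) s := add_sub_add_left_eq_sub _ _ _
      rw [e]
      refine this.trans ?_
      have hCl : C / l ≤ 1 / 2 := by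
        rw [div_le_div_iff₀ hl0 (by norm_num)]; linarith
      calc C * (|A| * (1 / 2) ^ n) * (Real.exp (l * t) / l)
          = (C / l) * ((|A| * (1 / 2) ^ n) * Real.exp (l * t)) := by ring
        _ ≤ (1 / 2) * ((|A| * (1 / 2) ^ n) * Real.exp (l * t)) := by gcongr
        _ = _ := by ring
  refine ⟨|A| * Real.exp (l * T), fun n t ht => ?_⟩
  rw [dist_comm, Real.dist_eq]
  refine (key n t ht).trans ?_
  rw [mul_right_comm]
  gcongr
  exact ht.2

/-- Global existence for causal integral equations. -/
theorem CausalLipschitz.exists_solution {a : (ℝ → ℝ) → ℝ → ℝ} (ha : CausalLipschitz a) (v₀ : ℝ) :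
    ∃ v : ℝ → ℝ, Continuous v ∧ ∀ t, 0 ≤ t → v t = v₀ + ∫ s in (0 : ℝ)..t, a v s := by
  have hcont := ha.picardIterate_continuous v₀
  choose B hB using ha.exists_geometric v₀
  have hlim : ∀ t : ℝ, ∃ L, 0 ≤ t →
      Tendsto (fun n => picardIterate a v₀ n t) atTop (𝓝 L) := by
    intro t
    by_cases ht : 0 ≤ t
    · obtain ⟨L, hL⟩ := cauchySeq_tendsto_of_complete (cauchySeq_of_le_geometric (1 / 2) (B t)
        (by norm_num) fun n => hB t n t ⟨ht, le_rfl⟩)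
      exact ⟨L, fun _ => hL⟩
    · exact ⟨0, fun h => absurd h ht⟩
  choose L hL using hlim
  have hdist : ∀ T n, ∀ t ∈ Icc 0 T,
      |picardIterate a v₀ n t - L t| ≤ B T * (1 / 2) ^ n / (1 - 1 / 2) := fun T n t ht =>
    dist_le_of_le_geometric_of_tendsto (1 / 2) (B T) (by norm_num)
      (fun n => hB T n t ht) (hL t ht.1) n
  have hgeo : ∀ b : ℝ, Tendsto (fun n : ℕ => b * (1 / 2) ^ n / (1 - 1 / 2)) atTop (𝓝 0) := by
    intro b
    have := ((tendsto_pow_atTop_nhds_zero_of_lt_one (r := (1 / 2 : ℝ)) (by norm_num)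
      (by norm_num)).const_mul b).div_const (1 - 1 / 2)
    simpa using this
  -- The functional acts on functions that are continuous on the whole line, so the limit is
  -- extended by a constant to negative times.
  set v : ℝ → ℝ := fun t => L (max t 0) with hv
  have hvL : ∀ t, 0 ≤ t → v t = L t := fun t ht => by simp [hv, max_eq_left ht]
  have hvc : Continuous v := by
    have hloc : TendstoLocallyUniformly (fun n t => picardIterate a v₀ n (max t 0)) v atTop := by
      rw [Metric.tendstoLocallyUniformly_iff]
      intro ε hε t
      refine ⟨Iio (t + 1), Iio_mem_nhds (by linarith), ?_⟩
      filter_upwards [(hgeo (B (max (t + 1) 0))).eventually (gt_mem_nhds hε)] with n hn s hs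
      rw [dist_comm, Real.dist_eq]
      exact (hdist (max (t + 1) 0) n (max s 0)
        ⟨le_max_right _ _, max_le_max hs.le le_rfl⟩).trans_lt hn
    exact hloc.continuous (Frequently.of_forall fun n =>
      (hcont n).comp (continuous_id.max continuous_const))
  refine ⟨v, hvc, fun t ht => ?_⟩
  obtain ⟨C, hC0, hC⟩ := ha.lipschitz t
  have h1 : Tendsto (fun n => picardIterate a v₀ (n + 1) t) atTop (𝓝 (v t)) := by
    rw [hvL t ht]
    exact (hL t ht).comp (tendsto_add_atTop_nat 1)
  have h2 : Tendsto (fun n => picardIterate a v₀ (n + 1) t) atTop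
      (𝓝 (v₀ + ∫ s in (0 : ℝ)..t, a v s)) := by
    rw [tendsto_iff_dist_tendsto_zero]
    refine squeeze_zero (g := fun n : ℕ => C * (B t * (1 / 2) ^ n / (1 - 1 / 2)) * t)
      (fun _ => dist_nonneg) (fun n => ?_) ?_
    · have e : picardIterate a v₀ (n + 1) t - (v₀ + ∫ s in (0 : ℝ)..t, a v s) =
          ∫ s in (0 : ℝ)..t, (a (picardIterate a v₀ n) s - a v s) := by
        rw [intervalIntegral.integral_sub
          ((ha.continuous _ (hcont n)).intervalIntegrable _ _)
          ((ha.continuous _ hvc).intervalIntegrable _ _)]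
        exact add_sub_add_left_eq_sub _ _ _
      rw [Real.dist_eq, e]
      have := intervalIntegral.norm_integral_le_of_norm_le_const (a := 0) (b := t)
        (f := fun s => a (picardIterate a v₀ n) s - a v s)
        (C := C * (B t * (1 / 2) ^ n / (1 - 1 / 2))) fun s hs => by
          rw [uIoc_of_le ht] at hs
          refine hC _ _ (hcont n) hvc s ⟨hs.1.le, hs.2⟩ _ fun r hr => ?_
          rw [hvL r hr.1]
          exact hdist t n r ⟨hr.1, hr.2.trans hs.2⟩
      simpa [abs_of_nonneg ht] using this
    · simpa using ((hgeo (B t)).const_mul C).mul_const t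
  exact tendsto_nhds_unique h1 h2

/-! ### Trajectories and their velocities -/

theorem trajectory_of_integral {v a y : ℝ → ℝ} {v₀ : ℝ} (hv : Continuous v)
    (ha : Continuous a) (hva : ∀ t, 0 ≤ t → v t = v₀ + ∫ s in (0 : ℝ)..t, a s)
    (hy : ∀ t, y t = ∫ s in (0 : ℝ)..t, v s) :
    IsTrajectory v₀ y ∧ (∀ t, 0 ≤ t → velocity y t = v t) ∧
      ∀ t, 0 < t → iteratedDeriv 2 y t = a t := by
  have hyd : ∀ t, HasDerivAt y (v t) t := by
    rw [funext hy]
    exact fun t => (hv.integral_hasStrictDerivAt 0 t).hasDerivAt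
  have hvel : ∀ t, 0 ≤ t → velocity y t = v t := fun t ht =>
    (hyd t).hasDerivWithinAt.derivWithin (uniqueDiffOn_Ici 0 t ht)
  -- `v` satisfies its equation only for t ≥ 0; `V` is a C¹ function on the line that agrees with it
  -- there.
  set V : ℝ → ℝ := fun t => v₀ + ∫ s in (0 : ℝ)..t, a s
  have hVd : ∀ t, HasDerivAt V (a t) t := fun t =>
    (ha.integral_hasStrictDerivAt 0 t).hasDerivAt.const_add v₀
  have hV1 : ContDiff ℝ 1 V := by
    rw [contDiff_one_iff_deriv]
    refine ⟨fun t => (hVd t).differentiableAt, ?_⟩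
    rw [funext fun t => (hVd t).deriv]
    exact ha
  refine ⟨⟨?_, by simp [hy], ?_⟩, hvel, fun t ht => ?_⟩
  · rw [show (2 : ℕ∞ω) = 1 + 1 by norm_num, contDiffOn_succ_iff_derivWithin (uniqueDiffOn_Ici 0)]
    refine ⟨fun t _ => (hyd t).differentiableAt.differentiableWithinAt, by simp, ?_⟩
    exact hV1.contDiffOn.congr fun t ht => (hvel t ht).trans (hva t ht)
  · rw [hvel 0 le_rfl, hva 0 le_rfl]; simp
  · rw [iteratedDeriv_succ, iteratedDeriv_one, funext fun t => (hyd t).deriv]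
    have : v =ᶠ[𝓝 t] V := by
      filter_upwards [lt_mem_nhds ht] with s hs using hva s hs.le
    rw [this.deriv_eq, (hVd t).deriv]

theorem IsTrajectory.velocity_contDiffOn {v₀ : ℝ} {y : ℝ → ℝ} (h : IsTrajectory v₀ y) :
    ContDiffOn ℝ 1 (velocity y) (Ici 0) := by
  have := h.contDiffOn
  rw [show (2 : ℕ∞ω) = 1 + 1 by norm_num,
    contDiffOn_succ_iff_derivWithin (uniqueDiffOn_Ici 0)] at this
  exact this.2.2

theorem IsTrajectory.hasDerivAt {v₀ : ℝ} {y : ℝ → ℝ} (h : IsTrajectory v₀ y) {t : ℝ} (ht : 0 < t) :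
    HasDerivAt y (velocity y t) t :=
  ((h.contDiffOn.differentiableOn (by norm_num)) t ht.le).hasDerivWithinAt.hasDerivAt
    (Ici_mem_nhds ht)

theorem IsTrajectory.hasDerivAt_velocity {v₀ : ℝ} {y : ℝ → ℝ} (h : IsTrajectory v₀ y) {t : ℝ}
    (ht : 0 < t) : HasDerivAt (velocity y) (iteratedDeriv 2 y t) t := by
  have h1 := ((h.velocity_contDiffOn.differentiableOn (by norm_num)) t
    ht.le).differentiableAt (Ici_mem_nhds ht)
  refine h1.hasDerivAt.congr_deriv ?_
  rw [iteratedDeriv_succ, iteratedDeriv_one]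
  refine EventuallyEq.deriv_eq ?_
  filter_upwards [lt_mem_nhds ht] with s hs using (h.hasDerivAt hs).deriv.symm

theorem IsTrajectory.eq_integral {v₀ : ℝ} {y : ℝ → ℝ} (h : IsTrajectory v₀ y) {t : ℝ}
    (ht : 0 ≤ t) : y t = ∫ s in (0 : ℝ)..t, velocity y s := by
  have := intervalIntegral.integral_eq_sub_of_hasDerivAt_of_le ht
    (h.contDiffOn.continuousOn.mono Icc_subset_Ici_self) (fun s hs => h.hasDerivAt hs.1)
    ((h.velocity_contDiffOn.continuousOn.mono Icc_subset_Ici_self).intervalIntegrable_of_Icc ht)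
  rw [this, h.position_zero, sub_zero]

theorem IsTrajectory.velocity_eq_integral {v₀ : ℝ} {y a : ℝ → ℝ} (h : IsTrajectory v₀ y)
    (ha : ContinuousOn a (Ici 0)) (hya : ∀ t, 0 < t → iteratedDeriv 2 y t = a t) {t : ℝ}
    (ht : 0 ≤ t) : velocity y t = v₀ + ∫ s in (0 : ℝ)..t, a s := by
  have := intervalIntegral.integral_eq_sub_of_hasDerivAt_of_le ht
    (h.velocity_contDiffOn.continuousOn.mono Icc_subset_Ici_self)
    (fun s hs => (h.hasDerivAt_velocity hs.1).congr_deriv (hya s hs.1))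
    ((ha.mono Icc_subset_Ici_self).intervalIntegrable_of_Icc ht)
  rw [this, h.velocity_zero]; ring

/-! ### The smeared system -/

/-- The position reached from the origin with velocity `v`. -/
def position (v : ℝ → ℝ) (t : ℝ) : ℝ := ∫ s in (0 : ℝ)..t, v s

theorem position_hasDerivAt {v : ℝ → ℝ} (hv : Continuous v) (t : ℝ) :
    HasDerivAt (position v) (v t) t :=
  (hv.integral_hasStrictDerivAt 0 t).hasDerivAt

theorem position_continuous {v : ℝ → ℝ} (hv : Continuous v) : Continuous (position v) :=
  continuous_primitive hv

theorem position_contDiff {v : ℝ → ℝ} (hv : Continuous v) : ContDiff ℝ 1 (position v) := by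
  rw [contDiff_one_iff_deriv]
  refine ⟨fun t => (position_hasDerivAt hv t).differentiableAt, ?_⟩
  rw [funext fun t => (position_hasDerivAt hv t).deriv]
  exact hv

theorem position_congr {v w : ℝ → ℝ} {t : ℝ} (ht : 0 ≤ t) (h : ∀ s ∈ Icc 0 t, v s = w s) :
    position v t = position w t :=
  intervalIntegral.integral_congr fun s hs => h s (by rwa [uIcc_of_le ht] at hs)

theorem abs_position_sub_le {v w : ℝ → ℝ} (hv : Continuous v) (hw : Continuous w) {t A : ℝ}
    (ht : 0 ≤ t) (h : ∀ s ∈ Icc 0 t, |v s - w s| ≤ A) :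
    |position v t - position w t| ≤ A * t := by
  rw [position, position, ← intervalIntegral.integral_sub (hv.intervalIntegrable _ _)
    (hw.intervalIntegrable _ _)]
  have := intervalIntegral.norm_integral_le_of_norm_le_const (a := 0) (b := t)
    (f := fun s => v s - w s) (C := A) fun s hs => by
      rw [uIoc_of_le ht] at hs
      exact h s ⟨hs.1.le, hs.2⟩
  simpa [abs_of_nonneg ht] using this

/-- The acceleration caused by the field of the particle itself, for the kernel `g`, as a
functional of the velocity. -/
def selfAcceleration (b c : ℝ) (g : ℝ → ℝ) (v : ℝ → ℝ) (t : ℝ) : ℝ :=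
  b * retardedField g c (position v) (position v t) t

theorem retardedField_path_continuous {g : ℝ → ℝ} (hg : Continuous g) {y : ℝ → ℝ}
    (hy : Continuous y) (c : ℝ) : Continuous fun t => retardedField g c y (y t) t :=
  (retardedField_continuous hg hy c).comp (hy.prodMk continuous_id)

/-- A smooth kernel of positive width is Lipschitz, and positions differ by at most T times the
difference of the velocities. Each of the two kernel values moves by at most L · 2AT, and
integrating over a time of at most T gives 4LT²A. The speed is not bounded in this argument, so
supersonic data are covered. -/
theorem selfAcceleration_causalLipschitz (b c : ℝ) {σ : ℝ} (hσ : 0 < σ) :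
    CausalLipschitz (selfAcceleration b c (gaussianDelta σ)) := by
  have hg := gaussianDelta_continuous σ
  obtain ⟨L, hL0, hL⟩ := exists_gaussianDelta_lipschitz hσ
  refine ⟨fun v hv => continuous_const.mul
    (retardedField_path_continuous hg (position_continuous hv) c), fun T => ?_⟩
  refine ⟨|b| * (4 * L * T ^ 2), by positivity, fun v w hv hw t ht A hA => ?_⟩
  have hA0 : 0 ≤ A := (abs_nonneg _).trans (hA 0 ⟨le_rfl, ht.1⟩)
  have hT : 0 ≤ T := ht.1.trans ht.2
  have hpos : ∀ s ∈ Icc 0 t, |position v s - position w s| ≤ A * T := fun s hs =>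
    (abs_position_sub_le hv hw hs.1 fun r hr => hA r ⟨hr.1, hr.2.trans hs.2⟩).trans
      (by gcongr; exact hs.2.trans ht.2)
  have hvc := position_continuous hv
  have hwc := position_continuous hw
  rw [selfAcceleration, selfAcceleration, ← mul_sub, abs_mul, mul_assoc]
  gcongr
  rw [retardedField, retardedField, ← intervalIntegral.integral_sub]
  · have := intervalIntegral.norm_integral_le_of_norm_le_const (a := 0) (b := t) (C := 4 * L * T * A)
      (f := fun s => (gaussianDelta σ (position v t - position v s + c * (t - s)) -
        gaussianDelta σ (position v t - position v s - c * (t - s))) -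
        (gaussianDelta σ (position w t - position w s + c * (t - s)) -
        gaussianDelta σ (position w t - position w s - c * (t - s)))) fun s hs => by
      rw [uIoc_of_le ht.1] at hs
      have h1 := hL (position v t - position v s + c * (t - s))
        (position w t - position w s + c * (t - s))
      have h2 := hL (position v t - position v s - c * (t - s))
        (position w t - position w s - c * (t - s))
      have hdiff : |(position v t - position w t) - (position v s - position w s)| ≤
          A * T + A * T :=
        (abs_sub _ _).trans (add_le_add (hpos t ⟨ht.1, le_rfl⟩) (hpos s ⟨hs.1.le, hs.2⟩))
      have e1 : position v t - position v s + c * (t - s) -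
          (position w t - position w s + c * (t - s)) =
          (position v t - position w t) - (position v s - position w s) := by ring
      have e2 : position v t - position v s - c * (t - s) -
          (position w t - position w s - c * (t - s)) =
          (position v t - position w t) - (position v s - position w s) := by ring
      rw [e1] at h1
      rw [e2] at h2
      have h3 := mul_le_mul_of_nonneg_left hdiff hL0
      rw [Real.norm_eq_abs, sub_sub_sub_comm]
      refine (abs_sub _ _).trans ?_
      linarith
    rw [Real.norm_eq_abs, sub_zero, abs_of_nonneg ht.1] at this
    refine this.trans ?_
    have : 4 * L * T * A * t ≤ 4 * L * T * A * T := by gcongr; exact ht.2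
    linarith
  · exact (by fun_prop : Continuous _).intervalIntegrable _ _
  · exact (by fun_prop : Continuous _).intervalIntegrable _ _

theorem continuous_comp_max {f : ℝ → ℝ} (hf : ContinuousOn f (Ici 0)) :
    Continuous fun t => f (max t 0) :=
  hf.comp_continuous (by fun_prop) fun t => by simp

theorem IsTrajectory.eq_position {v₀ : ℝ} {y : ℝ → ℝ} (h : IsTrajectory v₀ y) {t : ℝ}
    (ht : 0 ≤ t) : y t = position (fun t => velocity y (max t 0)) t := by
  rw [h.eq_integral ht]
  exact position_congr ht fun s hs => by rw [max_eq_left hs.1]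

/-- The equation of motion of the smeared system, with the field eliminated. -/
theorem IsSmoothSolution.newton_eq {m c β v₀ σ : ℝ} (hm : 0 < m) (hc : 0 < c) (hσ : 0 < σ)
    {φ : ℝ → ℝ → ℝ} {y : ℝ → ℝ} (h : IsSmoothSolution m c β v₀ (gaussianDelta σ) φ y)
    {t : ℝ} (ht : 0 < t) :
    iteratedDeriv 2 y t = selfAcceleration (β ^ 2 / (2 * c * m)) c
      (gaussianDelta (Real.sqrt 2 * σ)) (fun t => velocity y (max t 0)) t := by
  set v : ℝ → ℝ := fun t => velocity y (max t 0) with hv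
  have hvc : Continuous v := continuous_comp_max h.trajectory.velocity_contDiffOn.continuousOn
  have hforce := h.newton t ht
  have hfield : (fun x => φ x t) =
      fun x => β / (2 * c) * retardedField (smoothStep σ) c (position v) x t := by
    funext x
    rw [h.field_eq hc x ht.le,
      retardedField_congr ht.le (fun s hs => h.trajectory.eq_position hs.1)]
  rw [hfield] at hforce
  have h2 := hasForce_smoothStep hσ (position_continuous hvc) c β (β / (2 * c)) (y t) ht.le
  have := hforce.2.unique h2.2
  rw [selfAcceleration, ← h.trajectory.eq_position ht.le]
  field_simp at this ⊢
  linarith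

theorem IsSmoothSolution.velocity_eq {m c β v₀ σ : ℝ} (hm : 0 < m) (hc : 0 < c) (hσ : 0 < σ)
    {φ : ℝ → ℝ → ℝ} {y : ℝ → ℝ} (h : IsSmoothSolution m c β v₀ (gaussianDelta σ) φ y)
    {t : ℝ} (ht : 0 ≤ t) :
    velocity y t = v₀ + ∫ s in (0 : ℝ)..t, selfAcceleration (β ^ 2 / (2 * c * m)) c
      (gaussianDelta (Real.sqrt 2 * σ)) (fun t => velocity y (max t 0)) s := by
  have hvc : Continuous fun t => velocity y (max t 0) :=
    continuous_comp_max h.trajectory.velocity_contDiffOn.continuousOn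
  exact h.trajectory.velocity_eq_integral ((selfAcceleration_causalLipschitz _ c
    (by positivity)).continuous _ hvc).continuousOn (fun t ht => h.newton_eq hm hc hσ ht) ht

theorem IsSmoothSolution.unique {m c β v₀ σ : ℝ} (hm : 0 < m) (hc : 0 < c) (hσ : 0 < σ)
    {φ₁ φ₂ : ℝ → ℝ → ℝ} {y₁ y₂ : ℝ → ℝ}
    (h₁ : IsSmoothSolution m c β v₀ (gaussianDelta σ) φ₁ y₁)
    (h₂ : IsSmoothSolution m c β v₀ (gaussianDelta σ) φ₂ y₂) {t : ℝ} (ht : 0 ≤ t) :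
    y₁ t = y₂ t ∧ ∀ x, φ₁ x t = φ₂ x t := by
  have hv : ∀ {φ : ℝ → ℝ → ℝ} {y : ℝ → ℝ}, IsSmoothSolution m c β v₀ (gaussianDelta σ) φ y →
      (Continuous fun t => velocity y (max t 0)) ∧ ∀ t, 0 ≤ t → velocity y (max t 0) =
        v₀ + ∫ s in (0 : ℝ)..t, selfAcceleration (β ^ 2 / (2 * c * m)) c
          (gaussianDelta (Real.sqrt 2 * σ)) (fun t => velocity y (max t 0)) s :=
    fun h => ⟨continuous_comp_max h.trajectory.velocity_contDiffOn.continuousOn,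
      fun t ht => by rw [max_eq_left ht, h.velocity_eq hm hc hσ ht]⟩
  have hvel : ∀ t, 0 ≤ t → velocity y₁ (max t 0) = velocity y₂ (max t 0) := fun t ht =>
    (selfAcceleration_causalLipschitz _ c (by positivity)).unique (hv h₁).1 (hv h₂).1
      (hv h₁).2 (hv h₂).2 ht
  have hy : ∀ t, 0 ≤ t → y₁ t = y₂ t := fun t ht => by
    rw [h₁.trajectory.eq_position ht, h₂.trajectory.eq_position ht]
    exact position_congr ht fun s hs => hvel s hs.1
  refine ⟨hy t ht, fun x => ?_⟩
  rw [h₁.field_eq hc x ht, h₂.field_eq hc x ht, retardedField_congr ht fun s hs => hy s hs.1]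

theorem exists_isSmoothSolution {m c : ℝ} (β v₀ : ℝ) {σ : ℝ} (hm : 0 < m) (hc : 0 < c)
    (hσ : 0 < σ) : ∃ (φ : ℝ → ℝ → ℝ) (y : ℝ → ℝ),
      IsSmoothSolution m c β v₀ (gaussianDelta σ) φ y := by
  have hcl := selfAcceleration_causalLipschitz (β ^ 2 / (2 * c * m)) c
    (by positivity : 0 < Real.sqrt 2 * σ)
  obtain ⟨v, hvc, hv⟩ := hcl.exists_solution v₀
  obtain ⟨htraj, -, hacc⟩ := trajectory_of_integral hvc (hcl.continuous v hvc) hv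
    (y := position v) fun _ => rfl
  have hyc := position_continuous hvc
  have hC2 := retardedField_contDiff hσ (position_contDiff hvc) c
  refine ⟨fun x t => β / (2 * c) * retardedField (smoothStep σ) c (position v) x t, position v,
    (contDiff_const.mul hC2).contDiffOn, fun x => by simp [retardedField_initial], fun x => ?_,
    fun x t ht => ?_, htraj, fun t ht => ?_⟩
  · have := ((retardedField_derivWithin_zero hσ hyc c x).const_mul (β / (2 * c))).hasDerivWithinAt
      (s := Ici 0)
    rw [this.derivWithin (uniqueDiffOn_Ici 0 0 self_mem_Ici), mul_zero]
  · have h1 : ContDiff ℝ 2 fun s => retardedField (smoothStep σ) c (position v) x s :=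
      hC2.comp (by fun_prop : ContDiff ℝ 2 fun s : ℝ => (x, s))
    have h2 : ContDiff ℝ 2 fun z => retardedField (smoothStep σ) c (position v) z t :=
      hC2.comp (by fun_prop : ContDiff ℝ 2 fun z : ℝ => (z, t))
    rw [iteratedDeriv_const_mul _ h1.contDiffAt, iteratedDeriv_const_mul _ h2.contDiffAt,
      retardedField_wave hσ hyc]
    field_simp
  · rw [hacc t ht]
    have h2 := hasForce_smoothStep hσ hyc c β (β / (2 * c)) (position v t) ht.le
    convert h2 using 1
    rw [selfAcceleration]
    field_simp

/-! ### Estimates along subsonic trajectories -/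

section Subsonic

variable {k k' : ℝ → ℝ} {δ t : ℝ}

/-- A change of variables without inverting k: insert k'/δ ≥ 1 into the integral and use the
primitive. In the applications k is a light-cone phase, and δ = c - K measures how far the motion is
from the speed of sound. -/
theorem integral_comp_le_of_deriv_ge (hk : ∀ s, HasDerivAt k (k' s) s) (hk' : Continuous k')
    (hδ : 0 < δ) (ht : 0 ≤ t) (hge : ∀ s ∈ Icc 0 t, δ ≤ k' s) {f F : ℝ → ℝ} (hf : Continuous f)
    (hf0 : ∀ r, 0 ≤ f r) (hF : ∀ r, HasDerivAt F (f r) r) :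
    ∫ s in (0 : ℝ)..t, f (k s) ≤ (F (k t) - F (k 0)) / δ := by
  have hkc : Continuous k := continuous_iff_continuousAt.2 fun s => (hk s).continuousAt
  have h1 : ∫ s in (0 : ℝ)..t, f (k s) * k' s = F (k t) - F (k 0) :=
    intervalIntegral.integral_eq_sub_of_hasDerivAt (f := fun s => F (k s))
      (fun s _ => (hF (k s)).comp s (hk s))
      ((by fun_prop : Continuous fun s => f (k s) * k' s).intervalIntegrable _ _)
  rw [← h1, le_div_iff₀ hδ, ← intervalIntegral.integral_mul_const]
  refine intervalIntegral.integral_mono_on ht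
    ((by fun_prop : Continuous fun s => f (k s) * δ).intervalIntegrable _ _)
    ((by fun_prop : Continuous fun s => f (k s) * k' s).intervalIntegrable _ _) fun s hs => ?_
  exact mul_le_mul_of_nonneg_left (hge s hs) (hf0 _)

theorem integral_gaussianDelta_comp_le (hk : ∀ s, HasDerivAt k (k' s) s) (hk' : Continuous k')
    (hδ : 0 < δ) (ht : 0 ≤ t) (hge : ∀ s ∈ Icc 0 t, δ ≤ k' s) {σ : ℝ} (hσ : 0 < σ) :
    ∫ s in (0 : ℝ)..t, gaussianDelta σ (k s) ≤ 1 / δ := by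
  refine (integral_comp_le_of_deriv_ge hk hk' hδ ht hge (gaussianDelta_continuous σ)
    (fun r => (gaussianDelta_pos hσ r).le) (smoothStep_hasDerivAt σ)).trans ?_
  gcongr
  have h1 := abs_le.1 (abs_smoothStep_le hσ (k t))
  have h2 := abs_le.1 (abs_smoothStep_le hσ (k 0))
  linarith

theorem integral_smoothStep_band_le (hk : ∀ s, HasDerivAt k (k' s) s) (hk' : Continuous k')
    (hδ : 0 < δ) (ht : 0 ≤ t) (hge : ∀ s ∈ Icc 0 t, δ ≤ k' s) {σ ε : ℝ} (hσ : 0 < σ)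
    (hε : 0 ≤ ε) :
    ∫ s in (0 : ℝ)..t, (smoothStep σ (k s + ε) - smoothStep σ (k s - ε)) ≤ 2 * ε / δ := by
  have hG := smoothStep_continuous σ
  have hP : ∀ r, HasDerivAt (fun r => ∫ x in (0 : ℝ)..r, smoothStep σ x) (smoothStep σ r) r :=
    fun r => (hG.integral_hasStrictDerivAt 0 r).hasDerivAt
  refine (integral_comp_le_of_deriv_ge hk hk' hδ ht hge
    (f := fun r => smoothStep σ (r + ε) - smoothStep σ (r - ε)) (by fun_prop)
    (fun r => sub_nonneg.2 (smoothStep_mono hσ (by linarith)))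
    (fun r => ((hP _).comp_add_const r ε).sub ((hP _).comp_sub_const r ε))).trans ?_
  gcongr
  -- The primitive of the band is an integral of the step, of size at most 1/2, over a window of
  -- length 2ε; its two end values differ by at most 2ε, whatever σ is.
  have hb : ∀ r, |(∫ x in (0 : ℝ)..(r + ε), smoothStep σ x) -
      ∫ x in (0 : ℝ)..(r - ε), smoothStep σ x| ≤ ε := by
    intro r
    rw [intervalIntegral.integral_interval_sub_left (hG.intervalIntegrable _ _)
      (hG.intervalIntegrable _ _)]
    have := intervalIntegral.norm_integral_le_of_norm_le_const (a := r - ε) (b := r + ε)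
      (f := smoothStep σ) (C := 1 / 2) fun s _ => abs_smoothStep_le hσ s
    rw [show r + ε - (r - ε) = 2 * ε by ring, abs_of_nonneg (by positivity)] at this
    rw [← Real.norm_eq_abs]
    linarith
  have h1 := abs_le.1 (hb (k t))
  have h2 := abs_le.1 (hb (k 0))
  simp only [Pi.sub_apply]
  linarith [h1.2, h2.1]

end Subsonic

section Trajectory

variable {v : ℝ → ℝ} {c K t : ℝ}

theorem position_neg (v : ℝ → ℝ) (t : ℝ) : position (fun s => -v s) t = -position v t :=
  intervalIntegral.integral_neg

theorem position_zero (v : ℝ → ℝ) : position v 0 = 0 := by simp [position]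

/-- The sign makes this phase increasing, like the other one; it is harmless later because the
Gaussian is even and the step is odd. -/
theorem hasDerivAt_retarded_add (hv : Continuous v) (c x t s : ℝ) :
    HasDerivAt (fun s => -(x - position v s + c * (t - s))) (c + v s) s := by
  have h1 := (position_hasDerivAt hv s).const_sub x
  have h2 := ((hasDerivAt_id s).const_sub t).const_mul c
  refine (h1.add h2).neg.congr_deriv ?_
  ring

theorem hasDerivAt_retarded_sub (hv : Continuous v) (c x t s : ℝ) :
    HasDerivAt (fun s => x - position v s - c * (t - s)) (c - v s) s := by
  have h1 := (position_hasDerivAt hv s).const_sub x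
  have h2 := ((hasDerivAt_id s).const_sub t).const_mul c
  refine (h1.sub h2).congr_deriv ?_
  ring

/-- The apex time r need not be the end t of the integration: with x = r = 0 the phase measures the
distance of the particle to the light cone of the origin, as `abs_sub_limit_equation_le` requires.
-/
theorem integral_gaussianDelta_retarded_add_le (hv : Continuous v) (hKc : K < c) (ht : 0 ≤ t)
    (hK : ∀ s ∈ Icc 0 t, |v s| ≤ K) {σ : ℝ} (hσ : 0 < σ) (x r : ℝ) :
    ∫ s in (0 : ℝ)..t, gaussianDelta σ (x - position v s + c * (r - s)) ≤ 1 / (c - K) := by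
  have := integral_gaussianDelta_comp_le (hasDerivAt_retarded_add hv c x r)
    (by fun_prop) (sub_pos.2 hKc) ht
    (fun s hs => by linarith [(abs_le.1 (hK s hs)).1]) hσ
  simpa only [gaussianDelta_neg] using this

theorem integral_gaussianDelta_retarded_sub_le (hv : Continuous v) (hKc : K < c) (ht : 0 ≤ t)
    (hK : ∀ s ∈ Icc 0 t, |v s| ≤ K) {σ : ℝ} (hσ : 0 < σ) (x r : ℝ) :
    ∫ s in (0 : ℝ)..t, gaussianDelta σ (x - position v s - c * (r - s)) ≤ 1 / (c - K) :=
  integral_gaussianDelta_comp_le (hasDerivAt_retarded_sub hv c x r)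
    (by fun_prop) (sub_pos.2 hKc) ht
    (fun s hs => by linarith [(abs_le.1 (hK s hs)).2]) hσ

theorem abs_retardedField_gaussianDelta_le (hv : Continuous v) (hKc : K < c) (ht : 0 ≤ t)
    (hK : ∀ s ∈ Icc 0 t, |v s| ≤ K) {σ : ℝ} (hσ : 0 < σ) (x : ℝ) :
    |retardedField (gaussianDelta σ) c (position v) x t| ≤ 1 / (c - K) := by
  have hg := gaussianDelta_continuous σ
  have hp := position_continuous hv
  rw [retardedField, intervalIntegral.integral_sub
    ((by fun_prop : Continuous _).intervalIntegrable _ _)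
    ((by fun_prop : Continuous _).intervalIntegrable _ _)]
  have h1 := integral_gaussianDelta_retarded_add_le hv hKc ht hK hσ x t
  have h2 := integral_gaussianDelta_retarded_sub_le hv hKc ht hK hσ x t
  have h3 := intervalIntegral.integral_nonneg ht (μ := volume)
    fun s _ => (gaussianDelta_pos hσ (x - position v s + c * (t - s))).le
  have h4 := intervalIntegral.integral_nonneg ht (μ := volume)
    fun s _ => (gaussianDelta_pos hσ (x - position v s - c * (t - s))).le
  rw [abs_le]
  constructor <;> linarith

/-- The phase a decreases to 0 at s = t with slope -(c + v). If v were frozen at v(t), substitution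
would give `smoothStep ε (a 0)` / (c + v(t)), close to half the mass over c + v(t). Freezing costs a
first moment: |v(t) - v(s)| ≤ A (t-s) ≤ A a(s)/(c-K), and the first moment of the Gaussian is O(ε).
The other error is the tail beyond a(0) = y(t) + ct, which is small only once the particle is well
inside the light cone of the origin. -/
theorem abs_integral_retarded_sub_half_le (hv : Continuous v) (hKc : K < c) (ht : 0 ≤ t)
    (hK : ∀ s ∈ Icc 0 t, |v s| ≤ K) {A : ℝ} (hA : ∀ s ∈ Icc 0 t, |v t - v s| ≤ A * (t - s))
    (hA0 : 0 ≤ A) {ε : ℝ} (hε : 0 < ε) :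
    |(∫ s in (0 : ℝ)..t, gaussianDelta ε (position v t - position v s + c * (t - s))) -
        1 / (2 * (c + v t))| ≤
      2 * ε / (c - K) * (A / (c - K) ^ 2 + gaussianDelta ε (position v t + c * t)) := by
  have hg := gaussianDelta_continuous ε
  have hg2 := gaussianDelta_continuous (Real.sqrt 2 * ε)
  have hp := position_continuous hv
  have hδ : 0 < c - K := sub_pos.2 hKc
  set a : ℝ → ℝ := fun s => position v t - position v s + c * (t - s) with ha
  have hac : Continuous a := by fun_prop
  have hpos : ∀ s ∈ Icc 0 t, c - K ≤ c + v s := fun s hs => by linarith [(abs_le.1 (hK s hs)).1]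
  have had : ∀ s, HasDerivAt (fun s => -a s) (c + v s) s :=
    hasDerivAt_retarded_add hv c (position v t) t
  have hage : ∀ s ∈ Icc 0 t, (c - K) * (t - s) ≤ a s := by
    intro s hs
    have := (convex_Icc 0 t).mul_sub_le_image_sub_of_le_deriv (f := fun s => -a s) (C := c - K)
      (by fun_prop) (fun r _ => (had r).differentiableAt.differentiableWithinAt)
      (fun r hr => by rw [(had r).deriv]; exact hpos r (interior_subset hr)) s hs t
      ⟨ht, le_rfl⟩ hs.2
    have h0 : a t = 0 := by simp [ha]
    simp only [h0] at this
    linarith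
  have h1 : ∫ s in (0 : ℝ)..t, gaussianDelta ε (a s) * (c + v s) = smoothStep ε (a 0) := by
    have := intervalIntegral.integral_eq_sub_of_hasDerivAt (a := 0) (b := t)
      (f := fun s => smoothStep ε (-a s))
      (f' := fun s => gaussianDelta ε (-a s) * (c + v s))
      (fun s _ => HasDerivAt.comp (h := fun s => -a s) s (smoothStep_hasDerivAt ε (-a s)) (had s))
      ((by fun_prop : Continuous _).intervalIntegrable _ _)
    simp only [gaussianDelta_neg, smoothStep_neg] at this
    rw [this]
    simp [ha, smoothStep_zero]
  have h2 : (c + v t) * (∫ s in (0 : ℝ)..t, gaussianDelta ε (a s)) - smoothStep ε (a 0) =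
      ∫ s in (0 : ℝ)..t, gaussianDelta ε (a s) * (v t - v s) := by
    rw [← h1, ← intervalIntegral.integral_const_mul, ← intervalIntegral.integral_sub
      ((by fun_prop : Continuous _).intervalIntegrable _ _)
      ((by fun_prop : Continuous _).intervalIntegrable _ _)]
    congr 1
    funext s
    ring
  have h3 : |∫ s in (0 : ℝ)..t, gaussianDelta ε (a s) * (v t - v s)| ≤
      2 * ε * A / (c - K) ^ 2 := by
    have hle : ‖∫ s in (0 : ℝ)..t, gaussianDelta ε (a s) * (v t - v s)‖ ≤
        ∫ s in (0 : ℝ)..t, 2 * ε * A / (c - K) * gaussianDelta (Real.sqrt 2 * ε) (a s) := by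
      refine intervalIntegral.norm_integral_le_of_norm_le ht
        (Eventually.of_forall fun s hs => ?_)
        ((by fun_prop : Continuous _).intervalIntegrable _ _)
      have hs' : s ∈ Icc 0 t := ⟨hs.1.le, hs.2⟩
      have ha1 := hage s hs'
      have hts : 0 ≤ t - s := by linarith [hs.2]
      have ha0 : 0 ≤ a s := (mul_nonneg hδ.le hts).trans ha1
      have hg0 := gaussianDelta_pos hε (a s)
      have hm := abs_mul_gaussianDelta_le hε (a s)
      rw [abs_of_nonneg ha0] at hm
      rw [Real.norm_eq_abs, abs_mul, abs_of_pos hg0]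
      calc gaussianDelta ε (a s) * |v t - v s|
          ≤ gaussianDelta ε (a s) * (A * (t - s)) := by gcongr; exact hA s hs'
        _ ≤ gaussianDelta ε (a s) * (A * (a s / (c - K))) := by
            gcongr
            rw [le_div_iff₀ hδ]; linarith
        _ = A / (c - K) * (a s * gaussianDelta ε (a s)) := by ring
        _ ≤ A / (c - K) * (2 * ε * gaussianDelta (Real.sqrt 2 * ε) (a s)) := by gcongr
        _ = _ := by ring
    rw [intervalIntegral.integral_const_mul] at hle
    have h4 := integral_gaussianDelta_retarded_add_le hv hKc ht hK
      (by positivity : 0 < Real.sqrt 2 * ε) (position v t) t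
    calc _ ≤ _ := hle
      _ ≤ 2 * ε * A / (c - K) * (1 / (c - K)) := by gcongr
      _ = _ := by field_simp
  have ha0 : a 0 = position v t + c * t := by simp [ha, position_zero]
  have h4 : |smoothStep ε (a 0) - 1 / 2| ≤ 2 * ε * gaussianDelta ε (position v t + c * t) := by
    have h0 : 0 ≤ a 0 := (mul_nonneg hδ.le (by linarith)).trans (hage 0 ⟨le_rfl, ht⟩)
    rw [abs_sub_comm, abs_of_nonneg (by linarith [smoothStep_le_half hε (a 0)]), ← ha0]
    exact half_sub_smoothStep_le hε h0
  have hct : c - K ≤ c + v t := hpos t ⟨ht, le_rfl⟩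
  have hct0 : 0 < c + v t := hδ.trans_le hct
  set I := ∫ s in (0 : ℝ)..t, gaussianDelta ε (a s)
  have h5 : |(c + v t) * I - 1 / 2| ≤
      2 * ε * (A / (c - K) ^ 2 + gaussianDelta ε (position v t + c * t)) := by
    calc |(c + v t) * I - 1 / 2|
        = |((c + v t) * I - smoothStep ε (a 0)) + (smoothStep ε (a 0) - 1 / 2)| := by ring_nf
      _ ≤ _ := abs_add_le _ _
      _ ≤ 2 * ε * A / (c - K) ^ 2 + 2 * ε * gaussianDelta ε (position v t + c * t) := by
          rw [h2]; gcongr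
      _ = _ := by ring
  have h6 : I - 1 / (2 * (c + v t)) = ((c + v t) * I - 1 / 2) / (c + v t) := by field_simp
  have hgp := gaussianDelta_pos hε (position v t + c * t)
  rw [h6, abs_div, abs_of_pos hct0]
  calc |(c + v t) * I - 1 / 2| / (c + v t)
      ≤ (2 * ε * (A / (c - K) ^ 2 + gaussianDelta ε (position v t + c * t))) / (c - K) := by
        gcongr
    _ = _ := by ring

/-- The slope of the field of a point source at its position, averaged over both sides. -/
def meanSlope (c v : ℝ) : ℝ := 1 / (2 * (c + v)) - 1 / (2 * (c - v))

/-- Up to an error linear in the smearing width, the self-force only depends on the present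
velocity. -/
theorem abs_retardedField_sub_meanSlope_le (hv : Continuous v) (hKc : K < c) (ht : 0 ≤ t)
    (hK : ∀ s ∈ Icc 0 t, |v s| ≤ K) {A : ℝ} (hA : ∀ s ∈ Icc 0 t, |v t - v s| ≤ A * (t - s))
    (hA0 : 0 ≤ A) {ε : ℝ} (hε : 0 < ε) :
    |retardedField (gaussianDelta ε) c (position v) (position v t) t - meanSlope c (v t)| ≤
      2 * ε / (c - K) * (2 * A / (c - K) ^ 2 + gaussianDelta ε (position v t + c * t) +
        gaussianDelta ε (position v t - c * t)) := by
  have hg := gaussianDelta_continuous ε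
  have hp := position_continuous hv
  have h1 := abs_integral_retarded_sub_half_le hv hKc ht hK hA hA0 hε
  -- The other family of characteristics is obtained by reflecting space.
  have h2 := abs_integral_retarded_sub_half_le (v := fun s => -v s) hv.neg hKc ht
    (fun s hs => by rw [abs_neg]; exact hK s hs)
    (fun s hs => by rw [neg_sub_neg, abs_sub_comm]; exact hA s hs) hA0 hε
  simp only [position_neg] at h2
  have e : ∀ s, -position v t - -position v s + c * (t - s) =
      -(position v t - position v s - c * (t - s)) := fun s => by ring
  simp only [e, gaussianDelta_neg] at h2
  rw [show -position v t + c * t = -(position v t - c * t) by ring, gaussianDelta_neg,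
    ← sub_eq_add_neg] at h2
  rw [retardedField, intervalIntegral.integral_sub
    ((by fun_prop : Continuous _).intervalIntegrable _ _)
    ((by fun_prop : Continuous _).intervalIntegrable _ _), meanSlope, sub_sub_sub_comm]
  refine (abs_sub _ _).trans ((add_le_add h1 h2).trans (le_of_eq ?_))
  ring

theorem intervalIntegrable_sharpStep_comp {k : ℝ → ℝ} (hk : Continuous k) (a b : ℝ) :
    IntervalIntegrable (fun s => sharpStep (k s)) volume a b :=
  intervalIntegrable_iff.2 (Measure.integrableOn_of_bounded (M := 1 / 2) (by simp)
    (sharpStep_measurable.comp hk.measurable).aestronglyMeasurable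
    (Eventually.of_forall fun s => abs_sharpStep_le _))

theorem abs_integral_smoothStep_sub_sharpStep_le {k : ℝ → ℝ} (hk : Continuous k) (ht : 0 ≤ t)
    {σ : ℝ} (hσ : 0 < σ) :
    |∫ s in (0 : ℝ)..t, (smoothStep σ (k s) - sharpStep (k s))| ≤
      2 * σ * ∫ s in (0 : ℝ)..t, gaussianDelta σ (k s) := by
  have hg := gaussianDelta_continuous σ
  rw [← intervalIntegral.integral_const_mul]
  exact intervalIntegral.norm_integral_le_of_norm_le
    (f := fun s => smoothStep σ (k s) - sharpStep (k s)) (g := fun s => 2 * σ * gaussianDelta σ (k s)) ht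
    (Eventually.of_forall fun s _ => abs_smoothStep_sub_sharpStep_le hσ (k s))
    ((by fun_prop : Continuous _).intervalIntegrable _ _)

/-- The steps differ by at most 2σ times a Gaussian, whose integral along each phase is at most
1/(c-K). Nothing depends on x, which yields uniform convergence on the whole line. -/
theorem abs_retardedField_smoothStep_sub_sharpStep_le (hv : Continuous v) (hKc : K < c)
    (ht : 0 ≤ t) (hK : ∀ s ∈ Icc 0 t, |v s| ≤ K) {σ : ℝ} (hσ : 0 < σ) (x : ℝ) :
    |retardedField (smoothStep σ) c (position v) x t - retardedField sharpStep c (position v) x t|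
      ≤ 4 * σ / (c - K) := by
  have hp := position_continuous hv
  have hG := smoothStep_continuous σ
  have c1 : Continuous fun s => x - position v s + c * (t - s) := by fun_prop
  have c2 : Continuous fun s => x - position v s - c * (t - s) := by fun_prop
  have i1 : IntervalIntegrable (fun s => smoothStep σ (x - position v s + c * (t - s)))
      volume 0 t := (hG.comp c1).intervalIntegrable 0 t
  have i2 : IntervalIntegrable (fun s => smoothStep σ (x - position v s - c * (t - s)))
      volume 0 t := (hG.comp c2).intervalIntegrable 0 t
  have i3 := intervalIntegrable_sharpStep_comp c1 0 t
  have i4 := intervalIntegrable_sharpStep_comp c2 0 t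
  have e : retardedField (smoothStep σ) c (position v) x t -
      retardedField sharpStep c (position v) x t =
      (∫ s in (0 : ℝ)..t, (smoothStep σ (x - position v s + c * (t - s)) -
        sharpStep (x - position v s + c * (t - s)))) -
      ∫ s in (0 : ℝ)..t, (smoothStep σ (x - position v s - c * (t - s)) -
        sharpStep (x - position v s - c * (t - s))) := by
    rw [retardedField, retardedField, ← intervalIntegral.integral_sub (i1.sub i2) (i3.sub i4),
      ← intervalIntegral.integral_sub (i1.sub i3) (i2.sub i4)]
    congr 1
    funext s
    ring
  rw [e]
  have h1 := abs_integral_smoothStep_sub_sharpStep_le c1 ht hσ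
  have h2 := abs_integral_smoothStep_sub_sharpStep_le c2 ht hσ
  have h3 := integral_gaussianDelta_retarded_add_le hv hKc ht hK hσ x t
  have h4 := integral_gaussianDelta_retarded_sub_le hv hKc ht hK hσ x t
  have h5 := mul_le_mul_of_nonneg_left h3 (by positivity : 0 ≤ 2 * σ)
  have h6 := mul_le_mul_of_nonneg_left h4 (by positivity : 0 ≤ 2 * σ)
  have h7 : 4 * σ / (c - K) = 2 * σ * (1 / (c - K)) + 2 * σ * (1 / (c - K)) := by ring
  rw [h7]
  exact (abs_sub _ _).trans (add_le_add (h1.trans h5) (h2.trans h6))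

/-- Monotonicity replaces the Lipschitz constant of the step, which blows up like 1/σ; the band on
the right has an integral along the phase bounded independently of σ. -/
theorem abs_smoothStep_sub_le {σ : ℝ} (hσ : 0 < σ) {r r' ε : ℝ} (h : |r' - r| ≤ ε) :
    |smoothStep σ r' - smoothStep σ r| ≤ smoothStep σ (r + ε) - smoothStep σ (r - ε) := by
  have hmono := smoothStep_mono hσ
  have hε : 0 ≤ ε := (abs_nonneg _).trans h
  rw [abs_le] at h ⊢
  have h1 : smoothStep σ r' ≤ smoothStep σ (r + ε) := hmono (by linarith)
  have h2 : smoothStep σ (r - ε) ≤ smoothStep σ r' := hmono (by linarith)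
  have h3 : smoothStep σ r ≤ smoothStep σ (r + ε) := hmono (by linarith)
  have h4 : smoothStep σ (r - ε) ≤ smoothStep σ r := hmono (by linarith)
  constructor <;> linarith

/-- Stability of the field under perturbations of a subsonic trajectory. -/
theorem abs_retardedField_smoothStep_sub_le (hv : Continuous v) (hKc : K < c) (ht : 0 ≤ t)
    (hK : ∀ s ∈ Icc 0 t, |v s| ≤ K) {σ : ℝ} (hσ : 0 < σ) {y : ℝ → ℝ} (hy : Continuous y) {ε : ℝ}
    (hε : ∀ s ∈ Icc 0 t, |y s - position v s| ≤ ε) (x : ℝ) :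
    |retardedField (smoothStep σ) c y x t - retardedField (smoothStep σ) c (position v) x t|
      ≤ 4 * ε / (c - K) := by
  have hε0 : 0 ≤ ε := (abs_nonneg _).trans (hε 0 ⟨le_rfl, ht⟩)
  have hp := position_continuous hv
  have hG := smoothStep_continuous σ
  set k₁ : ℝ → ℝ := fun s => x - position v s + c * (t - s) with hk₁
  set k₂ : ℝ → ℝ := fun s => x - position v s - c * (t - s) with hk₂
  have c1 : Continuous k₁ := by fun_prop
  have c2 : Continuous k₂ := by fun_prop
  have hle : ‖∫ s in (0 : ℝ)..t, ((smoothStep σ (x - y s + c * (t - s)) -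
      smoothStep σ (x - y s - c * (t - s))) - (smoothStep σ (k₁ s) - smoothStep σ (k₂ s)))‖ ≤
      ∫ s in (0 : ℝ)..t, ((smoothStep σ (-k₁ s + ε) - smoothStep σ (-k₁ s - ε)) +
        (smoothStep σ (k₂ s + ε) - smoothStep σ (k₂ s - ε))) := by
    refine intervalIntegral.norm_integral_le_of_norm_le ht
      (Eventually.of_forall fun s hs => ?_)
      ((by fun_prop : Continuous _).intervalIntegrable _ _)
    have hs' := hε s ⟨hs.1.le, hs.2⟩
    rw [abs_sub_comm] at hs'
    have b1 := abs_smoothStep_sub_le hσ (r := k₁ s) (r' := x - y s + c * (t - s)) (ε := ε)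
      (by simp only [hk₁]; convert hs' using 2; ring)
    have b2 := abs_smoothStep_sub_le hσ (r := k₂ s) (r' := x - y s - c * (t - s)) (ε := ε)
      (by simp only [hk₂]; convert hs' using 2; ring)
    rw [show -k₁ s + ε = -(k₁ s - ε) by ring, show -k₁ s - ε = -(k₁ s + ε) by ring,
      smoothStep_neg, smoothStep_neg, Real.norm_eq_abs, sub_sub_sub_comm]
    refine (abs_sub _ _).trans ?_
    linarith
  have h1 := integral_smoothStep_band_le (hasDerivAt_retarded_add hv c x t) (by fun_prop)
    (sub_pos.2 hKc) ht (fun s hs => by linarith [(abs_le.1 (hK s hs)).1]) hσ hε0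
  have h2 := integral_smoothStep_band_le (hasDerivAt_retarded_sub hv c x t) (by fun_prop)
    (sub_pos.2 hKc) ht (fun s hs => by linarith [(abs_le.1 (hK s hs)).2]) hσ hε0
  rw [intervalIntegral.integral_add ((by fun_prop : Continuous _).intervalIntegrable _ _)
    ((by fun_prop : Continuous _).intervalIntegrable _ _), intervalIntegral.integral_sub
    ((by fun_prop : Continuous _).intervalIntegrable _ _)
    ((by fun_prop : Continuous _).intervalIntegrable _ _)] at hle
  rw [show 4 * ε / (c - K) = 2 * ε / (c - K) + 2 * ε / (c - K) by ring]
  exact hle.trans (add_le_add h1 h2)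

end Trajectory

/-! ### The limiting equation of motion -/

theorem meanSlope_eq {c v : ℝ} (h : |v| < c) : meanSlope c v = -v / (c ^ 2 - v ^ 2) := by
  obtain ⟨h1, h2⟩ := abs_lt.1 h
  have h3 : c + v ≠ 0 := by linarith
  have h4 : c - v ≠ 0 := by linarith
  rw [meanSlope, show c ^ 2 - v ^ 2 = (c + v) * (c - v) by ring]
  field_simp
  ring

theorem meanSlope_contDiffAt {c v : ℝ} (h : |v| < c) {n : ℕ∞} : ContDiffAt ℝ n (meanSlope c) v := by
  obtain ⟨h1, h2⟩ := abs_lt.1 h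
  have h3 : 2 * (c + v) ≠ 0 := by linarith
  have h4 : 2 * (c - v) ≠ 0 := by linarith
  have e1 : ContDiffAt ℝ n (fun v => 1 / (2 * (c + v))) v :=
    contDiffAt_const.div (by fun_prop) h3
  have e2 : ContDiffAt ℝ n (fun v => 1 / (2 * (c - v))) v :=
    contDiffAt_const.div (by fun_prop) h4
  exact e1.sub e2

theorem continuousOn_meanSlope_comp {c K : ℝ} (hKc : K < c) {v : ℝ → ℝ} {s : Set ℝ}
    (hv : ContinuousOn v s) (hK : ∀ t ∈ s, |v t| ≤ K) :
    ContinuousOn (fun t => meanSlope c (v t)) s := fun t ht =>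
  ((meanSlope_contDiffAt ((hK t ht).trans_lt hKc) (n := 0)).continuousAt).comp_continuousWithinAt
    (hv t ht)

theorem abs_meanSlope_sub_le {c K u w : ℝ} (hKc : K < c) (hu : |u| ≤ K) (hw : |w| ≤ K) :
    |meanSlope c u - meanSlope c w| ≤ |u - w| / (c - K) ^ 2 := by
  obtain ⟨u1, u2⟩ := abs_le.1 hu
  obtain ⟨w1, w2⟩ := abs_le.1 hw
  have hδ : 0 < c - K := sub_pos.2 hKc
  have key : ∀ p q : ℝ, c - K ≤ p → c - K ≤ q →
      |1 / (2 * p) - 1 / (2 * q)| ≤ |p - q| / (c - K) ^ 2 / 2 := by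
    intro p q hp hq
    have hp0 : 0 < p := hδ.trans_le hp
    have hq0 : 0 < q := hδ.trans_le hq
    rw [show 1 / (2 * p) - 1 / (2 * q) = (q - p) / (p * q) / 2 by field_simp, abs_div, abs_div,
      abs_sub_comm, abs_of_pos (mul_pos hp0 hq0), abs_two]
    have : (c - K) ^ 2 ≤ p * q := by rw [sq]; gcongr
    gcongr
  have h1 := key (c + u) (c + w) (by linarith) (by linarith)
  have h2 := key (c - u) (c - w) (by linarith) (by linarith)
  rw [add_sub_add_left_eq_sub] at h1
  rw [sub_sub_sub_cancel_left, abs_sub_comm w u] at h2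
  rw [meanSlope, meanSlope, sub_sub_sub_comm]
  refine (abs_sub _ _).trans ?_
  linarith

/-- Stability of the limiting equation of motion under perturbations. -/
theorem abs_sub_le_of_approx_solution {b c K v₀ T ε : ℝ} (hKc : K < c) (hε : 0 ≤ ε)
    {v w : ℝ → ℝ} (hv : Continuous v) (hw : Continuous w)
    (hvK : ∀ t ∈ Icc 0 T, |v t| ≤ K) (hwK : ∀ t ∈ Icc 0 T, |w t| ≤ K)
    (hve : ∀ t ∈ Icc 0 T, v t = v₀ + ∫ s in (0 : ℝ)..t, b * meanSlope c (v s))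
    (hwe : ∀ t ∈ Icc 0 T, |w t - (v₀ + ∫ s in (0 : ℝ)..t, b * meanSlope c (w s))| ≤ ε) :
    ∀ t ∈ Icc 0 T, |w t - v t| ≤
      2 * ε * Real.exp ((2 * (|b| / (c - K) ^ 2) + 1) * t) := by
  have hδ : 0 < c - K := sub_pos.2 hKc
  refine le_of_weighted_bound (by fun_prop) hε (by positivity) fun A l hA hl h t ht => ?_
  have hsub : Icc 0 t ⊆ Icc 0 T := Icc_subset_Icc_right ht.2
  have iv : IntervalIntegrable (fun s => b * meanSlope c (v s)) volume 0 t :=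
    (continuousOn_const.mul (continuousOn_meanSlope_comp hKc hv.continuousOn
      fun s hs => hvK s (hsub hs))).intervalIntegrable_of_Icc ht.1
  have iw : IntervalIntegrable (fun s => b * meanSlope c (w s)) volume 0 t :=
    (continuousOn_const.mul (continuousOn_meanSlope_comp hKc hw.continuousOn
      fun s hs => hwK s (hsub hs))).intervalIntegrable_of_Icc ht.1
  have h1 : |∫ s in (0 : ℝ)..t, (b * meanSlope c (w s) - b * meanSlope c (v s))| ≤
      |b| / (c - K) ^ 2 * A * (Real.exp (l * t) / l) := by
    refine abs_integral_le_weighted hl ht.1 (by positivity) fun s hs => ?_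
    rw [← mul_sub, abs_mul]
    calc |b| * |meanSlope c (w s) - meanSlope c (v s)|
        ≤ |b| * (|w s - v s| / (c - K) ^ 2) := by
          gcongr; exact abs_meanSlope_sub_le hKc (hwK s (hsub hs)) (hvK s (hsub hs))
      _ ≤ |b| * (A * Real.exp (l * s) / (c - K) ^ 2) := by gcongr; exact h s (hsub hs)
      _ = _ := by ring
  rw [intervalIntegral.integral_sub iw iv] at h1
  calc |w t - v t| = |(w t - (v₀ + ∫ s in (0 : ℝ)..t, b * meanSlope c (w s))) +
        ((∫ s in (0 : ℝ)..t, b * meanSlope c (w s)) -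
          ∫ s in (0 : ℝ)..t, b * meanSlope c (v s))| := by rw [hve t ht]; ring_nf
    _ ≤ _ := abs_add_le _ _
    _ ≤ _ := add_le_add (hwe t ht) h1

theorem abs_clamp_le {K : ℝ} (hK : 0 ≤ K) (x : ℝ) : |max (-K) (min K x)| ≤ K :=
  abs_le.2 ⟨le_max_left _ _, max_le (by linarith) (min_le_left _ _)⟩

theorem clamp_eq_self {K x : ℝ} (h : |x| ≤ K) : max (-K) (min K x) = x := by
  rw [min_eq_right (abs_le.1 h).2, max_eq_right (abs_le.1 h).1]

theorem mul_clamp_nonneg {K : ℝ} (hK : 0 ≤ K) (x : ℝ) : 0 ≤ x * max (-K) (min K x) := by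
  rcases le_total 0 x with h | h
  · exact mul_nonneg h (le_max_of_le_right (le_min hK h))
  · exact mul_nonneg_of_nonpos_of_nonpos h
      (max_le (by linarith) ((min_le_right _ _).trans h))

theorem abs_clamp_sub_clamp_le (K x y : ℝ) :
    |max (-K) (min K x) - max (-K) (min K y)| ≤ |x - y| :=
  (abs_max_sub_max_le_max _ _ _ _).trans (max_le (by simp)
    ((abs_min_sub_min_le_max _ _ _ _).trans (max_le (by simp) le_rfl)))

/-- The slope is singular at v = ±c. Clamping its argument to [-K, K] puts the equation within reach
of the general existence theorem; `exists_limit_velocity` shows that the clamp at K = |v₀| is never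
active. -/
theorem clampedSlope_causalLipschitz (b : ℝ) {c K : ℝ} (hK : 0 ≤ K) (hKc : K < c) :
    CausalLipschitz fun v t => b * meanSlope c (max (-K) (min K (v t))) := by
  refine ⟨fun v hv => ?_, fun T => ⟨|b| / (c - K) ^ 2, by positivity,
    fun v w hv hw t ht A hA => ?_⟩⟩
  · rw [← continuousOn_univ]
    exact continuousOn_const.mul (continuousOn_meanSlope_comp hKc (by fun_prop)
      fun t _ => abs_clamp_le hK _)
  · rw [← mul_sub, abs_mul]
    calc |b| * |meanSlope c (max (-K) (min K (v t))) - meanSlope c (max (-K) (min K (w t)))|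
        ≤ |b| * (|max (-K) (min K (v t)) - max (-K) (min K (w t))| / (c - K) ^ 2) := by
          gcongr; exact abs_meanSlope_sub_le hKc (abs_clamp_le hK _) (abs_clamp_le hK _)
      _ ≤ |b| * (A / (c - K) ^ 2) := by
          gcongr
          exact (abs_clamp_sub_clamp_le _ _ _).trans (hA t ⟨ht.1, le_rfl⟩)
      _ = _ := by ring

/-- The limiting equation of motion has a global solution, whose speed never increases. -/
theorem exists_limit_velocity {b c v₀ : ℝ} (hb : 0 ≤ b) (hv₀ : |v₀| < c) :
    ∃ v : ℝ → ℝ, Continuous v ∧ (∀ t, |v t| ≤ |v₀|) ∧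
      ∀ t, 0 ≤ t → v t = v₀ + ∫ s in (0 : ℝ)..t, b * meanSlope c (v s) := by
  have hcl := clampedSlope_causalLipschitz b (abs_nonneg v₀) hv₀
  obtain ⟨v, hvc, hv⟩ := hcl.exists_solution v₀
  have hac := hcl.continuous v hvc
  have hder : ∀ t, 0 < t →
      HasDerivAt v (b * meanSlope c (max (-|v₀|) (min |v₀| (v t)))) t := by
    intro t ht
    refine ((hac.integral_hasStrictDerivAt 0 t).hasDerivAt.const_add v₀).congr_of_eventuallyEq ?_
    filter_upwards [lt_mem_nhds ht] with s hs using hv s hs.le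
  -- Even the clamped force opposes the motion, as v · clamp(v) ≥ 0, so the speed cannot exceed its
  -- initial value.
  have hanti : AntitoneOn (fun t => v t ^ 2) (Ici 0) := by
    refine antitoneOn_of_deriv_nonpos (convex_Ici 0) (by fun_prop)
      (fun t ht => ?_) (fun t ht => ?_)
    · rw [interior_Ici] at ht
      exact ((hder t ht).pow 2).differentiableAt.differentiableWithinAt
    · rw [interior_Ici] at ht
      have hd := (hder t ht).pow 2
      have h1 := abs_clamp_le (abs_nonneg v₀) (v t)
      have h2 := mul_clamp_nonneg (abs_nonneg v₀) (v t)
      refine le_of_eq_of_le hd.deriv ?_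
      set r := max (-|v₀|) (min |v₀| (v t))
      have h3 : 0 < c ^ 2 - r ^ 2 := by
        have := abs_le.1 h1
        nlinarith [sq_abs r, abs_nonneg r]
      rw [meanSlope_eq (h1.trans_lt hv₀)]
      have h4 : 0 ≤ v t * r / (c ^ 2 - r ^ 2) * b := by positivity
      calc _ = -(2 * (v t * r / (c ^ 2 - r ^ 2) * b)) := by push_cast; ring
        _ ≤ 0 := by linarith
  have hbound : ∀ t, 0 ≤ t → |v t| ≤ |v₀| := by
    intro t ht
    have h0 : v 0 = v₀ := by rw [hv 0 le_rfl]; simp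
    have := hanti self_mem_Ici ht ht
    simp only [h0] at this
    exact sq_le_sq.1 this
  refine ⟨fun t => v (max t 0), hvc.comp (by fun_prop), fun t => hbound _ (le_max_right _ _),
    fun t ht => ?_⟩
  simp only [max_eq_left ht]
  rw [hv t ht]
  congr 1
  refine intervalIntegral.integral_congr fun s hs => ?_
  rw [uIcc_of_le ht] at hs
  simp only [max_eq_left hs.1, clamp_eq_self (hbound s hs.1)]

section LimitVelocity

variable {b c v₀ : ℝ} {v : ℝ → ℝ}

theorem hasDerivWithinAt_limit_velocity (hv₀ : |v₀| < c) (hvc : Continuous v)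
    (hvK : ∀ t, |v t| ≤ |v₀|)
    (hv : ∀ t, 0 ≤ t → v t = v₀ + ∫ s in (0 : ℝ)..t, b * meanSlope c (v s)) {t : ℝ} (ht : 0 ≤ t) :
    HasDerivWithinAt v (b * meanSlope c (v t)) (Ici 0) t := by
  have hac : Continuous fun s => b * meanSlope c (v s) := by
    rw [← continuousOn_univ]
    exact continuousOn_const.mul (continuousOn_meanSlope_comp hv₀ hvc.continuousOn
      fun t _ => hvK t)
  exact ((hac.integral_hasStrictDerivAt 0 t).hasDerivAt.const_add v₀).hasDerivWithinAt.congr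
    (fun s hs => hv s hs) (hv t ht)

/-- Bootstrap: the derivative is a smooth function of v away from ±c, so each degree of smoothness
of v gives the next. -/
theorem limit_velocity_contDiffOn (hv₀ : |v₀| < c) (hvc : Continuous v) (hvK : ∀ t, |v t| ≤ |v₀|)
    (hv : ∀ t, 0 ≤ t → v t = v₀ + ∫ s in (0 : ℝ)..t, b * meanSlope c (v s)) :
    ContDiffOn ℝ ∞ v (Ici 0) := by
  have hd := fun t (ht : t ∈ Ici (0 : ℝ)) => hasDerivWithinAt_limit_velocity hv₀ hvc hvK hv ht
  rw [contDiffOn_infty]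
  intro n
  induction n with
  | zero => exact contDiffOn_zero.2 hvc.continuousOn
  | succ n ih =>
    rw [Nat.cast_add, Nat.cast_one, contDiffOn_succ_iff_derivWithin (uniqueDiffOn_Ici 0)]
    refine ⟨fun t ht => (hd t ht).differentiableWithinAt, by simp, ?_⟩
    refine ContDiffOn.congr (f := fun t => b * meanSlope c (v t)) ?_
      fun t ht => (hd t ht).derivWithin (uniqueDiffOn_Ici 0 t ht)
    refine contDiffOn_const.mul fun t ht => ?_
    exact ContDiffAt.comp_contDiffWithinAt t
      (meanSlope_contDiffAt ((hvK t).trans_lt hv₀) (n := n)) (ih t ht)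

/-- Read as a linear equation v' = -(b/(c² - v²)) v with known coefficient, the equation is solved
by an integrating factor. For b ≥ 0 the sign of v is constant and |v| decreases; the bound c² - v² ≤
c² gives the rate b/c². -/
theorem limit_velocity_eq_exp (hv₀ : |v₀| < c) (hvc : Continuous v)
    (hvK : ∀ t, |v t| ≤ |v₀|)
    (hv : ∀ t, 0 ≤ t → v t = v₀ + ∫ s in (0 : ℝ)..t, b * meanSlope c (v s)) {t : ℝ} (ht : 0 ≤ t) :
    v t = v₀ * Real.exp (-∫ s in (0 : ℝ)..t, b / (c ^ 2 - v s ^ 2)) := by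
  have hpos : ∀ s, 0 < c ^ 2 - v s ^ 2 := fun s => by
    nlinarith [sq_abs (v s), abs_nonneg (v s), hvK s]
  have hpc : Continuous fun s => b / (c ^ 2 - v s ^ 2) :=
    continuous_const.div (by fun_prop) fun s => (hpos s).ne'
  set P : ℝ → ℝ := fun t => ∫ s in (0 : ℝ)..t, b / (c ^ 2 - v s ^ 2) with hP
  have hPd : ∀ t, HasDerivAt P (b / (c ^ 2 - v t ^ 2)) t := fun t =>
    (hpc.integral_hasStrictDerivAt 0 t).hasDerivAt
  have hPc : Continuous P := continuous_primitive hpc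
  have hconst := intervalIntegral.integral_eq_sub_of_hasDerivAt_of_le ht
    (f := fun t => v t * Real.exp (P t)) (f' := fun _ => 0) (by fun_prop) (fun s hs => by
      have h1 := (hasDerivWithinAt_limit_velocity hv₀ hvc hvK hv hs.1.le).hasDerivAt
        (Ici_mem_nhds hs.1)
      refine (h1.mul (hPd s).exp).congr_deriv ?_
      rw [meanSlope_eq ((hvK s).trans_lt hv₀)]
      ring) (by simp)
  have h0 : v 0 = v₀ := by rw [hv 0 le_rfl]; simp
  have hP0 : P 0 = 0 := by simp [hP]
  simp only [intervalIntegral.integral_zero, h0, hP0, Real.exp_zero, mul_one] at hconst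
  rw [← sub_eq_zero.1 hconst.symm, mul_assoc, ← Real.exp_add]
  simp [hP]

theorem limit_velocity_monotone (hb : 0 ≤ b) (hv₀ : |v₀| < c) (hvc : Continuous v)
    (hvK : ∀ t, |v t| ≤ |v₀|)
    (hv : ∀ t, 0 ≤ t → v t = v₀ + ∫ s in (0 : ℝ)..t, b * meanSlope c (v s)) :
    MonotoneOn v (Ici 0) ∨ AntitoneOn v (Ici 0) := by
  have hpos : ∀ s, 0 < c ^ 2 - v s ^ 2 := fun s => by
    nlinarith [sq_abs (v s), abs_nonneg (v s), hvK s]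
  have hpc : Continuous fun s => b / (c ^ 2 - v s ^ 2) :=
    continuous_const.div (by fun_prop) fun s => (hpos s).ne'
  have hexp : ∀ s t : ℝ, s ≤ t → Real.exp (-∫ r in (0 : ℝ)..t, b / (c ^ 2 - v r ^ 2)) ≤
      Real.exp (-∫ r in (0 : ℝ)..s, b / (c ^ 2 - v r ^ 2)) := by
    intro s t hst
    have h1 := intervalIntegral.integral_add_adjacent_intervals (hpc.intervalIntegrable 0 s)
      (hpc.intervalIntegrable (μ := volume) s t)
    have h2 := intervalIntegral.integral_nonneg hst (μ := volume)
      fun r _ => div_nonneg hb (hpos r).le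
    gcongr
    linarith
  rcases le_total v₀ 0 with h0 | h0
  · refine Or.inl fun s hs t ht hst => ?_
    rw [limit_velocity_eq_exp hv₀ hvc hvK hv hs, limit_velocity_eq_exp hv₀ hvc hvK hv ht]
    exact mul_le_mul_of_nonpos_left (hexp s t hst) h0
  · refine Or.inr fun s hs t ht hst => ?_
    rw [limit_velocity_eq_exp hv₀ hvc hvK hv hs, limit_velocity_eq_exp hv₀ hvc hvK hv ht]
    exact mul_le_mul_of_nonneg_left (hexp s t hst) h0

theorem limit_velocity_decay (hb : 0 ≤ b) (hv₀ : |v₀| < c) (hvc : Continuous v)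
    (hvK : ∀ t, |v t| ≤ |v₀|)
    (hv : ∀ t, 0 ≤ t → v t = v₀ + ∫ s in (0 : ℝ)..t, b * meanSlope c (v s)) {t : ℝ} (ht : 0 ≤ t) :
    |v t| ≤ |v₀| * Real.exp (-(b / c ^ 2) * t) := by
  have hpos : ∀ s, 0 < c ^ 2 - v s ^ 2 := fun s => by
    nlinarith [sq_abs (v s), abs_nonneg (v s), hvK s]
  have hpc : Continuous fun s => b / (c ^ 2 - v s ^ 2) :=
    continuous_const.div (by fun_prop) fun s => (hpos s).ne'
  rw [limit_velocity_eq_exp hv₀ hvc hvK hv ht, abs_mul, Real.abs_exp]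
  gcongr
  have h : ∫ s in (0 : ℝ)..t, b / c ^ 2 ≤ ∫ s in (0 : ℝ)..t, b / (c ^ 2 - v s ^ 2) :=
    intervalIntegral.integral_mono_on ht (by simp) (hpc.intervalIntegrable _ _) fun s _ => by
      have := hpos s
      gcongr
      linarith [sq_nonneg (v s)]
  rw [intervalIntegral.integral_const, smul_eq_mul] at h
  linarith

end LimitVelocity

/-! ### Weak fields of a point source -/

theorem two_le_smooth : (2 : ℕ∞ω) ≤ ∞ := by
  have : ((2 : ℕ∞) : ℕ∞ω) ≤ ((⊤ : ℕ∞) : ℕ∞ω) := WithTop.coe_le_coe.2 le_top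
  exact this

section Box

variable {ψ : ℝ × ℝ → ℝ}

/-- The wave operator in two variables. -/
def waveOp (c : ℝ) (ψ : ℝ × ℝ → ℝ) (p : ℝ × ℝ) : ℝ :=
  fderiv ℝ (fderiv ℝ ψ) p (0, 1) (0, 1) - c ^ 2 * fderiv ℝ (fderiv ℝ ψ) p (1, 0) (1, 0)

theorem iteratedDeriv_time (hψ : ContDiff ℝ ∞ ψ) (x t : ℝ) :
    iteratedDeriv 2 (fun s => ψ (x, s)) t = fderiv ℝ (fderiv ℝ ψ) (x, t) (0, 1) (0, 1) :=
  iteratedDeriv_two_line (γ := fun s => (x, s))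
    (fun s => (hasDerivAt_const s x).prodMk (hasDerivAt_id s)) rfl
    (hψ.contDiffAt.of_le two_le_smooth)

theorem iteratedDeriv_space (hψ : ContDiff ℝ ∞ ψ) (x t : ℝ) :
    iteratedDeriv 2 (fun z => ψ (z, t)) x = fderiv ℝ (fderiv ℝ ψ) (x, t) (1, 0) (1, 0) :=
  iteratedDeriv_two_line (γ := fun z => (z, t))
    (fun s => (hasDerivAt_id s).prodMk (hasDerivAt_const s t)) rfl
    (hψ.contDiffAt.of_le two_le_smooth)

theorem waveOp_eq (hψ : ContDiff ℝ ∞ ψ) (c x t : ℝ) :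
    iteratedDeriv 2 (fun s : ℝ => ψ (x, s)) t -
      c ^ 2 * iteratedDeriv 2 (fun z : ℝ => ψ (z, t)) x = waveOp c ψ (x, t) := by
  rw [iteratedDeriv_time hψ, iteratedDeriv_space hψ, waveOp]

theorem waveOp_continuous (hψ : ContDiff ℝ ∞ ψ) (c : ℝ) : Continuous (waveOp c ψ) := by
  have h1 : ContDiff ℝ 1 (fderiv ℝ ψ) := hψ.fderiv_right (by norm_num; exact two_le_smooth)
  have h2 : Continuous (fderiv ℝ (fderiv ℝ ψ)) := h1.continuous_fderiv (by norm_num)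
  unfold waveOp
  fun_prop

theorem waveOp_eq_zero {p : ℝ × ℝ} (hp : ψ =ᶠ[𝓝 p] 0) (c : ℝ) : waveOp c ψ p = 0 := by
  have h2 : fderiv ℝ (fderiv ℝ ψ) p = 0 := by
    rw [hp.fderiv.fderiv_eq, fderiv_zero, Pi.zero_def, fderiv_const_apply]
  simp [waveOp, h2]

theorem exists_vanishing_box (hc : HasCompactSupport ψ) :
    ∃ R : ℝ, 0 < R ∧ ∀ p : ℝ × ℝ, R < |p.1| ∨ R < |p.2| → ψ p = 0 := by
  obtain ⟨R, hR⟩ := hc.isCompact.isBounded.subset_closedBall 0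
  refine ⟨max R 1, by positivity, fun p hp => ?_⟩
  by_contra hne
  have := hR (subset_tsupport ψ hne)
  rw [mem_closedBall_zero_iff, Prod.norm_def, max_le_iff, Real.norm_eq_abs, Real.norm_eq_abs] at this
  rcases hp with h | h
  · linarith [le_max_left R 1, this.1]
  · linarith [le_max_left R 1, this.2]

theorem waveOp_vanishing {R : ℝ} (h : ∀ p : ℝ × ℝ, R < |p.1| ∨ R < |p.2| → ψ p = 0) (c : ℝ)
    {p : ℝ × ℝ} (hp : R < |p.1| ∨ R < |p.2|) : waveOp c ψ p = 0 := by
  refine waveOp_eq_zero ?_ c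
  have ho : IsOpen {p : ℝ × ℝ | R < |p.1| ∨ R < |p.2|} :=
    (isOpen_lt continuous_const (continuous_abs.comp continuous_fst)).union
      (isOpen_lt continuous_const (continuous_abs.comp continuous_snd))
  filter_upwards [ho.mem_nhds hp] with q hq using h q hq

theorem integrable_of_vanishing {f : ℝ → ℝ} (hf : Continuous f) {R : ℝ}
    (h : ∀ x, R < |x| → f x = 0) : Integrable f := by
  refine hf.integrable_of_hasCompactSupport
    (HasCompactSupport.intro (isCompact_Icc (a := -R) (b := R)) fun x hx => h x ?_)
  by_contra hle
  exact hx (abs_le.1 (not_lt.1 hle))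

/-- Integrating the wave operator over a forward light cone recovers the value at the apex. -/
theorem integral_waveOp_cone {c : ℝ} (hc : 0 < c) (hψ : ContDiff ℝ ∞ ψ) {R T : ℝ}
    (h : ∀ p : ℝ × ℝ, R < |p.1| ∨ R < |p.2| → ψ p = 0) (hT : R < T) (z : ℝ) {s : ℝ} (hs : s ≤ T) :
    ∫ t in s..T, ∫ ξ in (z - c * (t - s))..(z + c * (t - s)), waveOp c ψ (ξ, t) =
      2 * c * ψ (z, s) := by
  have hzero : ∀ x t, R < t → ψ (x, t) = 0 := fun x t ht =>
    h (x, t) (Or.inr (ht.trans_le (le_abs_self t)))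
  have hu : ContDiff ℝ ∞ fun p : ℝ × ℝ => ψ (p.1, T - p.2) := by fun_prop
  have hbox := waveOp_continuous hψ c
  -- Time reversal: ψ vanishes after time R < T, so in reversed time it has zero initial data, and
  -- the forward cone becomes a backward one.
  have hd := dAlembert (u := fun x t => ψ (x, T - t)) (F := fun x t => waveOp c ψ (x, T - t)) hc
    (by unfold Function.uncurry; fun_prop)
    (hu.of_le two_le_smooth).contDiffOn (fun x => hzero x _ (by linarith))
    (fun x => by
      have hev : (fun s => ψ (x, T - s)) =ᶠ[𝓝 0] fun _ => 0 := by
        filter_upwards [gt_mem_nhds (sub_pos.2 hT)] with s hs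
        exact hzero x _ (by linarith)
      exact ((hasDerivAt_const (0 : ℝ) (0 : ℝ)).congr_of_eventuallyEq
        hev).hasDerivWithinAt.derivWithin (uniqueDiffOn_Ici 0 0 self_mem_Ici))
    (fun x t _ => by
      have ht : iteratedDeriv 2 (fun s => ψ (x, T - s)) t =
          fderiv ℝ (fderiv ℝ ψ) (x, T - t) (0, -1) (0, -1) :=
        iteratedDeriv_two_line (γ := fun s => (x, T - s)) (fun s => (hasDerivAt_const s x).prodMk
          (by simpa using (hasDerivAt_id s).const_sub T)) rfl
          (hψ.contDiffAt.of_le two_le_smooth)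
      have e : ((0, -1) : ℝ × ℝ) = -(0, 1) := by simp
      rw [ht, iteratedDeriv_space hψ, waveOp, e]
      simp only [map_neg, neg_apply, neg_neg]
      ring) z (sub_nonneg.2 hs)
  have hsub := intervalIntegral.integral_comp_sub_left (a := 0) (b := T - s)
    (fun t => ∫ ξ in (z - c * (t - s))..(z + c * (t - s)), waveOp c ψ (ξ, t)) T
  rw [sub_zero, sub_sub_cancel] at hsub
  simp only [sub_sub_cancel] at hd
  rw [hd, ← hsub]
  have e : ∀ r, T - s - r = T - r - s := fun r => by ring
  simp only [e]
  field_simp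

/-- The difference of the two steps is the indicator of the interval except at p and q, where
`Real.sign` takes the value 0. -/
theorem integral_sharpStep_window (f : ℝ → ℝ) {p q : ℝ} (hpq : p ≤ q) :
    ∫ x, (sharpStep (x - p) - sharpStep (x - q)) * f x = ∫ x in p..q, f x := by
  rw [intervalIntegral.integral_of_le hpq, ← integral_indicator measurableSet_Ioc]
  refine integral_congr_ae ?_
  filter_upwards [(Set.toFinite {p, q}).countable.ae_notMem volume] with x hx
  simp only [mem_insert_iff, mem_singleton_iff, not_or] at hx
  have hneg : ∀ r : ℝ, r < 0 → sharpStep r = -(1 / 2) := fun r hr => by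
    rw [← neg_neg r, sharpStep_neg, sharpStep_of_pos (by linarith)]
  rcases lt_or_gt_of_ne hx.1 with h1 | h1
  · rw [hneg _ (by linarith), hneg _ (by linarith), indicator_of_notMem (fun h => by
      linarith [h.1])]
    simp
  · rw [sharpStep_of_pos (sub_pos.2 h1)]
    rcases lt_or_gt_of_ne hx.2 with h2 | h2
    · rw [hneg _ (by linarith), indicator_of_mem (show x ∈ Ioc p q from ⟨h1, h2.le⟩)]; ring
    · rw [sharpStep_of_pos (sub_pos.2 h2), indicator_of_notMem (fun h => by linarith [h.2])]
      simp

theorem integral_retardedField_sharpStep_mul {f : ℝ → ℝ} (hf : Integrable f) {c : ℝ} (hc : 0 < c)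
    {y : ℝ → ℝ} (hy : Continuous y) {t : ℝ} (ht : 0 ≤ t) :
    ∫ x, retardedField sharpStep c y x t * f x =
      ∫ s in (0 : ℝ)..t, ∫ ξ in (y s - c * (t - s))..(y s + c * (t - s)), f ξ := by
  have h_int : Integrable (fun r : ℝ × ℝ => (sharpStep (r.1 - (y r.2 - c * (t - r.2))) -
      sharpStep (r.1 - (y r.2 + c * (t - r.2)))) * f r.1)
      (volume.prod (volume.restrict (Ioc 0 t))) := by
    have h1 := integrable_prod_bounded_mul sharpStep_measurable abs_sharpStep_le hf
      (p := fun s => y s - c * (t - s)) (by fun_prop) 0 t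
    have h2 := integrable_prod_bounded_mul sharpStep_measurable abs_sharpStep_le hf
      (p := fun s => y s + c * (t - s)) (by fun_prop) 0 t
    simp only [sub_zero] at h1 h2
    simp only [sub_mul]
    exact h1.sub h2
  have e : ∀ x, retardedField sharpStep c y x t * f x = ∫ s in Ioc 0 t,
      (sharpStep (x - (y s - c * (t - s))) - sharpStep (x - (y s + c * (t - s)))) * f x := by
    intro x
    rw [integral_mul_const, retardedField, intervalIntegral.integral_of_le ht]
    congr 2
    funext s
    congr 2 <;> ring
  simp_rw [e]
  rw [integral_integral_swap h_int, intervalIntegral.integral_of_le ht]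
  refine setIntegral_congr_fun measurableSet_Ioc fun s hs => ?_
  have : 0 ≤ c * (t - s) := mul_nonneg hc.le (sub_nonneg.2 hs.2)
  exact integral_sharpStep_window f (by linarith)

theorem setIntegral_Ioi_eq_intervalIntegral {f : ℝ → ℝ} {T : ℝ} (hT : 0 ≤ T)
    (h : ∀ t, T < t → f t = 0) : ∫ t in Ioi (0 : ℝ), f t = ∫ t in (0 : ℝ)..T, f t := by
  rw [intervalIntegral.integral_of_le hT]
  refine setIntegral_eq_of_subset_of_forall_sdiff_eq_zero measurableSet_Ioi Ioc_subset_Ioi_self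
    fun t ht => h t ?_
  by_contra hle
  exact ht.2 ⟨ht.1, not_lt.1 hle⟩

/-- The field of a point source moving along `y` is a weak solution. -/
theorem isWeakDeltaField_retardedField {c : ℝ} (hc : 0 < c) (β : ℝ) {y : ℝ → ℝ}
    (hy : Continuous y) :
    IsWeakDeltaField c β (fun x t => β / (2 * c) * retardedField sharpStep c y x t) y := by
  intro ψ hψ hcs
  obtain ⟨R, hR, hvan⟩ := exists_vanishing_box hcs
  have hbox := waveOp_continuous hψ c
  set T := R + 1 with hT
  set J : ℝ → ℝ → ℝ := fun s t =>
    ∫ ξ in (y s - c * (t - s))..(y s + c * (t - s)), waveOp c ψ (ξ, t) with hJdef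
  have hJ : Continuous (Function.uncurry J) := by
    have hb : ∀ u : ℝ × ℝ → ℝ, Continuous u →
        Continuous fun q : ℝ × ℝ => ∫ ξ in (0 : ℝ)..u q, waveOp c ψ (ξ, q.2) := fun u hu =>
      intervalIntegral.continuous_parametric_intervalIntegral_of_continuous (μ := volume)
        (f := fun (q : ℝ × ℝ) ξ => waveOp c ψ (ξ, q.2)) (by fun_prop) hu
    have : Function.uncurry J = fun q : ℝ × ℝ =>
        (∫ ξ in (0 : ℝ)..(y q.1 + c * (q.2 - q.1)), waveOp c ψ (ξ, q.2)) -
          ∫ ξ in (0 : ℝ)..(y q.1 - c * (q.2 - q.1)), waveOp c ψ (ξ, q.2) := by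
      funext q
      rw [intervalIntegral.integral_interval_sub_left]
      · rfl
      · exact (by fun_prop : Continuous fun ξ => waveOp c ψ (ξ, q.2)).intervalIntegrable _ _
      · exact (by fun_prop : Continuous fun ξ => waveOp c ψ (ξ, q.2)).intervalIntegrable _ _
    rw [this]
    exact (hb _ (by fun_prop)).sub (hb _ (by fun_prop))
  have hinner : ∀ t ∈ Ioi (0 : ℝ), (∫ x, β / (2 * c) * retardedField sharpStep c y x t *
      (iteratedDeriv 2 (fun s : ℝ => ψ (x, s)) t -
          c ^ 2 * iteratedDeriv 2 (fun z : ℝ => ψ (z, t)) x)) =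
      β / (2 * c) * ∫ s in (0 : ℝ)..t, J s t := by
    intro t ht
    simp only [waveOp_eq hψ, mul_assoc]
    rw [integral_const_mul, integral_retardedField_sharpStep_mul (f := fun x => waveOp c ψ (x, t))
      (integrable_of_vanishing (by fun_prop) fun x hx => waveOp_vanishing hvan c (Or.inl hx))
      hc hy (le_of_lt ht)]
  -- Exchanging emission time s and observation time t collects, for each s, the forward cone of
  -- (y(s), s). The integral of the wave operator of ψ over it is 2c ψ(y(s), s).
  rw [setIntegral_congr_fun measurableSet_Ioi hinner, integral_const_mul,
    setIntegral_Ioi_eq_intervalIntegral (T := T) (by positivity), integral_triangle_swap hJ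
    (by positivity), setIntegral_Ioi_eq_intervalIntegral (T := T) (f := fun t => ψ (y t, t))
    (by positivity)]
  · have : ∫ s in (0 : ℝ)..T, ∫ t in s..T, J s t = ∫ s in (0 : ℝ)..T, 2 * c * ψ (y s, s) := by
      refine intervalIntegral.integral_congr fun s hs => ?_
      rw [uIcc_of_le (by positivity)] at hs
      exact integral_waveOp_cone hc hψ hvan (by linarith) (y s) hs.2
    rw [this, intervalIntegral.integral_const_mul]
    field_simp
  · intro t ht
    exact hvan _ (Or.inr (by simp only; linarith [le_abs_self t]))
  · intro t ht
    have : ∀ s, J s t = 0 := fun s => by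
      have hz : ∀ ξ, waveOp c ψ (ξ, t) = 0 := fun ξ =>
        waveOp_vanishing hvan c (Or.inr (by simp only; linarith [le_abs_self t]))
      simp [hJdef, hz]
    simp [this]

end Box

/-! ### Uniqueness of continuous weak fields -/

theorem iteratedDeriv_two_mul_affine {A B : ℝ → ℝ} (hA : ContDiff ℝ 2 A) (hB : ContDiff ℝ 2 B)
    (p q a b s : ℝ) :
    iteratedDeriv 2 (fun s => A (p + a * s) * B (q + b * s)) s =
      a ^ 2 * (deriv (deriv A) (p + a * s) * B (q + b * s)) +
      2 * a * b * (deriv A (p + a * s) * deriv B (q + b * s)) +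
      b ^ 2 * (A (p + a * s) * deriv (deriv B) (q + b * s)) := by
  have hcomp : ∀ {f : ℝ → ℝ}, Differentiable ℝ f → ∀ p a s : ℝ,
      HasDerivAt (fun s => f (p + a * s)) (deriv f (p + a * s) * a) s := by
    intro f hf p a s
    have h1 : HasDerivAt (fun s : ℝ => p + a * s) a s := by
      simpa using ((hasDerivAt_id s).const_mul a).const_add p
    exact HasDerivAt.comp (h := fun s : ℝ => p + a * s) s (hf (p + a * s)).hasDerivAt h1
  have hA1 : Differentiable ℝ A := hA.differentiable (by norm_num)
  have hB1 : Differentiable ℝ B := hB.differentiable (by norm_num)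
  have hA2 : Differentiable ℝ (deriv A) := by
    rw [show (2 : ℕ∞ω) = 1 + 1 by norm_num, contDiff_succ_iff_deriv] at hA
    exact hA.2.2.differentiable (by norm_num)
  have hB2 : Differentiable ℝ (deriv B) := by
    rw [show (2 : ℕ∞ω) = 1 + 1 by norm_num, contDiff_succ_iff_deriv] at hB
    exact hB.2.2.differentiable (by norm_num)
  rw [iteratedDeriv_succ, iteratedDeriv_one]
  have e1 : deriv (fun s => A (p + a * s) * B (q + b * s)) = fun s =>
      deriv A (p + a * s) * a * B (q + b * s) + A (p + a * s) * (deriv B (q + b * s) * b) :=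
    funext fun s => ((hcomp hA1 p a s).mul (hcomp hB1 q b s)).deriv
  rw [e1]
  have e2 := (((hcomp hA2 p a s).mul_const a).mul (hcomp hB1 q b s)).add
    ((hcomp hA1 p a s).mul ((hcomp hB2 q b s).mul_const b))
  refine e2.deriv.trans ?_
  ring

theorem deriv_smoothTransition_eq_zero {s : ℝ} (h : s < 0 ∨ 1 < s) :
    deriv Real.smoothTransition s = 0 := by
  rcases h with h | h
  · have : Real.smoothTransition =ᶠ[𝓝 s] fun _ => 0 := by
      filter_upwards [gt_mem_nhds h] with r hr using Real.smoothTransition.zero_of_nonpos hr.le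
    rw [this.deriv_eq, deriv_const]
  · have : Real.smoothTransition =ᶠ[𝓝 s] fun _ => 1 := by
      filter_upwards [lt_mem_nhds h] with r hr using Real.smoothTransition.one_of_one_le hr.le
    rw [this.deriv_eq, deriv_const]

theorem exists_deriv_smoothTransition_eq_one :
    ∃ s : ℝ, deriv Real.smoothTransition s = 1 := by
  obtain ⟨s, -, hs⟩ := exists_deriv_eq_slope Real.smoothTransition (zero_lt_one' ℝ)
    Real.smoothTransition.continuous.continuousOn
    ((Real.smoothTransition.contDiff (n := 1)).differentiable (by norm_num)).differentiableOn
  exact ⟨s, by simpa using hs⟩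

/-- A smooth function whose derivative is a nonnegative bump supported in `[w, w + r]`. -/
def smoothRamp (w r x : ℝ) : ℝ := Real.smoothTransition (r⁻¹ * (x - w))

section Ramp

variable {w r : ℝ}

theorem smoothRamp_contDiff (w r : ℝ) {n : ℕ∞} : ContDiff ℝ n (smoothRamp w r) :=
  Real.smoothTransition.contDiff.comp (by fun_prop : ContDiff ℝ n fun x : ℝ => r⁻¹ * (x - w))

theorem smoothRamp_deriv (w r x : ℝ) :
    deriv (smoothRamp w r) x = deriv Real.smoothTransition (r⁻¹ * (x - w)) * r⁻¹ := by
  have h1 : HasDerivAt (fun x : ℝ => r⁻¹ * (x - w)) r⁻¹ x := by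
    simpa using ((hasDerivAt_id x).sub_const w).const_mul r⁻¹
  exact (HasDerivAt.comp (h := fun x : ℝ => r⁻¹ * (x - w)) x
    (((Real.smoothTransition.contDiff (n := 1)).differentiable (by norm_num)) _).hasDerivAt
    h1).deriv

theorem smoothRamp_deriv_continuous (w r : ℝ) : Continuous (deriv (smoothRamp w r)) :=
  (smoothRamp_contDiff w r (n := 1)).continuous_deriv (by norm_num)

theorem smoothRamp_deriv_nonneg (hr : 0 < r) (x : ℝ) : 0 ≤ deriv (smoothRamp w r) x := by
  rw [smoothRamp_deriv]
  exact mul_nonneg Real.smoothTransition.monotone.deriv_nonneg (by positivity)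

theorem smoothRamp_deriv_support (hr : 0 < r) {x : ℝ} (h : deriv (smoothRamp w r) x ≠ 0) :
    w ≤ x ∧ x ≤ w + r := by
  rw [smoothRamp_deriv] at h
  have h1 : ¬(r⁻¹ * (x - w) < 0 ∨ 1 < r⁻¹ * (x - w)) := fun hs =>
    h (by rw [deriv_smoothTransition_eq_zero hs, zero_mul])
  push Not at h1
  rw [inv_mul_eq_div, le_div_iff₀ hr, div_le_iff₀ hr] at h1
  constructor <;> linarith [h1.1, h1.2]

theorem exists_smoothRamp_deriv_ne_zero (hr : 0 < r) : ∃ x, deriv (smoothRamp w r) x ≠ 0 := by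
  obtain ⟨s, hs⟩ := exists_deriv_smoothTransition_eq_one
  refine ⟨w + r * s, ?_⟩
  rw [smoothRamp_deriv, show r⁻¹ * (w + r * s - w) = s by field_simp; ring, hs]
  positivity

theorem smoothRamp_eq_zero (hr : 0 < r) {x : ℝ} (hx : x ≤ w) : smoothRamp w r x = 0 :=
  Real.smoothTransition.zero_of_nonpos
    (mul_nonpos_of_nonneg_of_nonpos (by positivity) (by linarith))

end Ramp

/-- The test function that isolates the value of a weak field near the apex of a light cone. -/
def coneTest (c u w r : ℝ) (p : ℝ × ℝ) : ℝ :=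
  Real.smoothTransition (p.2 + 2) *
    (smoothRamp u r (-(p.1 + c * p.2)) * smoothRamp w r (p.1 - c * p.2))

/-- The (positive) image of the cone test function under the wave operator at positive times. -/
def coneBump (c u w r : ℝ) (p : ℝ × ℝ) : ℝ :=
  4 * c ^ 2 * (deriv (smoothRamp u r) (-(p.1 + c * p.2)) *
    deriv (smoothRamp w r) (p.1 - c * p.2))

section Cone

variable {c u w r : ℝ}

theorem coneTest_contDiff (c u w r : ℝ) : ContDiff ℝ ∞ (coneTest c u w r) := by
  have h1 : ContDiff ℝ ∞ (smoothRamp u r) := smoothRamp_contDiff u r (n := ⊤)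
  have h2 : ContDiff ℝ ∞ (smoothRamp w r) := smoothRamp_contDiff w r (n := ⊤)
  have h3 : ContDiff ℝ ∞ Real.smoothTransition := Real.smoothTransition.contDiff (n := ⊤)
  unfold coneTest
  fun_prop

/-- The ramps confine the support to a backward light cone, unbounded only towards the past. The
time cutoff vanishes for t ≤ -2, which closes the cone, and equals 1 at positive times, where it
goes unnoticed. -/
theorem coneTest_hasCompactSupport (hc : 0 < c) (hr : 0 < r) :
    HasCompactSupport (coneTest c u w r) := by
  refine HasCompactSupport.intro (K := Icc (w - 2 * c) (2 * c - u) ×ˢ Icc (-2) ((-u - w) / (2 * c)))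
    (isCompact_Icc.prod isCompact_Icc) fun p hp => ?_
  by_contra hne
  have h1 : -2 < p.2 := by
    by_contra h
    exact hne (by rw [coneTest, Real.smoothTransition.zero_of_nonpos (by linarith), zero_mul])
  have h2 : p.1 + c * p.2 < -u := by
    by_contra h
    exact hne (by rw [coneTest, smoothRamp_eq_zero hr (by linarith), zero_mul, mul_zero])
  have h3 : w < p.1 - c * p.2 := by
    by_contra h
    exact hne (by
      rw [coneTest, smoothRamp_eq_zero (w := w) hr (by linarith), mul_zero, mul_zero])
  have h4 : -(2 * c) < c * p.2 := by nlinarith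
  refine hp ⟨⟨by linarith, by linarith⟩, ⟨h1.le, ?_⟩⟩
  rw [le_div_iff₀ (by positivity)]
  linarith

/-- For a product A(-(x + ct)) B(x - ct) the terms with A'' and B'' cancel, and the mixed terms add
up to 4c² A' B'. The minus sign inside A makes the result nonnegative for increasing ramps. -/
theorem coneTest_wave (c u w r x : ℝ) {t : ℝ} (ht : 0 < t) :
    iteratedDeriv 2 (fun s : ℝ => coneTest c u w r (x, s)) t -
      c ^ 2 * iteratedDeriv 2 (fun z : ℝ => coneTest c u w r (z, t)) x =
      coneBump c u w r (x, t) := by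
  have hA := smoothRamp_contDiff u r (n := 2)
  have hB := smoothRamp_contDiff w r (n := 2)
  have hone : ∀ s : ℝ, 0 < s → Real.smoothTransition (s + 2) = 1 := fun s hs =>
    Real.smoothTransition.one_of_one_le (by linarith)
  have e1 : (fun s : ℝ => coneTest c u w r (x, s)) =ᶠ[𝓝 t]
      fun s => smoothRamp u r (-x + -c * s) * smoothRamp w r (x + -c * s) := by
    filter_upwards [lt_mem_nhds ht] with s hs
    simp only [coneTest, hone s hs, one_mul]
    congr 2 <;> ring
  have e2 : (fun z : ℝ => coneTest c u w r (z, t)) =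
      fun z => smoothRamp u r (-(c * t) + -1 * z) * smoothRamp w r (-(c * t) + 1 * z) := by
    funext z
    simp only [coneTest, hone t ht, one_mul]
    congr 2 <;> ring
  rw [e1.iteratedDeriv_eq, e2, iteratedDeriv_two_mul_affine hA hB,
    iteratedDeriv_two_mul_affine hA hB, coneBump,
    show -(c * t) + -1 * x = -(x + c * t) by ring, show -(c * t) + 1 * x = x - c * t by ring,
    show -x + -c * t = -(x + c * t) by ring, show x + -c * t = x - c * t by ring]
  ring

theorem coneBump_continuous (c u w r : ℝ) : Continuous (coneBump c u w r) := by
  have h1 := smoothRamp_deriv_continuous u r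
  have h2 := smoothRamp_deriv_continuous w r
  unfold coneBump
  fun_prop

theorem coneBump_nonneg (hr : 0 < r) (p : ℝ × ℝ) : 0 ≤ coneBump c u w r p := by
  have h1 := smoothRamp_deriv_nonneg (w := u) hr (-(p.1 + c * p.2))
  have h2 := smoothRamp_deriv_nonneg (w := w) hr (p.1 - c * p.2)
  unfold coneBump
  positivity

theorem coneBump_support (hc : 0 < c) (hr : 0 < r) {x₀ t₀ : ℝ} {p : ℝ × ℝ}
    (h : coneBump c (-(x₀ + c * t₀)) (x₀ - c * t₀) r p ≠ 0) :
    |p.1 - x₀| ≤ r ∧ |p.2 - t₀| ≤ r / c := by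
  have h1 := smoothRamp_deriv_support hr (w := -(x₀ + c * t₀)) (x := -(p.1 + c * p.2))
    fun h0 => h (by rw [coneBump, h0, zero_mul, mul_zero])
  have h2 := smoothRamp_deriv_support hr (w := x₀ - c * t₀) (x := p.1 - c * p.2)
    fun h0 => h (by rw [coneBump, h0, mul_zero, mul_zero])
  refine ⟨abs_le.2 ⟨by linarith, by linarith⟩, ?_⟩
  rw [abs_le, ← neg_div, div_le_iff₀ hc, le_div_iff₀ hc]
  constructor <;> linarith

theorem exists_coneBump_ne_zero (hc : 0 < c) (hr : 0 < r) : ∃ p, coneBump c u w r p ≠ 0 := by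
  obtain ⟨x, hx⟩ := exists_smoothRamp_deriv_ne_zero (w := u) hr
  obtain ⟨z, hz⟩ := exists_smoothRamp_deriv_ne_zero (w := w) hr
  refine ⟨((z - x) / 2, (-x - z) / (2 * c)), ?_⟩
  rw [coneBump]
  simp only
  rw [show -((z - x) / 2 + c * ((-x - z) / (2 * c))) = x by field_simp; ring,
    show (z - x) / 2 - c * ((-x - z) / (2 * c)) = z by field_simp; ring]
  positivity

end Cone

/-- A continuous weak field is not larger than another one with the same source. -/
theorem IsWeakDeltaField.le {c β : ℝ} (hc : 0 < c) {φ₁ φ₂ : ℝ → ℝ → ℝ} {y₁ y₂ : ℝ → ℝ}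
    (h₁ : IsWeakDeltaField c β φ₁ y₁) (h₂ : IsWeakDeltaField c β φ₂ y₂)
    (hc₁ : ContinuousOn (fun p : ℝ × ℝ => φ₁ p.1 p.2) (univ ×ˢ Ici 0))
    (hc₂ : ContinuousOn (fun p : ℝ × ℝ => φ₂ p.1 p.2) (univ ×ˢ Ici 0))
    (hy : ∀ t, 0 < t → y₁ t = y₂ t) (x₀ : ℝ) {t₀ : ℝ} (ht₀ : 0 < t₀) : φ₁ x₀ t₀ ≤ φ₂ x₀ t₀ := by
  by_contra hlt
  push Not at hlt
  set D₁ : ℝ × ℝ → ℝ := fun p => φ₁ p.1 (max p.2 0) with hD₁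
  set D₂ : ℝ × ℝ → ℝ := fun p => φ₂ p.1 (max p.2 0) with hD₂
  have hmax : Continuous fun p : ℝ × ℝ => (p.1, max p.2 0) := by fun_prop
  have hD₁c : Continuous D₁ := hc₁.comp_continuous hmax fun p => by simp
  have hD₂c : Continuous D₂ := hc₂.comp_continuous hmax fun p => by simp
  have hopen : IsOpen {p : ℝ × ℝ | D₂ p < D₁ p} := isOpen_lt hD₂c hD₁c
  obtain ⟨ρ, hρ, hball⟩ := Metric.isOpen_iff.1 hopen (x₀, t₀)
    (by simpa [hD₁, hD₂, max_eq_left ht₀.le] using hlt)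
  -- The bump extends r in space and r / c in time; it must fit into the ball where φ₂ < φ₁ and stay
  -- at positive times.
  set r := min (ρ / 2) (min (c * (ρ / 2)) (c * (t₀ / 2))) with hrdef
  have hr : 0 < r := by positivity
  set k := coneBump c (-(x₀ + c * t₀)) (x₀ - c * t₀) r with hk
  have hkc : Continuous k := coneBump_continuous _ _ _ _
  have hsupp : ∀ p, k p ≠ 0 → |p.1 - x₀| ≤ r ∧ |p.2 - t₀| ≤ r / c :=
    fun p hp => coneBump_support hc hr hp
  have hrc : r / c ≤ ρ / 2 ∧ r / c ≤ t₀ / 2 := by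
    rw [div_le_iff₀ hc, div_le_iff₀ hc]
    constructor
    · linarith [(min_le_right _ _).trans (min_le_left _ _) |>.trans_eq' hrdef]
    · linarith [(min_le_right _ _).trans (min_le_right _ _) |>.trans_eq' hrdef]
  have hpos : ∀ p, k p ≠ 0 → 0 < p.2 := fun p hp => by
    have := (abs_le.1 (hsupp p hp).2).1
    linarith [hrc.2]
  have hlt' : ∀ p, k p ≠ 0 → D₂ p < D₁ p := fun p hp => by
    refine hball ?_
    obtain ⟨h1, h2⟩ := hsupp p hp
    rw [Metric.mem_ball, Prod.dist_eq, max_lt_iff, Real.dist_eq, Real.dist_eq]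
    have hr2 : r ≤ ρ / 2 := min_le_left _ _
    exact ⟨by linarith, by linarith [hrc.1]⟩
  have hkcs : HasCompactSupport k := by
    refine HasCompactSupport.intro (K := Icc (x₀ - r) (x₀ + r) ×ˢ Icc (t₀ - r / c) (t₀ + r / c))
      (isCompact_Icc.prod isCompact_Icc) fun p hp => ?_
    by_contra hne
    obtain ⟨h1, h2⟩ := hsupp p hne
    rw [abs_le] at h1 h2
    exact hp ⟨⟨by linarith, by linarith⟩, ⟨by linarith, by linarith⟩⟩
  -- The average of a weak field against the bump depends on the source only, so both fields have
  -- the same average.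
  have hval : ∀ {φ : ℝ → ℝ → ℝ} {y : ℝ → ℝ}, IsWeakDeltaField c β φ y →
      (Continuous fun p : ℝ × ℝ => φ p.1 (max p.2 0)) →
      ∫ p : ℝ × ℝ, φ p.1 (max p.2 0) * k p =
        β * ∫ t in Ioi (0 : ℝ), coneTest c (-(x₀ + c * t₀)) (x₀ - c * t₀) r (y t, t) := by
    intro φ y h hφ
    rw [← h _ (coneTest_contDiff _ _ _ _) (coneTest_hasCompactSupport hc hr)]
    have h_int : Integrable (fun p : ℝ × ℝ => φ p.1 (max p.2 0) * k p) :=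
      (hφ.mul hkc).integrable_of_hasCompactSupport hkcs.mul_left
    have e1 : ∫ p : ℝ × ℝ, φ p.1 (max p.2 0) * k p =
        ∫ t, ∫ x, φ x (max t 0) * k (x, t) := integral_prod_symm _ h_int
    rw [e1, ← setIntegral_eq_integral_of_forall_compl_eq_zero (s := Ioi (0 : ℝ))]
    · refine setIntegral_congr_fun measurableSet_Ioi fun t ht => ?_
      refine integral_congr_ae (Eventually.of_forall fun x => ?_)
      have ht' : (0 : ℝ) < t := ht
      simp only [coneTest_wave c _ _ _ x ht', max_eq_left ht'.le, hk]
    · intro t ht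
      have : ∀ x, k (x, t) = 0 := fun x => by
        by_contra hne
        exact ht (hpos _ hne)
      simp [this]
  have hsame : ∫ t in Ioi (0 : ℝ), coneTest c (-(x₀ + c * t₀)) (x₀ - c * t₀) r (y₁ t, t) =
      ∫ t in Ioi (0 : ℝ), coneTest c (-(x₀ + c * t₀)) (x₀ - c * t₀) r (y₂ t, t) :=
    setIntegral_congr_fun measurableSet_Ioi fun t ht => by simp only [hy t ht]
  have heq : ∫ p, D₁ p * k p = ∫ p, D₂ p * k p := by
    rw [hval h₁ hD₁c, hval h₂ hD₂c, hsame]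
  have hdiff : ∫ p, (D₁ p - D₂ p) * k p = 0 := by
    have i₁ : Integrable fun p => D₁ p * k p :=
      (hD₁c.mul hkc).integrable_of_hasCompactSupport hkcs.mul_left
    have i₂ : Integrable fun p => D₂ p * k p :=
      (hD₂c.mul hkc).integrable_of_hasCompactSupport hkcs.mul_left
    simp only [sub_mul]
    rw [integral_sub i₁ i₂, heq, sub_self]
  obtain ⟨p, hp⟩ := exists_coneBump_ne_zero (u := -(x₀ + c * t₀)) (w := x₀ - c * t₀) hc hr
  have := Continuous.integral_pos_of_hasCompactSupport_nonneg_nonzero (μ := volume)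
    (f := fun p => (D₁ p - D₂ p) * k p) ((hD₁c.sub hD₂c).mul hkc) hkcs.mul_left (x := p)
    (fun q => by
      by_cases hq : k q = 0
      · simp [hq]
      · exact mul_nonneg (sub_nonneg.2 (hlt' q hq).le) (coneBump_nonneg hr q))
    (mul_ne_zero (sub_pos.2 (hlt' p hp)).ne' hp)
  exact this.ne' hdiff

/-- Continuous weak fields are determined by the source for positive times. -/
theorem IsWeakDeltaField.unique {c β : ℝ} (hc : 0 < c) {φ₁ φ₂ : ℝ → ℝ → ℝ} {y₁ y₂ : ℝ → ℝ}
    (h₁ : IsWeakDeltaField c β φ₁ y₁) (h₂ : IsWeakDeltaField c β φ₂ y₂)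
    (hc₁ : ContinuousOn (fun p : ℝ × ℝ => φ₁ p.1 p.2) (univ ×ˢ Ici 0))
    (hc₂ : ContinuousOn (fun p : ℝ × ℝ => φ₂ p.1 p.2) (univ ×ˢ Ici 0))
    (hy : ∀ t, 0 < t → y₁ t = y₂ t) (x : ℝ) {t : ℝ} (ht : 0 < t) : φ₁ x t = φ₂ x t :=
  le_antisymm (h₁.le hc h₂ hc₁ hc₂ hy x ht) (h₂.le hc h₁ hc₂ hc₁ (fun t ht => (hy t ht).symm) x ht)

/-! ### The point particle -/

theorem tendstoUniformlyOn_of_linear_bound {ι : Type*} {F : ℝ → ι → ℝ} {f : ι → ℝ} {S : Set ι}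
    {C σ₀ : ℝ} (hσ₀ : 0 < σ₀)
    (h : ∀ σ, 0 < σ → σ < σ₀ → ∀ p ∈ S, |F σ p - f p| ≤ C * σ) :
    TendstoUniformlyOn F f (𝓝[>] (0 : ℝ)) S := by
  rw [Metric.tendstoUniformlyOn_iff]
  intro ε hε
  have hlim : Tendsto (fun σ : ℝ => C * σ) (𝓝[>] 0) (𝓝 0) := by
    have : Tendsto (fun σ : ℝ => C * σ) (𝓝 0) (𝓝 (C * 0)) := (continuous_const_mul C).tendsto 0
    rw [mul_zero] at this
    exact this.mono_left nhdsWithin_le_nhds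
  filter_upwards [hlim.eventually (gt_mem_nhds hε), self_mem_nhdsWithin,
    mem_nhdsWithin_of_mem_nhds (gt_mem_nhds hσ₀)] with σ h1 h2 h3 p hp
  rw [dist_comm, Real.dist_eq]
  exact (h σ h2 h3 p hp).trans_lt h1

/-- The kernel jumps, but the field is the uniform limit of the continuous smeared fields of the
same subsonic path. -/
theorem pointField_continuousOn {v : ℝ → ℝ} {c K : ℝ} (hv : Continuous v) (hKc : K < c)
    (hK : ∀ t, |v t| ≤ K) (a : ℝ) :
    ContinuousOn (fun p : ℝ × ℝ => a * retardedField sharpStep c (position v) p.1 p.2)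
      (univ ×ˢ Ici 0) := by
  have hu : TendstoUniformlyOn
      (fun σ (p : ℝ × ℝ) => retardedField (smoothStep σ) c (position v) p.1 p.2)
      (fun p => retardedField sharpStep c (position v) p.1 p.2) (𝓝[>] (0 : ℝ))
      (univ ×ˢ Ici 0) := by
    refine tendstoUniformlyOn_of_linear_bound (C := 4 / (c - K)) one_pos fun σ hσ _ p hp => ?_
    have := abs_retardedField_smoothStep_sub_sharpStep_le hv hKc hp.2 (fun s _ => hK s) hσ p.1
    rwa [div_mul_eq_mul_div]
  exact continuousOn_const.mul (hu.continuousOn (Frequently.of_forall fun σ =>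
    (retardedField_continuous (smoothStep_continuous σ) (position_continuous hv) c).continuousOn))

theorem mul_gaussianDelta_le {ε x : ℝ} (hε : 0 < ε) (hx : x ≠ 0) :
    ε * gaussianDelta ε x ≤ 2 * ε ^ 2 / x ^ 2 := by
  have hx2 : 0 < x ^ 2 := by positivity
  have hp : 1 ≤ Real.sqrt (2 * Real.pi) := by
    rw [Real.one_le_sqrt]; linarith [Real.pi_gt_three]
  set z := x ^ 2 / (2 * ε ^ 2) with hz
  have hz0 : 0 < z := by positivity
  have h1 : Real.exp (-x ^ 2 / (2 * ε ^ 2)) ≤ 1 / z := by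
    rw [show -x ^ 2 / (2 * ε ^ 2) = -z by rw [hz]; ring, Real.exp_neg, ← one_div]
    gcongr
    linarith [Real.add_one_le_exp z]
  calc ε * gaussianDelta ε x
      = 1 / Real.sqrt (2 * Real.pi) * Real.exp (-x ^ 2 / (2 * ε ^ 2)) := by
        unfold gaussianDelta; field_simp
    _ ≤ 1 * (1 / z) := by
        gcongr
        rw [div_le_one (by positivity)]; exact hp
    _ = _ := by rw [hz]; field_simp

theorem tendsto_mul_gaussianDelta {x : ℝ} (hx : x ≠ 0) :
    Tendsto (fun ε => ε * gaussianDelta ε x) (𝓝[>] 0) (𝓝 0) := by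
  have hlim : Tendsto (fun ε : ℝ => 2 * ε ^ 2 / x ^ 2) (𝓝[>] 0) (𝓝 0) := by
    have h : Tendsto (fun ε : ℝ => 2 * ε ^ 2 / x ^ 2) (𝓝 0) (𝓝 (2 * 0 ^ 2 / x ^ 2)) :=
      (by fun_prop : Continuous fun ε : ℝ => 2 * ε ^ 2 / x ^ 2).tendsto 0
    norm_num at h
    exact h.mono_left nhdsWithin_le_nhds
  refine tendsto_of_tendsto_of_tendsto_of_le_of_le' tendsto_const_nhds hlim ?_ ?_
  · filter_upwards [self_mem_nhdsWithin] with ε hε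
    exact mul_nonneg (le_of_lt hε) (gaussianDelta_pos hε x).le
  · filter_upwards [self_mem_nhdsWithin] with ε hε using mul_gaussianDelta_le hε hx

/-- The sharp limit of the self-force along a subsonic trajectory. -/
theorem tendsto_retardedField_meanSlope {v : ℝ → ℝ} {c K t A : ℝ} (hv : Continuous v)
    (hKc : K < c) (ht : 0 < t) (hK : ∀ s ∈ Icc 0 t, |v s| ≤ K)
    (hA : ∀ s ∈ Icc 0 t, |v t - v s| ≤ A * (t - s)) (hA0 : 0 ≤ A) :
    Tendsto (fun ε => retardedField (gaussianDelta ε) c (position v) (position v t) t) (𝓝[>] 0)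
      (𝓝 (meanSlope c (v t))) := by
  -- At a fixed t > 0 the particle is strictly inside the light cone of the origin, so the two
  -- boundary Gaussians in the error are evaluated away from 0 and vanish in the limit.
  have hpos : |position v t| < c * t := by
    have h := intervalIntegral.norm_integral_le_of_norm_le_const (a := 0) (b := t) (f := v)
      (C := K) fun s hs => by
        rw [uIoc_of_le ht.le] at hs
        exact hK s ⟨hs.1.le, hs.2⟩
    rw [sub_zero, abs_of_pos ht] at h
    exact lt_of_le_of_lt h (by gcongr)
  obtain ⟨h1, h2⟩ := abs_lt.1 hpos
  have l1 := tendsto_mul_gaussianDelta (x := position v t + c * t) (by linarith)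
  have l2 := tendsto_mul_gaussianDelta (x := position v t - c * t) (by linarith)
  have l0 : Tendsto (fun ε : ℝ => ε * (2 * A / (c - K) ^ 2)) (𝓝[>] 0) (𝓝 0) := by
    have h : Tendsto (fun ε : ℝ => ε * (2 * A / (c - K) ^ 2)) (𝓝 0)
        (𝓝 (0 * (2 * A / (c - K) ^ 2))) := (continuous_mul_const _).tendsto 0
    rw [zero_mul] at h
    exact h.mono_left nhdsWithin_le_nhds
  have l3 := ((l0.add l1).add l2).const_mul (2 / (c - K))
  simp only [add_zero, mul_zero] at l3
  rw [tendsto_iff_dist_tendsto_zero]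
  refine tendsto_of_tendsto_of_tendsto_of_le_of_le' tendsto_const_nhds l3
    (Eventually.of_forall fun _ => dist_nonneg) ?_
  filter_upwards [self_mem_nhdsWithin] with ε hε
  rw [Real.dist_eq]
  refine (abs_retardedField_sub_meanSlope_le hv hKc ht.le hK hA hA0 hε).trans (le_of_eq ?_)
  ring

theorem IsTrajectory.exists_velocity_lipschitz {v₀ : ℝ} {y : ℝ → ℝ} (h : IsTrajectory v₀ y)
    (t : ℝ) : ∃ A : ℝ, 0 ≤ A ∧
      ∀ s ∈ Icc 0 t, |velocity y t - velocity y s| ≤ A * (t - s) := by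
  have hd := h.velocity_contDiffOn
  obtain ⟨A, hA⟩ := isCompact_Icc.exists_bound_of_continuousOn (s := Icc 0 t)
    ((hd.continuousOn_derivWithin (uniqueDiffOn_Ici 0) le_rfl).mono Icc_subset_Ici_self)
  refine ⟨|A|, abs_nonneg A, fun s hs => ?_⟩
  have := (convex_Icc 0 t).norm_image_sub_le_of_norm_hasDerivWithin_le (C := |A|)
    (fun r hr => ((hd.differentiableOn (by norm_num)) r hr.1).hasDerivWithinAt.mono
      Icc_subset_Ici_self) (fun r hr => (hA r hr).trans (le_abs_self A)) hs
    (⟨hs.1.trans hs.2, le_rfl⟩ : t ∈ Icc 0 t)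
  rwa [Real.norm_eq_abs, Real.norm_eq_abs, abs_of_nonneg (sub_nonneg.2 hs.2)] at this

/-- The field of a subsonic solution is the retarded field of its trajectory. -/
theorem IsDeltaSolution.field_eq {m c β v₀ K : ℝ} (hc : 0 < c) {φ : ℝ → ℝ → ℝ} {y : ℝ → ℝ}
    (h : IsDeltaSolution m c β v₀ φ y) (hKc : K < c) (hK : ∀ t, 0 ≤ t → |velocity y t| ≤ K)
    (x : ℝ) {t : ℝ} (ht : 0 ≤ t) :
    φ x t = β / (2 * c) *
      retardedField sharpStep c (position fun t => velocity y (max t 0)) x t := by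
  have hvc : Continuous fun t => velocity y (max t 0) :=
    continuous_comp_max h.trajectory.velocity_contDiffOn.continuousOn
  rcases ht.eq_or_lt with rfl | ht
  · rw [h.field_zero, retardedField_initial, mul_zero]
  · exact h.wave.unique hc (isWeakDeltaField_retardedField hc β (position_continuous hvc))
      h.field_continuousOn
      (pointField_continuousOn hvc hKc (fun t => hK _ (le_max_right _ _)) _)
      (fun t ht => h.trajectory.eq_position ht.le) x ht

/-- With the field known, uniqueness of derivatives fixes the smeared force for every ε, and
uniqueness of limits fixes the acceleration. -/
theorem IsDeltaSolution.newton_eq {m c β v₀ K : ℝ} (hm : 0 < m) (hc : 0 < c) {φ : ℝ → ℝ → ℝ}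
    {y : ℝ → ℝ} (h : IsDeltaSolution m c β v₀ φ y) (hKc : K < c)
    (hK : ∀ t, 0 ≤ t → |velocity y t| ≤ K) {t : ℝ} (ht : 0 < t) :
    iteratedDeriv 2 y t = β ^ 2 / (2 * c * m) * meanSlope c (velocity y t) := by
  set v : ℝ → ℝ := fun t => velocity y (max t 0) with hv
  have hvc : Continuous v := continuous_comp_max h.trajectory.velocity_contDiffOn.continuousOn
  have hvt : ∀ s, 0 ≤ s → v s = velocity y s := fun s hs => by simp [hv, max_eq_left hs]
  obtain ⟨F, hF, hlim⟩ := h.newton t ht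
  have hyt := h.trajectory.eq_position ht.le
  have hFeq : ∀ ε, 0 < ε → F ε =
      β * (β / (2 * c)) * retardedField (gaussianDelta ε) c (position v) (position v t) t := by
    intro ε hε
    have h1 := hF ε hε
    rw [funext fun x => h.field_eq hc hKc hK x ht.le, hyt] at h1
    exact h1.2.unique (hasForce_sharpStep hε (position_continuous hvc) c β _ _ ht.le).2
  obtain ⟨A, hA0, hA⟩ := h.trajectory.exists_velocity_lipschitz t
  have hlim2 := (tendsto_retardedField_meanSlope hvc hKc ht (fun s hs => hK _ (le_max_right _ _))
    (fun s hs => by rw [hvt t ht.le, hvt s hs.1]; exact hA s hs) hA0).const_mul (β * (β / (2 * c)))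
  have hlim3 : Tendsto F (𝓝[>] 0) (𝓝 (β * (β / (2 * c)) * meanSlope c (v t))) :=
    hlim2.congr' (by
      filter_upwards [self_mem_nhdsWithin] with ε hε using (hFeq ε hε).symm)
  have := tendsto_nhds_unique hlim hlim3
  rw [hvt t ht.le] at this
  field_simp at this ⊢
  linarith

/-- The retarded field of the solution of the limiting equation of motion. -/
theorem isDeltaSolution_of_limit_velocity {m c β v₀ : ℝ} (hm : 0 < m) (hc : 0 < c)
    (hv₀ : |v₀| < c) {v : ℝ → ℝ} (hvc : Continuous v) (hvK : ∀ t, |v t| ≤ |v₀|)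
    (hv : ∀ t, 0 ≤ t → v t = v₀ + ∫ s in (0 : ℝ)..t, β ^ 2 / (2 * c * m) * meanSlope c (v s)) :
    IsDeltaSolution m c β v₀
      (fun x t => β / (2 * c) * retardedField sharpStep c (position v) x t) (position v) ∧
      ∀ t, 0 ≤ t → velocity (position v) t = v t := by
  have hac : Continuous fun s => β ^ 2 / (2 * c * m) * meanSlope c (v s) := by
    rw [← continuousOn_univ]
    exact continuousOn_const.mul (continuousOn_meanSlope_comp hv₀ hvc.continuousOn
      fun t _ => hvK t)
  obtain ⟨htraj, hvel, hacc⟩ := trajectory_of_integral hvc hac hv (y := position v) fun _ => rfl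
  refine ⟨⟨pointField_continuousOn hvc hv₀ hvK _, fun x => by simp [retardedField_initial],
    isWeakDeltaField_retardedField hc β (position_continuous hvc), htraj, fun t ht => ?_⟩, hvel⟩
  refine ⟨fun ε => β * (β / (2 * c)) *
    retardedField (gaussianDelta ε) c (position v) (position v t) t,
    fun ε hε => hasForce_sharpStep hε (position_continuous hvc) c β _ _ ht.le, ?_⟩
  obtain ⟨A, hA0, hA⟩ := htraj.exists_velocity_lipschitz t
  have hlim := (tendsto_retardedField_meanSlope hvc hv₀ ht (fun s _ => hvK s)
    (fun s hs => by rw [← hvel t ht.le, ← hvel s hs.1]; exact hA s hs) hA0).const_mul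
    (β * (β / (2 * c)))
  convert hlim using 2
  rw [hacc t ht]
  field_simp

theorem IsDeltaSolution.eq_of_subsonic {m c β v₀ : ℝ} (hm : 0 < m) (hc : 0 < c)
    (hv₀ : |v₀| < c) {v : ℝ → ℝ} (hvc : Continuous v) (hvK : ∀ t, |v t| ≤ |v₀|)
    (hv : ∀ t, 0 ≤ t → v t = v₀ + ∫ s in (0 : ℝ)..t, β ^ 2 / (2 * c * m) * meanSlope c (v s))
    {φ : ℝ → ℝ → ℝ} {y : ℝ → ℝ} (h : IsDeltaSolution m c β v₀ φ y)
    (hsub : UniformlySubsonic c y) {t : ℝ} (ht : 0 ≤ t) :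
    y t = position v t ∧
      ∀ x, φ x t = β / (2 * c) * retardedField sharpStep c (position v) x t := by
  obtain ⟨K', hK'c, hK'⟩ := hsub
  -- A common bound for both velocities, so that the stability estimate applies with zero defect.
  set K := max K' |v₀|
  have hKc : K < c := max_lt hK'c hv₀
  have hK : ∀ t, 0 ≤ t → |velocity y t| ≤ K := fun t ht => (hK' t ht).trans (le_max_left _ _)
  set w : ℝ → ℝ := fun t => velocity y (max t 0) with hw
  have hwc : Continuous w := continuous_comp_max h.trajectory.velocity_contDiffOn.continuousOn
  have hwt : ∀ s, 0 ≤ s → w s = velocity y s := fun s hs => by simp [hw, max_eq_left hs]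
  have hwe : ∀ t, 0 ≤ t →
      w t = v₀ + ∫ s in (0 : ℝ)..t, β ^ 2 / (2 * c * m) * meanSlope c (w s) := by
    intro t ht
    rw [hwt t ht, h.trajectory.velocity_eq_integral
      (a := fun s => β ^ 2 / (2 * c * m) * meanSlope c (w s)) ?_ ?_ ht]
    · exact continuousOn_const.mul (continuousOn_meanSlope_comp hKc hwc.continuousOn
        fun s _ => hK _ (le_max_right _ _))
    · intro s hs
      rw [h.newton_eq hm hc hKc hK hs, hwt s hs.le]
  have hwv : ∀ s, 0 ≤ s → w s = v s := by
    intro s hs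
    have := abs_sub_le_of_approx_solution (T := s) hKc le_rfl hvc hwc
      (fun t _ => (hvK t).trans (le_max_right _ _)) (fun t _ => hK _ (le_max_right _ _))
      (fun t ht => hv t ht.1) (fun t ht => by rw [← hwe t ht.1]; simp) s ⟨hs, le_rfl⟩
    simp only [mul_zero, zero_mul] at this
    exact sub_eq_zero.1 (abs_nonpos_iff.1 this)
  have hpos : ∀ s, 0 ≤ s → position w s = position v s := fun s hs =>
    position_congr hs fun r hr => hwv r hr.1
  refine ⟨(h.trajectory.eq_position ht).trans (hpos t ht), fun x => ?_⟩
  rw [h.field_eq hc hKc hK x ht, retardedField_congr ht fun s hs => hpos s hs.1]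

/-! ### The limit of vanishing smearing width -/

/-- At a first time with r ≤ d, continuity gives d ≤ r on the whole interval before it, including
the endpoint, and the hypothesis then forces d < r there. -/
theorem continuation_bound {d : ℝ → ℝ} {T r : ℝ} (hd : Continuous d) (h0 : d 0 < r)
    (h : ∀ t ∈ Icc 0 T, (∀ s ∈ Icc 0 t, d s ≤ r) → d t < r) : ∀ t ∈ Icc 0 T, d t < r := by
  intro t₁ ht₁
  by_contra hne
  have hclosed : IsClosed {s | r ≤ d s} := isClosed_le continuous_const hd
  have hcomp : IsCompact (Icc 0 t₁ ∩ {s | r ≤ d s}) := isCompact_Icc.inter_right hclosed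
  obtain ⟨t, ⟨htI, htr⟩, hmin⟩ := hcomp.exists_isLeast
    ⟨t₁, ⟨ht₁.1, le_rfl⟩, not_lt.1 hne⟩
  have hbefore : ∀ s ∈ Ico 0 t, d s < r := fun s hs => by
    by_contra hs'
    exact absurd (hmin ⟨⟨hs.1, hs.2.le.trans htI.2⟩, not_lt.1 hs'⟩) (not_le.2 hs.2)
  have ht0 : 0 < t := by
    rcases htI.1.eq_or_lt with h' | h'
    · rw [← h'] at htr
      exact absurd h0 (not_lt.2 htr)
    · exact h'
  have hclos : closure (Ico 0 t) ⊆ {s | d s ≤ r} :=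
    closure_minimal (fun s hs => (hbefore s hs).le) (isClosed_le hd continuous_const)
  rw [closure_Ico ht0.ne] at hclos
  exact absurd (h t ⟨htI.1, htI.2.trans ht₁.2⟩ fun s hs => hclos hs) (not_lt.2 htr)

/-- A smeared trajectory satisfies the limiting equation up to an error linear in the width. -/
theorem abs_sub_limit_equation_le {b c K v₀ ε τ T : ℝ} (hb : 0 ≤ b) (hKc : K < c) (hε : 0 < ε)
    (hτ : τ ≤ T) {w : ℝ → ℝ} (hw : Continuous w) (hK : ∀ t ∈ Icc 0 τ, |w t| ≤ K)
    (hwe : ∀ t, 0 ≤ t →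
      w t = v₀ + ∫ s in (0 : ℝ)..t, selfAcceleration b c (gaussianDelta ε) w s) :
    ∀ t ∈ Icc 0 τ, |w t - (v₀ + ∫ s in (0 : ℝ)..t, b * meanSlope c (w s))| ≤
      b * (2 / (c - K)) * (2 * (b / (c - K)) / (c - K) ^ 2 * T + 2 / (c - K)) * ε := by
  intro t ht
  have hδ : 0 < c - K := sub_pos.2 hKc
  have hg := gaussianDelta_continuous ε
  have hp := position_continuous hw
  have hac := (selfAcceleration_causalLipschitz b c hε).continuous w hw
  set A := b / (c - K) with hA
  have hA0 : 0 ≤ A := by positivity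
  have haA : ∀ s ∈ Icc 0 τ, |selfAcceleration b c (gaussianDelta ε) w s| ≤ A := by
    intro s hs
    rw [selfAcceleration, abs_mul, abs_of_nonneg hb]
    have := abs_retardedField_gaussianDelta_le hw hKc hs.1
      (fun r hr => hK r ⟨hr.1, hr.2.trans hs.2⟩) hε (position w s)
    calc _ ≤ b * (1 / (c - K)) := by gcongr
      _ = A := by rw [hA]; ring
  have hlip : ∀ s ∈ Icc 0 τ, ∀ r ∈ Icc 0 s, |w s - w r| ≤ A * (s - r) := by
    intro s hs r hr
    have e : w s - w r = ∫ q in r..s, selfAcceleration b c (gaussianDelta ε) w q := by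
      rw [hwe s hs.1, hwe r hr.1, add_sub_add_left_eq_sub,
        intervalIntegral.integral_interval_sub_left (hac.intervalIntegrable _ _)
        (hac.intervalIntegrable _ _)]
    rw [e]
    have := intervalIntegral.norm_integral_le_of_norm_le_const (a := r) (b := s) (C := A)
      (f := selfAcceleration b c (gaussianDelta ε) w) fun q hq => by
        rw [uIoc_of_le hr.2] at hq
        exact haA q ⟨hr.1.trans hq.1.le, hq.2.trans hs.2⟩
    rwa [Real.norm_eq_abs, abs_of_nonneg (sub_nonneg.2 hr.2)] at this
  have him : IntervalIntegrable (fun s => b * meanSlope c (w s)) volume 0 t :=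
    (continuousOn_const.mul (continuousOn_meanSlope_comp hKc hw.continuousOn
      fun s hs => hK s ⟨hs.1, hs.2.trans ht.2⟩)).intervalIntegrable_of_Icc ht.1
  have e : w t - (v₀ + ∫ s in (0 : ℝ)..t, b * meanSlope c (w s)) =
      ∫ s in (0 : ℝ)..t,
        (selfAcceleration b c (gaussianDelta ε) w s - b * meanSlope c (w s)) := by
    rw [intervalIntegral.integral_sub (hac.intervalIntegrable _ _) him, hwe t ht.1]
    ring
  -- Pointwise, the error need not be small at times of order ε, when the particle is still near the
  -- light cone of the origin. Integrated in time, the Gaussians at y(s) ± cs contribute at most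
  -- 1/(c-K) each, so the prefactor ε survives.
  have hle : ‖∫ s in (0 : ℝ)..t,
      (selfAcceleration b c (gaussianDelta ε) w s - b * meanSlope c (w s))‖ ≤
      ∫ s in (0 : ℝ)..t, b * (2 * ε / (c - K)) * (2 * A / (c - K) ^ 2 +
        gaussianDelta ε (0 - position w s + c * (0 - s)) +
        gaussianDelta ε (0 - position w s - c * (0 - s))) := by
    refine intervalIntegral.norm_integral_le_of_norm_le ht.1
      (Eventually.of_forall fun s hs => ?_)
      ((by fun_prop : Continuous _).intervalIntegrable _ _)
    have hs' : s ∈ Icc 0 τ := ⟨hs.1.le, hs.2.trans ht.2⟩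
    have := abs_retardedField_sub_meanSlope_le hw hKc hs'.1
      (fun r hr => hK r ⟨hr.1, hr.2.trans hs'.2⟩) (hlip s hs') hA0 hε
    rw [selfAcceleration, ← mul_sub, Real.norm_eq_abs, abs_mul, abs_of_nonneg hb, mul_assoc,
      show 0 - position w s + c * (0 - s) = -(position w s + c * s) by ring,
      show 0 - position w s - c * (0 - s) = -(position w s - c * s) by ring, gaussianDelta_neg,
      gaussianDelta_neg]
    gcongr
  have h1 := integral_gaussianDelta_retarded_add_le hw hKc ht.1
    (fun s hs => hK s ⟨hs.1, hs.2.trans ht.2⟩) hε 0 0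
  have h2 := integral_gaussianDelta_retarded_sub_le hw hKc ht.1
    (fun s hs => hK s ⟨hs.1, hs.2.trans ht.2⟩) hε 0 0
  rw [intervalIntegral.integral_const_mul, intervalIntegral.integral_add
    ((by fun_prop : Continuous _).intervalIntegrable _ _)
    ((by fun_prop : Continuous _).intervalIntegrable _ _), intervalIntegral.integral_add
    ((by fun_prop : Continuous _).intervalIntegrable _ _)
    ((by fun_prop : Continuous _).intervalIntegrable _ _), intervalIntegral.integral_const,
    smul_eq_mul, sub_zero] at hle
  rw [e]
  refine hle.trans ?_
  have h3 : t * (2 * A / (c - K) ^ 2) ≤ T * (2 * A / (c - K) ^ 2) := by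
    gcongr; exact ht.2.trans hτ
  calc _ ≤ b * (2 * ε / (c - K)) *
        (T * (2 * A / (c - K) ^ 2) + 1 / (c - K) + 1 / (c - K)) := by gcongr
    _ = _ := by ring

/-- Linear rate of convergence of the smeared velocities. -/
theorem exists_velocity_rate {b c v₀ T : ℝ} (hb : 0 ≤ b) (hv₀ : |v₀| < c)
    (hT : 0 ≤ T) {v : ℝ → ℝ} (hvc : Continuous v) (hvK : ∀ t, |v t| ≤ |v₀|)
    (hv : ∀ t, 0 ≤ t → v t = v₀ + ∫ s in (0 : ℝ)..t, b * meanSlope c (v s)) :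
    ∃ M ε₀ : ℝ, 0 < ε₀ ∧ ∀ ε, 0 < ε → ε < ε₀ → ∀ w : ℝ → ℝ, Continuous w →
      (∀ t, 0 ≤ t →
        w t = v₀ + ∫ s in (0 : ℝ)..t, selfAcceleration b c (gaussianDelta ε) w s) →
      ∀ t ∈ Icc 0 T, |w t - v t| ≤ M * ε := by
  -- The midpoint leaves room r = K - |v₀| for the smeared velocity to deviate from v and remain
  -- subsonic.
  set K := (|v₀| + c) / 2 with hK
  have hKc : K < c := by linarith
  have hvK' : |v₀| ≤ K := by linarith
  have hδ : 0 < c - K := sub_pos.2 hKc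
  set r := K - |v₀| with hr
  have hr0 : 0 < r := by linarith
  set N := b * (2 / (c - K)) * (2 * (b / (c - K)) / (c - K) ^ 2 * T + 2 / (c - K)) with hN
  have hN0 : 0 ≤ N := by positivity
  set E := Real.exp ((2 * (|b| / (c - K) ^ 2) + 1) * T) with hE
  set M := 2 * N * E with hM
  have hM0 : 0 ≤ M := by positivity
  -- The threshold yields M ε < r strictly, which closes the continuation argument, and M + 1 is
  -- positive even if M = 0.
  refine ⟨M, r / (M + 1), by positivity, fun ε hε hεr w hw hwe => ?_⟩
  have hMε : M * ε < r := by
    rw [lt_div_iff₀ (by positivity)] at hεr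
    nlinarith
  have hrate : ∀ τ ∈ Icc 0 T, (∀ s ∈ Icc 0 τ, |w s| ≤ K) → |w τ - v τ| ≤ M * ε := by
    intro τ hτ hwK
    have h1 := abs_sub_limit_equation_le (T := T) hb hKc hε hτ.2 hw hwK hwe
    have h2 := abs_sub_le_of_approx_solution (T := τ) hKc (by positivity : 0 ≤ N * ε) hvc hw
      (fun t _ => (hvK t).trans hvK') hwK (fun t ht => hv t ht.1) h1 τ ⟨hτ.1, le_rfl⟩
    refine h2.trans ?_
    have h3 : Real.exp ((2 * (|b| / (c - K) ^ 2) + 1) * τ) ≤ E := by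
      rw [hE]; gcongr; exact hτ.2
    calc _ ≤ 2 * (N * ε) * E := by gcongr
      _ = _ := by ring
  have hwK : ∀ τ, (∀ s ∈ Icc 0 τ, |w s - v s| ≤ r) → ∀ s ∈ Icc 0 τ, |w s| ≤ K := by
    intro τ h s hs
    have h1 := h s hs
    have h2 := hvK s
    have h3 : |w s| ≤ |w s - v s| + |v s| := by
      simpa using abs_add_le (w s - v s) (v s)
    linarith
  have hw0 : w 0 = v 0 := by rw [hwe 0 le_rfl, hv 0 le_rfl]; simp
  have hall := continuation_bound (d := fun s => |w s - v s|) (T := T) (r := r) (by fun_prop)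
    (by simpa [hw0] using hr0) fun τ hτ h => (hrate τ hτ (hwK τ h)).trans_lt hMε
  intro t ht
  exact hrate t ht (hwK t fun s hs => (hall s ⟨hs.1, hs.2.trans ht.2⟩).le)

/-- The smeared solutions converge to the point particle solution. -/
theorem tendstoUniformlyOn_smoothSolutions {m c β v₀ : ℝ} (hm : 0 < m) (hc : 0 < c)
    (hv₀ : |v₀| < c) {v : ℝ → ℝ} (hvc : Continuous v) (hvK : ∀ t, |v t| ≤ |v₀|)
    (hv : ∀ t, 0 ≤ t → v t = v₀ + ∫ s in (0 : ℝ)..t, β ^ 2 / (2 * c * m) * meanSlope c (v s))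
    {Φ : ℝ → ℝ → ℝ → ℝ} {Y : ℝ → ℝ → ℝ}
    (h : ∀ σ, 0 < σ → IsSmoothSolution m c β v₀ (gaussianDelta σ) (Φ σ) (Y σ)) {T : ℝ}
    (hT : 0 < T) :
    TendstoUniformlyOn (fun σ t => Y σ t) (position v) (𝓝[>] (0 : ℝ)) (Icc 0 T) ∧
      TendstoUniformlyOn (fun σ t => velocity (Y σ) t) v (𝓝[>] (0 : ℝ)) (Icc 0 T) ∧
      TendstoUniformlyOn (fun σ (p : ℝ × ℝ) => Φ σ p.1 p.2)
        (fun p : ℝ × ℝ => β / (2 * c) * retardedField sharpStep c (position v) p.1 p.2)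
        (𝓝[>] (0 : ℝ)) (univ ×ˢ Icc 0 T) := by
  obtain ⟨M, ε₀, hε₀, hM⟩ := exists_velocity_rate (b := β ^ 2 / (2 * c * m)) (by positivity) hv₀
    hT.le hvc hvK hv
  have hδ : 0 < c - |v₀| := sub_pos.2 hv₀
  have hs2 : 0 < Real.sqrt 2 := by positivity
  have hwc : ∀ σ, 0 < σ → Continuous fun t => velocity (Y σ) (max t 0) := fun σ hσ =>
    continuous_comp_max (h σ hσ).trajectory.velocity_contDiffOn.continuousOn
  -- The rate is applied at the kernel width ε = √2 σ of the twice smeared self-force.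
  have hvel : ∀ σ, 0 < σ → σ < ε₀ / Real.sqrt 2 → ∀ t ∈ Icc 0 T,
      |velocity (Y σ) (max t 0) - v t| ≤ M * Real.sqrt 2 * σ := by
    intro σ hσ hσ0 t ht
    rw [mul_assoc]
    refine hM (Real.sqrt 2 * σ) (by positivity)
      (by rwa [lt_div_iff₀ hs2, mul_comm] at hσ0) _ (hwc σ hσ) (fun t ht => ?_) t ht
    rw [max_eq_left ht]
    exact (h σ hσ).velocity_eq hm hc hσ ht
  have hM0 : ∀ σ, 0 < σ → σ < ε₀ / Real.sqrt 2 → 0 ≤ M * Real.sqrt 2 * σ := fun σ hσ hσ0 =>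
    (abs_nonneg _).trans (hvel σ hσ hσ0 0 ⟨le_rfl, hT.le⟩)
  have hposn : ∀ σ, 0 < σ → σ < ε₀ / Real.sqrt 2 → ∀ t ∈ Icc 0 T,
      |position (fun t => velocity (Y σ) (max t 0)) t - position v t| ≤
        M * Real.sqrt 2 * T * σ := by
    intro σ hσ hσ0 t ht
    have h1 := abs_position_sub_le (hwc σ hσ) hvc ht.1
      fun s hs => hvel σ hσ hσ0 s ⟨hs.1, hs.2.trans ht.2⟩
    have h2 := mul_le_mul_of_nonneg_left ht.2 (hM0 σ hσ hσ0)
    linarith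
  have hσ₀ : 0 < ε₀ / Real.sqrt 2 := by positivity
  refine ⟨tendstoUniformlyOn_of_linear_bound (C := M * Real.sqrt 2 * T) hσ₀
    fun σ hσ hσ0 t ht => ?_, tendstoUniformlyOn_of_linear_bound (C := M * Real.sqrt 2) hσ₀
    fun σ hσ hσ0 t ht => ?_, tendstoUniformlyOn_of_linear_bound
    (C := |β / (2 * c)| * (4 * (M * Real.sqrt 2 * T) / (c - |v₀|) + 4 / (c - |v₀|))) hσ₀
    fun σ hσ hσ0 p hp => ?_⟩
  · rw [(h σ hσ).trajectory.eq_position ht.1]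
    exact hposn σ hσ hσ0 t ht
  · have := hvel σ hσ hσ0 t ht
    rwa [max_eq_left ht.1] at this
  · have hp2 : p.2 ∈ Icc 0 T := hp.2
    rw [(h σ hσ).field_eq hc p.1 hp2.1,
      retardedField_congr hp2.1 (fun s hs => (h σ hσ).trajectory.eq_position hs.1),
      ← mul_sub, abs_mul, mul_assoc]
    gcongr
    -- First the path is replaced at fixed kernel, then the kernel along the limiting path. Both
    -- estimates use the subsonic bound of the limit only.
    have h1 := abs_retardedField_smoothStep_sub_le hvc hv₀ hp2.1 (fun s _ => hvK s) hσ
      (position_continuous (hwc σ hσ))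
      (fun s hs => hposn σ hσ hσ0 s ⟨hs.1, hs.2.trans hp2.2⟩) p.1
    have h2 := abs_retardedField_smoothStep_sub_sharpStep_le hvc hv₀ hp2.1 (fun s _ => hvK s) hσ
      p.1
    refine (abs_sub_le _ _ _).trans ((add_le_add h1 h2).trans (le_of_eq ?_))
    ring

end PointParticle

end

/-! ### The main theorem -/

theorem mainTheorem3 (m c β v₀ : ℝ) (hm : 0 < m) (hc : 0 < c) :
    -- for each `σ > 0` there is a global solution, and it is unique on `[0, ∞)`
    (∀ σ : ℝ, 0 < σ →
      (∃ (φ : ℝ → ℝ → ℝ) (y : ℝ → ℝ),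
        PointParticle.IsSmoothSolution m c β v₀ (PointParticle.gaussianDelta σ) φ y) ∧
      (∀ (φ₁ φ₂ : ℝ → ℝ → ℝ) (y₁ y₂ : ℝ → ℝ),
        PointParticle.IsSmoothSolution m c β v₀ (PointParticle.gaussianDelta σ) φ₁ y₁ →
        PointParticle.IsSmoothSolution m c β v₀ (PointParticle.gaussianDelta σ) φ₂ y₂ →
        ∀ t : ℝ, 0 ≤ t → y₁ t = y₂ t ∧ ∀ x : ℝ, φ₁ x t = φ₂ x t)) ∧
    (|v₀| < c →
      -- the solution `(φ, y)` for the delta interaction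
      ∃ (φ : ℝ → ℝ → ℝ) (y : ℝ → ℝ),
        PointParticle.IsDeltaSolution m c β v₀ φ y ∧
        ContDiffOn ℝ ∞ (PointParticle.velocity y) (Ici 0) ∧
        (MonotoneOn (PointParticle.velocity y) (Ici 0) ∨
          AntitoneOn (PointParticle.velocity y) (Ici 0)) ∧
        PointParticle.UniformlySubsonic c y ∧
        (β ≠ 0 → ∃ A κ : ℝ, 0 < κ ∧ ∀ t : ℝ, 0 ≤ t →
          |PointParticle.velocity y t| ≤ A * Real.exp (-κ * t)) ∧
        (∀ (φ' : ℝ → ℝ → ℝ) (y' : ℝ → ℝ),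
          PointParticle.IsDeltaSolution m c β v₀ φ' y' →
          PointParticle.UniformlySubsonic c y' →
          ∀ t : ℝ, 0 ≤ t → y' t = y t ∧ ∀ x : ℝ, φ' x t = φ x t) ∧
        -- the smeared solutions converge to it as `σ → 0+`
        (∀ (Φ : ℝ → ℝ → ℝ → ℝ) (Y : ℝ → ℝ → ℝ),
          (∀ σ : ℝ, 0 < σ →
            PointParticle.IsSmoothSolution m c β v₀ (PointParticle.gaussianDelta σ)
              (Φ σ) (Y σ)) →
          ∀ T : ℝ, 0 < T →
            TendstoUniformlyOn (fun σ t => Y σ t) y (𝓝[>] (0 : ℝ)) (Icc 0 T) ∧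
            TendstoUniformlyOn (fun σ t => PointParticle.velocity (Y σ) t)
              (PointParticle.velocity y) (𝓝[>] (0 : ℝ)) (Icc 0 T) ∧
            TendstoUniformlyOn (fun σ (p : ℝ × ℝ) => Φ σ p.1 p.2)
              (fun p : ℝ × ℝ => φ p.1 p.2) (𝓝[>] (0 : ℝ)) (univ ×ˢ Icc 0 T))) := by
  refine ⟨fun σ hσ => ⟨PointParticle.exists_isSmoothSolution β v₀ hm hc hσ,
    fun φ₁ φ₂ y₁ y₂ h₁ h₂ t ht => h₁.unique hm hc hσ h₂ ht⟩, fun hv₀ => ?_⟩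
  have hb : 0 ≤ β ^ 2 / (2 * c * m) := by positivity
  obtain ⟨v, hvc, hvK, hv⟩ := PointParticle.exists_limit_velocity hb hv₀
  obtain ⟨hsol, hvel⟩ :=
    PointParticle.isDeltaSolution_of_limit_velocity hm hc hv₀ hvc hvK hv
  refine ⟨_, _, hsol, ?_, ?_, ⟨|v₀|, hv₀, fun t ht => by rw [hvel t ht]; exact hvK t⟩,
    fun hβ => ⟨|v₀|, β ^ 2 / (2 * c * m) / c ^ 2, by positivity, fun t ht => ?_⟩,
    fun φ' y' h' hsub t ht => h'.eq_of_subsonic hm hc hv₀ hvc hvK hv hsub ht,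
    fun Φ Y h T hT => ?_⟩
  · exact (PointParticle.limit_velocity_contDiffOn hv₀ hvc hvK hv).congr hvel
  · exact (PointParticle.limit_velocity_monotone hb hv₀ hvc hvK hv).imp
      (fun h => h.congr fun t ht => (hvel t ht).symm)
      (fun h => h.congr fun t ht => (hvel t ht).symm)
  · rw [hvel t ht]
    exact PointParticle.limit_velocity_decay hb hv₀ hvc hvK hv ht
  · obtain ⟨h1, h2, h3⟩ :=
      PointParticle.tendstoUniformlyOn_smoothSolutions hm hc hv₀ hvc hvK hv h hT
    exact ⟨h1, h2.congr_right fun t ht => (hvel t ht.1).symm, h3⟩
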